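/- Write $F\bullet G$ for the pair $(F,G)$, and for a map $\phi=u\bullet v$ of the plane put $\phi^{z}(\mathbf x)=z^{-1}\phi(z\mathbf x)$ $(z\neq0)$, $\phi^0(\mathbf x)=\mathbf x$. An open cone is an open set $C\subset\mathbb R^2\setminus\{0\}$ with $tC\subset C$ for all real $t\ne0$. A (smooth) projective flow on $C$ is a map $\phi$ such that $(z,\mathbf x)\mapsto\phi^z(\mathbf x)$ is $C^\infty$ near $\{0\}\times C$ (in particular $\lim_{z\to0}\phi^z(\mathbf x)=\mathbf x$) and $\phi^{z+w}=\phi^z\circ\phi^w$ for small $z,w$, locally uniformly on $C$; its vector field is $\frac{d}{dz}\phi^z(\mathbf x)|_{z=0}$. All identities between flows below are meant at the points $t\mathbf x$ with $\mathbf x\in C$ and $t\neq0$ small (locally uniformly in $\mathbf x$); flows commute if $\phi\circ\psi=\psi\circ\phi$ in this sense. "The orbits are given by $\mathscr W=\mathrm{const.}$" means that $\mathscr W(\phi^z(\mathbf x))$, with the value $\infty$ where the denominator of $\mathscr W$ vanishes, is independent of small $z$. **Proposition.** (1) There is a projective flow $\phi=u\bullet v$ on $\mathbb R^2\setminus\{0\}$,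 with $v(x,y)=u(y,x)$, vector field $(2x^2+xy)\bullet(xy+2y^2)$ and orbits $\frac{u^2v^2}{(u-v)^3}=\mathrm{const.}$, such that in the directions with $x\ne3y$, $y\ne3x$ $$u(x,y)=\frac{\left(\sqrt[3]{x+y\sqrt{\tfrac{y-3x+6x^2}{x-3y+6y^2}}}+\sqrt[3]{x-y\sqrt{\tfrac{y-3x+6x^2}{x-3y+6y^2}}}\right)x(x-y)}{\sqrt[3]{x-3y+6y^2}\,(y-3x+6x^2)}-\frac{2x^2}{y-3x+6x^2}$$ for a suitable choice of the complex radicals, in which the product of the three cube roots is $x-y$. In the directions with $(x-3y)(y-3x)>0$ the formula holds with the nonnegative square root and the real cube roots. (2) There is a projective flow $\psi=a\bullet b$ on $\{x\neq y\}$ with vector field $-\frac{xy^3}{(x-y)^2}\bullet\frac{3xy^3-2y^4}{(x-y)^2}$ and orbits $\frac{a^2}{3a-b}=\mathrm{const.}$, such that on the cone $xy(x-y)\ne0$ $$\frac{(9ax-8x^2-3ay)x^2y^2}{a(ay-3ax+3x^2)^2}=x-3y-6y^2,\qquad b=\frac{a^2(y-3x)}{x^2}+3a .$$ There $a$ is the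 only solution of the first equation with the boundary condition $a(xz,yz)/z\to x$ as $z\to0$ (locally uniformly), and $a$ and $b$ are algebraic functions of degree three over $\mathbb R(x,y)$. (3) The flows $\phi$ and $\psi$ commute. For all $z,w\in\mathbb R$ the map $U\bullet V=\phi^z\circ\psi^w$ is a projective flow on $\{x\ne y\}$ which commutes with $\phi$; its vector field is the sum of $z$ times that of $\phi$ and $w$ times that of $\psi$, and its orbits are given by $$\frac{U^2V^2}{z(V-U)^3+wV^2(3U-V)}=\frac{x^2y^2}{z(y-x)^3+wy^2(3x-y)}=\mathrm{const.}$$ (4) Conversely, let $\eta$ be a projective flow on any open cone $C$ which commutes with $\phi$, and suppose that the vector field of $\eta$ is rational or that the set of directions of $C$ in the real projective line is connected. Then $\eta=\phi^z\circ\psi^w$ for some $z,w\in\mathbb R$. -/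

import Mathlib

open Filter Topology
open scoped ContDiff

noncomputable section

/-- The iterate `φ^z(p) = z⁻¹ φ(z p)`, extended by `φ^0(p) = p`. -/
def iter (φ : ℝ × ℝ → ℝ × ℝ) (z : ℝ) (p : ℝ × ℝ) : ℝ × ℝ :=
  if z = 0 then p else z⁻¹ • φ (z • p)

/-- An open set of nonzero points of the plane which is invariant under multiplication by every
nonzero real number (an open set of directions). -/
def IsOpenCone (C : Set (ℝ × ℝ)) : Prop :=
  IsOpen C ∧ (0 : ℝ × ℝ) ∉ C ∧ ∀ p ∈ C, ∀ t : ℝ, t ≠ 0 → t • p ∈ C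

/-- The property `P` holds at the point `t p'` for all small `t ≠ 0` and all `p'` near `p`,
for every `p ∈ C`. -/
def NearZero (C : Set (ℝ × ℝ)) (P : ℝ × ℝ → Prop) : Prop :=
  ∀ p ∈ C, ∀ᶠ q : ℝ × (ℝ × ℝ) in 𝓝 ((0 : ℝ), p), q.1 ≠ 0 → P (q.1 • q.2)

/-- A smooth (local) projective flow on the open cone `C`. -/
structure IsProjectiveFlow (C : Set (ℝ × ℝ)) (φ : ℝ × ℝ → ℝ × ℝ) : Prop where
  cone : IsOpenCone C
  /-- Non-singularity: `φ(z p) / z` tends to `p` as `z → 0`. -/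
  boundary : ∀ p ∈ C, Tendsto (fun z : ℝ => z⁻¹ • φ (z • p)) (𝓝[≠] 0) (𝓝 p)
  /-- The map `(z, p) ↦ φ^z(p)` is of class `C^∞` near `{0} × C`. -/
  smooth : ∀ p ∈ C, ∃ O ∈ 𝓝 ((0 : ℝ), p),
    ContDiffOn ℝ ∞ (fun q : ℝ × (ℝ × ℝ) => iter φ q.1 q.2) O
  /-- The projective translation equation `φ^(z+w) = φ^z ∘ φ^w` for small `z`, `w`. -/
  translation : ∀ p ∈ C, ∀ᶠ q : ℝ × ℝ × (ℝ × ℝ) in 𝓝 ((0 : ℝ), (0 : ℝ), p),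
    iter φ (q.1 + q.2.1) q.2.2 = iter φ q.1 (iter φ q.2.1 q.2.2)

/-- `X` is the vector field of `φ`: the derivative of `φ(z p) / z` at `z = 0`. -/
def HasVectorField (C : Set (ℝ × ℝ)) (φ X : ℝ × ℝ → ℝ × ℝ) : Prop :=
  ∀ p ∈ C, HasDerivAt (fun z : ℝ => iter φ z p) (X p) 0

/-- `φ ∘ ψ = ψ ∘ φ` near the origin, along the directions in `C`. -/
def FlowsCommute (C : Set (ℝ × ℝ)) (φ ψ : ℝ × ℝ → ℝ × ℝ) : Prop :=
  NearZero C fun p => φ (ψ p) = ψ (φ p)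

/-- The map `φ^z ∘ ψ^w`. -/
def compIter (φ ψ : ℝ × ℝ → ℝ × ℝ) (z w : ℝ) : ℝ × ℝ → ℝ × ℝ :=
  fun p => iter φ z (iter ψ w p)

/-- The orbits of `φ` are given by `N / D = const`: the value of `N / D` at `φ^z(p)` does not
depend on (small) `z`, the points where `D` vanishes being those where `N / D` is infinite. -/
def OrbitsGivenBy (C : Set (ℝ × ℝ)) (φ : ℝ × ℝ → ℝ × ℝ) (N D : ℝ × ℝ → ℝ) : Prop :=
  ∀ p ∈ C, ∀ᶠ q : ℝ × (ℝ × ℝ) in 𝓝 ((0 : ℝ), p),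
    (D q.2 ≠ 0 → D (iter φ q.1 q.2) ≠ 0 ∧
      N (iter φ q.1 q.2) / D (iter φ q.1 q.2) = N q.2 / D q.2) ∧
    (D q.2 = 0 → D (iter φ q.1 q.2) = 0)

/-- The set of directions of `C`, a subset of the real projective line, is connected. -/
def HasConnectedDirections (C : Set (ℝ × ℝ)) : Prop :=
  ∃ S ⊆ C, IsPreconnected S ∧ ∀ p ∈ C, ∃ t : ℝ, t ≠ 0 ∧ t • p ∈ S

/-- The two coordinates of the vector field `X` are rational functions on `C`. -/
def IsRationalField (C : Set (ℝ × ℝ)) (X : ℝ × ℝ → ℝ × ℝ) : Prop :=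
  ∃ P₁ P₂ Q : MvPolynomial (Fin 2) ℝ, Q ≠ 0 ∧ ∀ p ∈ C,
    Q.eval ![p.1, p.2] * (X p).1 = P₁.eval ![p.1, p.2] ∧
    Q.eval ![p.1, p.2] * (X p).2 = P₂.eval ![p.1, p.2]

/-- `P(f(x,y), x, y)` for a polynomial `P` in one variable over `ℝ[x,y]`. -/
def evalAlong (P : Polynomial (MvPolynomial (Fin 2) ℝ)) (f : ℝ × ℝ → ℝ) (p : ℝ × ℝ) : ℝ :=
  (P.map (MvPolynomial.eval ![p.1, p.2])).eval (f p)

/-- Near the origin, `f` is an algebraic function of degree `n` over `ℝ(x,y)`: it is a root of a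
polynomial of degree `n` over `ℝ[x,y]`, and of no nonzero polynomial of smaller degree, not even
on a smaller open cone. -/
def IsAlgebraicOfDegree (C : Set (ℝ × ℝ)) (f : ℝ × ℝ → ℝ) (n : ℕ) : Prop :=
  (∃ P : Polynomial (MvPolynomial (Fin 2) ℝ), P ≠ 0 ∧ P.natDegree = n ∧
    NearZero C fun p => evalAlong P f p = 0) ∧
  ∀ (C' : Set (ℝ × ℝ)) (P : Polynomial (MvPolynomial (Fin 2) ℝ)),
    IsOpenCone C' → C'.Nonempty → C' ⊆ C → P ≠ 0 →
    (NearZero C' fun p => evalAlong P f p = 0) → n ≤ P.natDegree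

/-- The real cube root. -/
def cbrt (t : ℝ) : ℝ :=
  if 0 ≤ t then t ^ ((1 : ℝ) / 3) else -((-t) ^ ((1 : ℝ) / 3))

theorem cbrt_pow_three (t : ℝ) : cbrt t ^ 3 = t := by
  have key : ∀ s : ℝ, 0 ≤ s → (s ^ ((1 : ℝ) / 3)) ^ 3 = s := fun s hs => by
    rw [← Real.rpow_natCast, ← Real.rpow_mul hs]
    norm_num
  unfold cbrt
  split_ifs with h
  · exact key t h
  · have := key (-t) (by linarith)
    linarith [this, neg_pow (((-t) ^ ((1 : ℝ) / 3))) 3]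

/-- The Cardano-type expression for `u(x,y)`, with the nonnegative square root and real cube
roots. -/
def cardanoU (x y : ℝ) : ℝ :=
  (cbrt (x + y * √((y - 3 * x + 6 * x ^ 2) / (x - 3 * y + 6 * y ^ 2)))
      + cbrt (x - y * √((y - 3 * x + 6 * x ^ 2) / (x - 3 * y + 6 * y ^ 2)))) * (x * (x - y))
    / (cbrt (x - 3 * y + 6 * y ^ 2) * (y - 3 * x + 6 * x ^ 2))
  - 2 * x ^ 2 / (y - 3 * x + 6 * x ^ 2)

/-- `u` is a value of the same expression for some choice of the complex square root `s` and of
the complex cube roots `r₁`, `r₂`, `r₃`; as always in Cardano's formula, the cube roots are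
coupled, here by `r₁ r₂ r₃ = x - y`. -/
def IsCardanoValue (x y u : ℝ) : Prop :=
  y - 3 * x + 6 * x ^ 2 ≠ 0 ∧ x - 3 * y + 6 * y ^ 2 ≠ 0 ∧
  ∃ s r₁ r₂ r₃ : ℂ,
    s ^ 2 = ((y : ℂ) - 3 * x + 6 * x ^ 2) / ((x : ℂ) - 3 * y + 6 * y ^ 2) ∧
    r₁ ^ 3 = x + y * s ∧ r₂ ^ 3 = x - y * s ∧ r₃ ^ 3 = x - 3 * y + 6 * y ^ 2 ∧
    r₁ * r₂ * r₃ = x - y ∧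
    (u : ℂ) = (r₁ + r₂) * (x * (x - y)) / (r₃ * ((y : ℂ) - 3 * x + 6 * x ^ 2))
      - 2 * (x : ℂ) ^ 2 / ((y : ℂ) - 3 * x + 6 * x ^ 2)

/-- The cubic equation relating `a` to `x` and `y`. -/
def CubicEquation (a x y : ℝ) : Prop :=
  a * (a * y - 3 * a * x + 3 * x ^ 2) ^ 2 ≠ 0 ∧
  (9 * a * x - 8 * x ^ 2 - 3 * a * y) * x ^ 2 * y ^ 2
    / (a * (a * y - 3 * a * x + 3 * x ^ 2) ^ 2) = x - 3 * y - 6 * y ^ 2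

/-- The vector field `(2x² + xy) • (xy + 2y²)`. -/
def fieldPhi (p : ℝ × ℝ) : ℝ × ℝ :=
  (2 * p.1 ^ 2 + p.1 * p.2, p.1 * p.2 + 2 * p.2 ^ 2)

/-- The vector field `-xy³/(x-y)² • (3xy³-2y⁴)/(x-y)²`. -/
def fieldPsi (p : ℝ × ℝ) : ℝ × ℝ :=
  (-(p.1 * p.2 ^ 3) / (p.1 - p.2) ^ 2,
    (3 * p.1 * p.2 ^ 3 - 2 * p.2 ^ 4) / (p.1 - p.2) ^ 2)

/-- All directions. -/
def conePhi : Set (ℝ × ℝ) := {p | p ≠ 0}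

/-- The directions in which `fieldPsi` is defined. -/
def conePsi : Set (ℝ × ℝ) := {p | p.1 ≠ p.2}

/-- The directions with `x ≠ 0`, `y ≠ 0`, `x ≠ y`. -/
def coneGeneric : Set (ℝ × ℝ) := {p | p.1 ≠ 0 ∧ p.2 ≠ 0 ∧ p.1 ≠ p.2}

/-- The directions in which the radicals for `φ` are real near the origin: `x - 3y` and `y - 3x`
have the same sign. -/
def coneReal : Set (ℝ × ℝ) := {p | 0 < (p.1 - 3 * p.2) * (p.2 - 3 * p.1)}

end

/-!
In the coordinates `T₁ = (3x - y) / x²` and `T₂ = (3y - x) / y²`, which are homogeneous of degree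
`-1`, both flows are translations: `φ^z` is `(T₁, T₂) ↦ (T₁ - 6z, T₂ - 6z)` and `ψ^w` is `(T₁, T₂)
↦ (T₁, T₂ + 6w)`. Everything follows from this. As `T₁` and `T₂` have poles on the axes, the
translations are recorded by polynomial equations (`Shift`), which also hold there.

*Existence.* The flow of a quadratically homogeneous field is its time-one map (`flowMap`);
homogeneity turns the iterates `z⁻¹ φ(z p)` into the time-`z` maps. They are analytic near `z = 0`
by the implicit function theorem in the Banach algebra of paths, applied to `γ = q + z ∫ X(γ)`
(`HasAnalyticLift.exists_paths`, `iter_flowMap_regular`). Conversely, a projective flow follows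
the integral curves of its vector field, so that it is determined by that field
(`IsProjectiveFlow.nearZero_eq`).

*Orbits and commutation.* The function `T₁ - T₂ = (x - y)³ / (x² y²)` is invariant under `φ`, and
`T₁` is invariant under `ψ`; a combination of these is invariant under `φ^z ∘ ψ^w`
(`Shift.orbit_phi`, `Shift.orbit_psi`, `Shift.orbit_compIter`). Translations commute
(`eventually_iter_comm`).

*Algebraic formulas.* For `φ = (u, v)` the two equations give a cubic equation for the ratio `v /
u` without quadratic term in `v / u - 1`, which Cardano's formula solves
(`Shift.exists_cubic_root`). For `ψ = (a, b)`, elimination of `b` gives the cubic equation for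
`a`; its branch is unique since `x` is a simple root of the equation rescaled to the origin
(`cubicEquation_unique`). The degree is three since on a line through the origin the point of the
line, `a` and `b` are rational functions of the ratio `b / a`, and for infinitely many points of
the line three real ratios lie above the point, with three different values of `a` and of `b`
(`three_le_natDegree`).

*Classification.* Let `η` commute with `φ`, with vector field `Y`. Then `T ∘ η - T`, for `T = T₁,
T₂`, is invariant under `φ`. Its limit at the origin is the derivative of `T` along `Y`, which is
therefore invariant under `φ` and under scaling, hence locally constant
(`fderiv_fderiv_field_eq_zero`). So off the axes and the diagonal, `Y` is locally a combination of
the fields of `φ` and `ψ` with constant coefficients. The coefficients agree on both sides of an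
axis or of the diagonal by smoothness of `Y`, and on the diagonal, where the field of `ψ` has a
pole, that field does not occur (`exists_isFieldCombNear`). Connectedness or rationality makes the
coefficients global.
-/

/-! ### Iterates and integral curves -/

theorem iter_zero (φ : ℝ × ℝ → ℝ × ℝ) (p : ℝ × ℝ) : iter φ 0 p = p := by
  simp [iter]

theorem iter_of_ne {z : ℝ} (hz : z ≠ 0) (φ : ℝ × ℝ → ℝ × ℝ) (p : ℝ × ℝ) :
    iter φ z p = z⁻¹ • φ (z • p) := by
  simp [iter, hz]

theorem apply_smul_eq_smul_iter {t : ℝ} (ht : t ≠ 0) (φ : ℝ × ℝ → ℝ × ℝ) (p : ℝ × ℝ) :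
    φ (t • p) = t • iter φ t p := by
  rw [iter_of_ne ht, smul_inv_smul₀ ht]

theorem iter_smul {t : ℝ} (ht : t ≠ 0) (φ : ℝ × ℝ → ℝ × ℝ) (z : ℝ) (p : ℝ × ℝ) :
    iter φ z (t • p) = t • iter φ (z * t) p := by
  rcases eq_or_ne z 0 with rfl | hz
  · simp [iter_zero]
  · rw [iter_of_ne hz, iter_of_ne (mul_ne_zero hz ht), smul_smul, smul_smul]
    congr 1
    field_simp

/-- An integral curve of the field `X` leads from `q` to `q'` in time `1`, inside `C`. -/
def FlowsTo (X : ℝ × ℝ → ℝ × ℝ) (C : Set (ℝ × ℝ)) (q q' : ℝ × ℝ) : Prop :=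
  ∃ γ : ℝ → ℝ × ℝ, γ 0 = q ∧ γ 1 = q' ∧
    ∀ τ ∈ Set.Icc (0 : ℝ) 1, γ τ ∈ C ∧ HasDerivAt γ (X (γ τ)) τ

/-- The time-one map of the field `X` on `C`; its values are meaningless at the points from which
no integral curve of length `1` starts. -/
noncomputable def flowMap (X : ℝ × ℝ → ℝ × ℝ) (C : Set (ℝ × ℝ)) (q : ℝ × ℝ) : ℝ × ℝ :=
  Classical.epsilon (FlowsTo X C q)

/-- A quadratically homogeneous vector field of class `C¹` on an open cone. -/
structure IsQuadraticField (C : Set (ℝ × ℝ)) (X : ℝ × ℝ → ℝ × ℝ) : Prop where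
  cone : IsOpenCone C
  contDiffAt : ∀ p ∈ C, ContDiffAt ℝ 1 X p
  homogeneous : ∀ p ∈ C, ∀ t : ℝ, t ≠ 0 → X (t • p) = t ^ 2 • X p

section Flow

variable {X : ℝ × ℝ → ℝ × ℝ} {C : Set (ℝ × ℝ)}

/-- Two integral curves stay in a compact part of `C`, on which `X` is Lipschitz. -/
theorem FlowsTo.unique (hX : IsQuadraticField C X) {q q₁ q₂ : ℝ × ℝ}
    (h₁ : FlowsTo X C q q₁) (h₂ : FlowsTo X C q q₂) : q₁ = q₂ := by
  obtain ⟨γ, hγ0, hγ1, hγ⟩ := h₁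
  obtain ⟨δ, hδ0, hδ1, hδ⟩ := h₂
  have cγ : ContinuousOn γ (Set.Icc 0 1) :=
    fun τ hτ => (hγ τ hτ).2.continuousAt.continuousWithinAt
  have cδ : ContinuousOn δ (Set.Icc 0 1) :=
    fun τ hτ => (hδ τ hτ).2.continuousAt.continuousWithinAt
  set K := γ '' Set.Icc 0 1 ∪ δ '' Set.Icc 0 1 with hK
  have hKc : IsCompact K := (isCompact_Icc.image_of_continuousOn cγ).union
    (isCompact_Icc.image_of_continuousOn cδ)
  have hKC : K ⊆ C := by
    rintro _ (⟨τ, hτ, rfl⟩ | ⟨τ, hτ, rfl⟩)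
    exacts [(hγ τ hτ).1, (hδ τ hτ).1]
  have hL : LocallyLipschitzOn K X := by
    intro x hx
    obtain ⟨L, t, ht, hLt⟩ := (hX.contDiffAt x (hKC hx)).exists_lipschitzOnWith
    exact ⟨L, t, mem_nhdsWithin_of_mem_nhds ht, hLt⟩
  obtain ⟨L, hL⟩ := hL.exists_lipschitzOnWith_of_compact hKc
  have := ODE_solution_unique_of_mem_Icc_right (v := fun _ => X) (s := fun _ => K) (K := L)
    (fun _ _ => hL) cγ
    (fun t ht => (hγ t (Set.Ico_subset_Icc_self ht)).2.hasDerivWithinAt)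
    (fun t ht => Or.inl ⟨t, Set.Ico_subset_Icc_self ht, rfl⟩) cδ
    (fun t ht => (hδ t (Set.Ico_subset_Icc_self ht)).2.hasDerivWithinAt)
    (fun t ht => Or.inr ⟨t, Set.Ico_subset_Icc_self ht, rfl⟩) (hγ0.trans hδ0.symm)
  rw [← hγ1, ← hδ1]
  exact this (Set.right_mem_Icc.2 zero_le_one)

theorem flowMap_eq (hX : IsQuadraticField C X) {q q' : ℝ × ℝ} (h : FlowsTo X C q q') :
    flowMap X C q = q' :=
  FlowsTo.unique hX (Classical.epsilon_spec (p := FlowsTo X C q) ⟨q', h⟩) h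

/-- The iterates of the time-one map of `X` follow the integral curves of `X`. -/
theorem iter_flowMap_eq_of_hasDerivAt_mul (hX : IsQuadraticField C X) {z : ℝ} {q : ℝ × ℝ}
    {γ : ℝ → ℝ × ℝ} (h0 : γ 0 = q)
    (hγ : ∀ τ ∈ Set.Icc (0 : ℝ) 1, γ τ ∈ C ∧ HasDerivAt γ (z • X (γ τ)) τ)
    {τ : ℝ} (hτ : τ ∈ Set.Icc (0 : ℝ) 1) : iter (flowMap X C) (z * τ) q = γ τ := by
  rcases eq_or_ne (z * τ) 0 with h | h
  · rw [h, iter_zero, ← h0]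
    rcases mul_eq_zero.1 h with rfl | rfl
    · have hc : ContinuousOn γ (Set.Icc 0 τ) := fun s hs =>
        (hγ s ⟨hs.1, hs.2.trans hτ.2⟩).2.continuousAt.continuousWithinAt
      have := constant_of_has_deriv_right_zero hc (fun s hs => by
        have := (hγ s ⟨hs.1, hs.2.le.trans hτ.2⟩).2.hasDerivWithinAt (s := Set.Ici s)
        rwa [zero_smul] at this) τ ⟨hτ.1, le_rfl⟩
      exact this.symm
    · rfl
  · rw [iter_of_ne h, inv_smul_eq_iff₀ h]
    refine flowMap_eq hX ⟨fun σ => (z * τ) • γ (τ * σ), by simp [h0], by simp, fun σ hσ => ?_⟩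
    have hm : τ * σ ∈ Set.Icc (0 : ℝ) 1 :=
      ⟨mul_nonneg hτ.1 hσ.1, mul_le_one₀ hτ.2 hσ.1 hσ.2⟩
    obtain ⟨hC, hd⟩ := hγ _ hm
    refine ⟨hX.cone.2.2 _ hC _ h, ?_⟩
    rw [hX.homogeneous _ hC _ h]
    have h1 : HasDerivAt (fun σ : ℝ => τ * σ) τ σ := by
      simpa using (hasDerivAt_id σ).const_mul τ
    have h2 := (hd.scomp σ h1).const_smul (z * τ)
    have h3 : (z * τ) ^ 2 • X (γ (τ * σ)) = (z * τ) • τ • z • X (γ (τ * σ)) := by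
      simp only [smul_smul]
      congr 1
      ring
    rw [h3]
    exact h2

theorem iter_flowMap_eq (hX : IsQuadraticField C X) {z : ℝ} {q : ℝ × ℝ}
    {g : ℝ → ℝ × ℝ} (h0 : g 0 = q)
    (hg : ∀ s : ℝ, |s| ≤ |z| → g s ∈ C ∧ HasDerivAt g (X (g s)) s) :
    iter (flowMap X C) z q = g z := by
  have := iter_flowMap_eq_of_hasDerivAt_mul hX (z := z) (q := q) (γ := fun τ => g (z * τ))
    (by simpa using h0) (fun τ hτ => by
      have hm : |z * τ| ≤ |z| := by
        rw [abs_mul]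
        exact mul_le_of_le_one_right (abs_nonneg z) (by rw [abs_of_nonneg hτ.1]; exact hτ.2)
      refine ⟨(hg _ hm).1, ?_⟩
      have h1 : HasDerivAt (fun σ : ℝ => z * σ) z τ := by
        simpa using (hasDerivAt_id τ).const_mul z
      exact (hg _ hm).2.scomp τ h1) (τ := 1) (by simp)
  simpa using this

/-- Neighbourhoods of `(0, p)` contain boxes. -/
theorem exists_box {P : ℝ × (ℝ × ℝ) → Prop} {p : ℝ × ℝ} (h : ∀ᶠ q in 𝓝 ((0 : ℝ), p), P q) :
    ∃ ε > 0, ∀ s : ℝ, |s| < ε → ∀ q : ℝ × ℝ, dist q p < ε → P (s, q) := by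
  obtain ⟨ε, hε, h⟩ := Metric.eventually_nhds_iff.1 h
  refine ⟨ε, hε, fun s hs q hq => h ?_⟩
  rw [Prod.dist_eq]
  exact max_lt (by simpa using hs) hq

theorem eventually_of_box {P : ℝ × (ℝ × ℝ) → Prop} {p : ℝ × ℝ} {ε : ℝ} (hε : 0 < ε)
    (h : ∀ s : ℝ, |s| < ε → ∀ q : ℝ × ℝ, dist q p < ε → P (s, q)) :
    ∀ᶠ q in 𝓝 ((0 : ℝ), p), P q := by
  refine Metric.eventually_nhds_iff.2 ⟨ε, hε, fun {q} hq => ?_⟩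
  rw [Prod.dist_eq, max_lt_iff] at hq
  exact h q.1 (by simpa using hq.1) q.2 hq.2

/-- If `g` is a family of integral curves of `X`, then it is the family of iterates of the
time-one map. -/
theorem eventually_iter_flowMap_eq (hX : IsQuadraticField C X) {p : ℝ × ℝ}
    {g : ℝ → ℝ × ℝ → ℝ × ℝ} (h0 : ∀ q, g 0 q = q)
    (hg : ∀ᶠ q in 𝓝 ((0 : ℝ), p), g q.1 q.2 ∈ C ∧
      HasDerivAt (fun s => g s q.2) (X (g q.1 q.2)) q.1) :
    ∀ᶠ q in 𝓝 ((0 : ℝ), p), iter (flowMap X C) q.1 q.2 = g q.1 q.2 := by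
  obtain ⟨ε, hε, h⟩ := exists_box hg
  exact eventually_of_box hε fun s hs q hq =>
    iter_flowMap_eq hX (h0 q) fun t ht => h t (ht.trans_lt hs) q hq

end Flow

/-! ### Integral curves as solutions of an equation between paths -/

/-- Real-valued paths, a Banach algebra. -/
abbrev RealPath : Type := C(unitInterval, ℝ)

/-- The primitive of a path vanishing at `0`. -/
noncomputable def pathIntegral : RealPath →L[ℝ] RealPath :=
  LinearMap.mkContinuous
    { toFun := fun f => ⟨fun τ => ∫ s in (0 : ℝ)..τ, f (Set.projIcc 0 1 zero_le_one s), by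
        have : Continuous fun b : ℝ => ∫ s in (0 : ℝ)..b, f (Set.projIcc 0 1 zero_le_one s) :=
          intervalIntegral.continuous_primitive (fun a b =>
            (f.continuous.comp continuous_projIcc).intervalIntegrable a b) 0
        exact this.comp continuous_subtype_val⟩
      map_add' := fun f g => by
        ext τ
        exact intervalIntegral.integral_add
          ((f.continuous.comp continuous_projIcc).intervalIntegrable _ _)
          ((g.continuous.comp continuous_projIcc).intervalIntegrable _ _)
      map_smul' := fun c f => by
        ext τ
        exact intervalIntegral.integral_smul c _ } 1 (fun f => by
    refine (ContinuousMap.norm_le _ (by positivity)).2 fun τ => ?_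
    have := intervalIntegral.norm_integral_le_of_norm_le_const (a := (0 : ℝ)) (b := τ)
      (f := fun s => f (Set.projIcc 0 1 zero_le_one s)) (C := ‖f‖)
      (fun s _ => f.norm_coe_le_norm _)
    refine this.trans ?_
    rw [sub_zero, abs_of_nonneg τ.2.1, one_mul]
    exact mul_le_of_le_one_right (norm_nonneg f) τ.2.2)

theorem pathIntegral_apply (f : RealPath) (τ : unitInterval) :
    pathIntegral f τ = ∫ s in (0 : ℝ)..τ, f (Set.projIcc 0 1 zero_le_one s) := rfl

/-- The constant path at `p`. -/
noncomputable def constPath (p : ℝ × ℝ) : RealPath × RealPath :=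
  (p.1 • (1 : RealPath), p.2 • (1 : RealPath))

/-- Composition with the field `X` is, near the constant path at `p`, an analytic map of the space
of paths in the plane. -/
def HasAnalyticLift (X : ℝ × ℝ → ℝ × ℝ) (p : ℝ × ℝ) : Prop :=
  ∃ L : RealPath × RealPath → RealPath × RealPath, ContDiffAt ℝ ω L (constPath p) ∧
    ∀ᶠ γ in 𝓝 (constPath p), ∀ τ, ((L γ).1 τ, (L γ).2 τ) = X (γ.1 τ, γ.2 τ)

/-- The implicit function theorem in the space of paths, applied to `γ = q + z ∫ X(γ)` at `z = 0`,
where the equation reads `γ = q`. -/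
theorem HasAnalyticLift.exists_paths {X : ℝ × ℝ → ℝ × ℝ} {p : ℝ × ℝ}
    (h : HasAnalyticLift X p) :
    ∃ Γ : ℝ × (ℝ × ℝ) → RealPath × RealPath, ContDiffAt ℝ ω Γ (0, p) ∧ Γ (0, p) = constPath p ∧
      ∀ᶠ u in 𝓝 ((0 : ℝ), p), ∀ τ : unitInterval, ((Γ u).1 τ, (Γ u).2 τ) =
        u.2 + u.1 • ∫ s in (0 : ℝ)..τ, X ((Γ u).1 (Set.projIcc 0 1 zero_le_one s),
          (Γ u).2 (Set.projIcc 0 1 zero_le_one s)) := by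
  obtain ⟨L, hL, hLX⟩ := h
  let G : (ℝ × (ℝ × ℝ)) × (RealPath × RealPath) → RealPath × RealPath := fun v =>
    (v.2.1 - v.1.2.1 • (1 : RealPath) - v.1.1 • pathIntegral (L v.2).1,
      v.2.2 - v.1.2.2 • (1 : RealPath) - v.1.1 • pathIntegral (L v.2).2)
  let v₀ : (ℝ × (ℝ × ℝ)) × (RealPath × RealPath) := ((0, p), constPath p)
  have hL' : ContDiffAt ℝ ω (fun v : (ℝ × (ℝ × ℝ)) × (RealPath × RealPath) => L v.2) v₀ :=
    ContDiffAt.comp v₀ (f := Prod.snd) (g := L) hL contDiffAt_snd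
  have hG : ContDiffAt ℝ ω G v₀ := by
    have h1 : ContDiffAt ℝ ω (fun v : (ℝ × (ℝ × ℝ)) × (RealPath × RealPath) => v.1.1) v₀ := by
      fun_prop
    refine ContDiffAt.prodMk ?_ ?_
    · exact ContDiffAt.sub (by fun_prop) (h1.smul
        (pathIntegral.contDiff.contDiffAt.comp v₀ (contDiffAt_fst.comp v₀ hL')))
    · exact ContDiffAt.sub (by fun_prop) (h1.smul
        (pathIntegral.contDiff.contDiffAt.comp v₀ (contDiffAt_snd.comp v₀ hL')))
  have hne : (ω : WithTop ℕ∞) ≠ 0 := by simp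
  have hG0 : G v₀ = 0 := by simp [G, v₀, constPath]
  have hder : fderiv ℝ G v₀ ∘L .inr ℝ (ℝ × (ℝ × ℝ)) (RealPath × RealPath) =
      ContinuousLinearMap.id ℝ _ := by
    have h1 : HasFDerivAt (fun γ : RealPath × RealPath => G ((0, p), γ))
        (fderiv ℝ G v₀ ∘L .inr ℝ (ℝ × (ℝ × ℝ)) (RealPath × RealPath)) (constPath p) :=
      HasFDerivAt.comp (constPath p) (f := fun γ => (((0 : ℝ), p), γ)) (g := G)
        (hG.differentiableAt hne).hasFDerivAt (hasFDerivAt_prodMk_right _ _)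
    have h2 : (fun γ : RealPath × RealPath => G ((0, p), γ)) = fun γ => γ - constPath p := by
      funext γ
      simp only [G, constPath, zero_smul, sub_zero]
      rfl
    rw [h2] at h1
    exact h1.unique ((hasFDerivAt_id _).sub_const _)
  have hinv : (fderiv ℝ G v₀ ∘L .inr ℝ (ℝ × (ℝ × ℝ)) (RealPath × RealPath)).IsInvertible := by
    rw [hder]
    exact ⟨ContinuousLinearEquiv.refl ℝ _, rfl⟩
  have hΓ := hG.contDiffAt_implicitFunction hne hinv
  have hΓ0 : hG.implicitFunction hne hinv (0, p) = constPath p :=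
    hG.implicitFunction_apply_self hne hinv
  refine ⟨hG.implicitFunction hne hinv, hΓ, hΓ0, ?_⟩
  have hlim : Tendsto (hG.implicitFunction hne hinv) (𝓝 (0, p)) (𝓝 (constPath p)) := by
    have := hΓ.continuousAt.tendsto
    rwa [show v₀.1 = (0, p) from rfl, hΓ0] at this
  filter_upwards [hG.eventually_apply_implicitFunction hne hinv, hlim.eventually hLX] with u h1 h2
  intro τ
  set γ := hG.implicitFunction hne hinv u with hγ
  rw [hG0] at h1
  have hint : ∀ f : RealPath, IntervalIntegrable
      (fun s => f (Set.projIcc 0 1 zero_le_one s)) MeasureTheory.volume 0 τ := fun f =>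
    (f.continuous.comp continuous_projIcc).intervalIntegrable _ _
  have e1 := congrArg (fun g => g τ) (congrArg Prod.fst h1)
  have e2 := congrArg (fun g => g τ) (congrArg Prod.snd h1)
  simp only [G, ContinuousMap.sub_apply, ContinuousMap.smul_apply, ContinuousMap.one_apply,
    Prod.fst_zero, Prod.snd_zero, ContinuousMap.zero_apply, pathIntegral_apply, smul_eq_mul,
    mul_one] at e1 e2
  simp_rw [← h2]
  rw [intervalIntegral.integral_of_le τ.2.1]
  rw [intervalIntegral.integral_of_le τ.2.1] at e1 e2
  rw [integral_pair ((intervalIntegrable_iff_integrableOn_Ioc_of_le τ.2.1).1 (hint (L γ).1))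
    ((intervalIntegrable_iff_integrableOn_Ioc_of_le τ.2.1).1 (hint (L γ).2))]
  ext
  · simp only [Prod.fst_add, Prod.smul_fst, smul_eq_mul]
    linarith
  · simp only [Prod.snd_add, Prod.smul_snd, smul_eq_mul]
    linarith

/-! ### The flow of a homogeneous field -/

section RegularFlow

variable {X : ℝ × ℝ → ℝ × ℝ} {C : Set (ℝ × ℝ)}

theorem eventually_path_mem (hC : IsOpen C) {p : ℝ × ℝ} (hp : p ∈ C) :
    ∀ᶠ γ in 𝓝 (constPath p), ∀ τ, (γ.1 τ, γ.2 τ) ∈ C := by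
  obtain ⟨ε, hε, hb⟩ := Metric.isOpen_iff.1 hC p hp
  filter_upwards [Metric.ball_mem_nhds (constPath p) hε] with γ hγ τ
  apply hb
  rw [Metric.mem_ball, Prod.dist_eq, max_lt_iff] at hγ ⊢
  constructor
  · refine lt_of_le_of_lt ?_ hγ.1
    simpa [constPath] using ContinuousMap.dist_apply_le_dist (f := γ.1) (g := (constPath p).1) τ
  · refine lt_of_le_of_lt ?_ hγ.2
    simpa [constPath] using ContinuousMap.dist_apply_le_dist (f := γ.2) (g := (constPath p).2) τ

/-- The time-one maps of a homogeneous field are analytic in `(z, p)` near `z = 0`: they are the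
end points of the paths given by the implicit function theorem, and these paths are integral
curves. -/
theorem iter_flowMap_regular (hX : IsQuadraticField C X) (hL : ∀ p ∈ C, HasAnalyticLift X p)
    {p : ℝ × ℝ} (hp : p ∈ C) : ∀ᶠ u in 𝓝 ((0 : ℝ), p),
      ContDiffAt ℝ ω (fun q : ℝ × (ℝ × ℝ) => iter (flowMap X C) q.1 q.2) u ∧
      iter (flowMap X C) u.1 u.2 ∈ C ∧
      HasDerivAt (fun s => iter (flowMap X C) s u.2) (X (iter (flowMap X C) u.1 u.2)) u.1 := by
  obtain ⟨Γ, hΓ, hΓ0, hΓe⟩ := (hL p hp).exists_paths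
  have hlim : Tendsto Γ (𝓝 (0, p)) (𝓝 (constPath p)) := by
    have := hΓ.continuousAt.tendsto
    rwa [hΓ0] at this
  -- the path `Γ u`, parametrized by the whole line, is an integral curve of `u.1 • X`
  have hcurve : ∀ᶠ u in 𝓝 ((0 : ℝ), p), ∃ γ : ℝ → ℝ × ℝ,
      (γ 1 = ((Γ u).1 1, (Γ u).2 1)) ∧ ∀ τ ∈ Set.Icc (0 : ℝ) 1, γ τ ∈ C ∧
        HasDerivAt γ (u.1 • X (γ τ)) τ ∧ iter (flowMap X C) (u.1 * τ) u.2 = γ τ := by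
    filter_upwards [hΓe, hlim.eventually (eventually_path_mem hX.cone.1 hp)] with u hu huC
    set c : ℝ → ℝ × ℝ := fun s => ((Γ u).1 (Set.projIcc 0 1 zero_le_one s),
          (Γ u).2 (Set.projIcc 0 1 zero_le_one s)) with hc
    have hcC : ∀ s, c s ∈ C := fun s => huC _
    have hcc : Continuous c := by
      rw [hc]
      exact ((Γ u).1.continuous.comp continuous_projIcc).prodMk
        ((Γ u).2.continuous.comp continuous_projIcc)
    have hXc : Continuous fun s => X (c s) := continuous_iff_continuousAt.2 fun s =>
      ContinuousAt.comp (hX.contDiffAt _ (hcC s)).continuousAt hcc.continuousAt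
    set γ : ℝ → ℝ × ℝ := fun τ => u.2 + u.1 • ∫ s in (0 : ℝ)..τ, X (c s) with hγ
    have hγc : ∀ τ ∈ Set.Icc (0 : ℝ) 1, γ τ = c τ := fun τ hτ => by
      have := hu ⟨τ, hτ⟩
      simp only [hγ, hc, Set.projIcc_of_mem zero_le_one hτ]
      exact this.symm
    have hd : ∀ τ ∈ Set.Icc (0 : ℝ) 1, γ τ ∈ C ∧ HasDerivAt γ (u.1 • X (γ τ)) τ := by
      intro τ hτ
      rw [hγc τ hτ]
      refine ⟨hcC τ, ?_⟩
      exact ((intervalIntegral.integral_hasDerivAt_right (hXc.intervalIntegrable _ _)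
        (hXc.stronglyMeasurableAtFilter _ _) hXc.continuousAt).const_smul u.1).const_add u.2
    refine ⟨γ, ?_, fun τ hτ => ⟨(hd τ hτ).1, (hd τ hτ).2, ?_⟩⟩
    · rw [hγc 1 (by simp)]
      simp [hc]
    · exact iter_flowMap_eq_of_hasDerivAt_mul hX (by simp [hγ]) hd hτ
  have heq : (fun q : ℝ × (ℝ × ℝ) => iter (flowMap X C) q.1 q.2) =ᶠ[𝓝 (0, p)]
      fun u => ((Γ u).1 1, (Γ u).2 1) := by
    filter_upwards [hcurve] with u hu
    obtain ⟨γ, h1, h2⟩ := hu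
    have := (h2 1 (by simp)).2.2
    rw [mul_one] at this
    rw [this, h1]
  have hsm : ContDiffAt ℝ ω (fun q : ℝ × (ℝ × ℝ) => iter (flowMap X C) q.1 q.2) (0, p) := by
    refine ContDiffAt.congr_of_eventuallyEq ?_ heq
    have ev : ContDiff ℝ ω fun f : RealPath => f 1 :=
      (ContinuousMap.evalCLM ℝ (1 : unitInterval) : RealPath →L[ℝ] ℝ).contDiff
    exact (ev.contDiffAt.comp _ (contDiffAt_fst.comp _ hΓ)).prodMk
      (ev.contDiffAt.comp _ (contDiffAt_snd.comp _ hΓ))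
  obtain ⟨ε, hε, hbox⟩ := exists_box ((hsm.eventually (by simp)).and hcurve)
  have key : ∀ z : ℝ, z ≠ 0 → |z| < ε → ∀ q, dist q p < ε → ∀ τ ∈ Set.Icc (0 : ℝ) 1,
      HasDerivAt (fun s => iter (flowMap X C) s q) (X (iter (flowMap X C) (z * τ) q)) (z * τ) := by
    intro z hz hzε q hq τ hτ
    obtain ⟨-, γ, -, hγ⟩ := hbox z hzε q hq
    have hzτ : |z * τ| < ε := by
      rw [abs_mul, abs_of_nonneg hτ.1]
      exact (mul_le_of_le_one_right (abs_nonneg z) hτ.2).trans_lt hzε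
    have hdiff : DifferentiableAt ℝ (fun s => iter (flowMap X C) s q) (z * τ) := by
      have h1 := ((hbox _ hzτ q hq).1.differentiableAt (by simp))
      have h2 : DifferentiableAt ℝ (fun s : ℝ => (s, q)) (z * τ) := by fun_prop
      exact DifferentiableAt.comp (z * τ) (f := fun s : ℝ => (s, q)) h1 h2
    have hD := hdiff.hasDerivAt
    have h1 : HasDerivAt (fun σ : ℝ => z * σ) z τ := by
      simpa using (hasDerivAt_id τ).const_mul z
    have h2 := (hD.scomp τ h1).hasDerivWithinAt (s := Set.Icc 0 1)
    have h3 := (hγ τ hτ).2.1.hasDerivWithinAt (s := Set.Icc 0 1)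
    have h4 : HasDerivWithinAt ((fun s => iter (flowMap X C) s q) ∘ fun σ => z * σ)
        (z • X (γ τ)) (Set.Icc 0 1) τ :=
      h3.congr (fun σ hσ => (hγ σ hσ).2.2) (hγ τ hτ).2.2
    have h5 := UniqueDiffWithinAt.eq_deriv _ (uniqueDiffOn_Icc zero_lt_one τ hτ) h2 h4
    rw [smul_right_injective _ hz h5, ← (hγ τ hτ).2.2] at hD
    exact hD
  refine eventually_of_box hε fun s hs q hq => ?_
  obtain ⟨hs1, γ, -, hγ⟩ := hbox s hs q hq
  refine ⟨hs1, ?_, ?_⟩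
  · have := hγ 1 (by simp)
    rw [mul_one] at this
    rw [this.2.2]
    exact this.1
  · rcases eq_or_ne s 0 with rfl | h0
    · have := key (ε / 2) (by positivity) (by rw [abs_of_pos (by positivity)]; linarith) q hq 0
        (by simp)
      rwa [mul_zero] at this
    · have := key s h0 hs q hq 1 (by simp)
      rwa [mul_one] at this

theorem iter_flowMap_tendsto (hX : IsQuadraticField C X) (hL : ∀ p ∈ C, HasAnalyticLift X p)
    {p : ℝ × ℝ} (hp : p ∈ C) :
    Tendsto (fun q : ℝ × (ℝ × ℝ) => iter (flowMap X C) q.1 q.2) (𝓝 (0, p)) (𝓝 p) := by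
  have := (iter_flowMap_regular hX hL hp).self_of_nhds.1.continuousAt.tendsto
  simpa only [iter_zero] using this

theorem isProjectiveFlow_flowMap (hX : IsQuadraticField C X)
    (hL : ∀ p ∈ C, HasAnalyticLift X p) : IsProjectiveFlow C (flowMap X C) where
  cone := hX.cone
  boundary p hp := by
    have h1 : Tendsto (fun z : ℝ => iter (flowMap X C) z p) (𝓝[≠] 0) (𝓝 p) :=
      (iter_flowMap_tendsto hX hL hp).comp
        (((Continuous.prodMk_left p).tendsto' (0 : ℝ) (0, p) rfl).mono_left nhdsWithin_le_nhds)
    refine h1.congr' ?_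
    filter_upwards [self_mem_nhdsWithin] with z hz
    exact iter_of_ne hz _ _
  smooth p hp := by
    refine ⟨_, iter_flowMap_regular hX hL hp, fun u hu => ?_⟩
    exact (hu.1.of_le le_top).contDiffWithinAt
  translation p hp := by
    obtain ⟨ε, hε, hbox⟩ := exists_box (iter_flowMap_regular hX hL hp)
    have hev : ∀ᶠ q : ℝ × ℝ × (ℝ × ℝ) in 𝓝 ((0 : ℝ), (0 : ℝ), p),
        |q.1| < ε / 2 ∧ |q.2.1| < ε / 2 ∧ dist q.2.2 p < ε := by
      have c1 : Continuous fun q : ℝ × ℝ × (ℝ × ℝ) => |q.1| := by fun_prop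
      have c2 : Continuous fun q : ℝ × ℝ × (ℝ × ℝ) => |q.2.1| := by fun_prop
      have c3 : Continuous fun q : ℝ × ℝ × (ℝ × ℝ) => dist q.2.2 p := by fun_prop
      refine (c1.continuousAt.eventually_lt continuousAt_const ?_).and
        ((c2.continuousAt.eventually_lt continuousAt_const ?_).and
          (c3.continuousAt.eventually_lt continuousAt_const ?_))
      · simpa using hε
      · simpa using hε
      · simpa using hε
    filter_upwards [hev] with q ⟨h1, h2, h3⟩
    refine (iter_flowMap_eq hX (g := fun s => iter (flowMap X C) (s + q.2.1) q.2.2)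
      (by simp) fun s hs => ?_).symm
    have hb : |s + q.2.1| < ε := by
      have := abs_add_le s q.2.1
      linarith
    obtain ⟨-, hC, hd⟩ := hbox _ hb _ h3
    exact ⟨hC, hd.comp_add_const s q.2.1⟩

theorem hasVectorField_flowMap (hX : IsQuadraticField C X)
    (hL : ∀ p ∈ C, HasAnalyticLift X p) : HasVectorField C (flowMap X C) X := fun p hp => by
  have := (iter_flowMap_regular hX hL hp).self_of_nhds.2.2
  simpa only [iter_zero] using this

end RegularFlow

/-! ### General projective flows -/

section ProjectiveFlow

variable {C : Set (ℝ × ℝ)} {η : ℝ × ℝ → ℝ × ℝ}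

theorem IsOpenCone.inter {D : Set (ℝ × ℝ)} (hC : IsOpenCone C) (hD : IsOpenCone D) :
    IsOpenCone (C ∩ D) :=
  ⟨hC.1.inter hD.1, fun h => hC.2.1 h.1, fun p hp t ht => ⟨hC.2.2 p hp.1 t ht, hD.2.2 p hp.2 t ht⟩⟩

theorem IsProjectiveFlow.mono {D : Set (ℝ × ℝ)} (h : IsProjectiveFlow C η) (hD : IsOpenCone D)
    (hDC : D ⊆ C) : IsProjectiveFlow D η where
  cone := hD
  boundary p hp := h.boundary p (hDC hp)
  smooth p hp := h.smooth p (hDC hp)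
  translation p hp := h.translation p (hDC hp)

theorem IsProjectiveFlow.contDiffAt (h : IsProjectiveFlow C η) {p : ℝ × ℝ} (hp : p ∈ C) :
    ∀ᶠ u in 𝓝 ((0 : ℝ), p), ContDiffAt ℝ ∞ (fun q : ℝ × (ℝ × ℝ) => iter η q.1 q.2) u := by
  obtain ⟨O, hO, hd⟩ := h.smooth p hp
  filter_upwards [eventually_mem_nhds_iff.2 hO] with u hu
  exact hd.contDiffAt hu

theorem IsProjectiveFlow.tendsto_iter (h : IsProjectiveFlow C η) {p : ℝ × ℝ} (hp : p ∈ C) :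
    Tendsto (fun q : ℝ × (ℝ × ℝ) => iter η q.1 q.2) (𝓝 (0, p)) (𝓝 p) := by
  have := (h.contDiffAt hp).self_of_nhds.continuousAt.tendsto
  simpa only [iter_zero] using this

theorem IsProjectiveFlow.hasVectorField_deriv (h : IsProjectiveFlow C η) :
    HasVectorField C η fun p => deriv (fun z : ℝ => iter η z p) 0 := fun p hp => by
  have h1 := (h.contDiffAt hp).self_of_nhds.differentiableAt (by simp)
  have h2 : DifferentiableAt ℝ (fun s : ℝ => (s, p)) 0 := by fun_prop
  exact (DifferentiableAt.comp (0 : ℝ) (f := fun s : ℝ => (s, p)) h1 h2).hasDerivAt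

/-- A projective flow follows the integral curves of its vector field. -/
theorem IsProjectiveFlow.eventually_hasDerivAt (h : IsProjectiveFlow C η) {Y : ℝ × ℝ → ℝ × ℝ}
    (hY : HasVectorField C η Y) {p : ℝ × ℝ} (hp : p ∈ C) : ∀ᶠ u in 𝓝 ((0 : ℝ), p),
      iter η u.1 u.2 ∈ C ∧ HasDerivAt (fun s => iter η s u.2) (Y (iter η u.1 u.2)) u.1 := by
  have ht : ∀ᶠ u in 𝓝 ((0 : ℝ), p), ∀ᶠ s in 𝓝 (0 : ℝ),
      iter η (s + u.1) u.2 = iter η s (iter η u.1 u.2) := by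
    have h1 : Continuous fun v : (ℝ × (ℝ × ℝ)) × ℝ => (v.2, v.1.1, v.1.2) := by fun_prop
    have h2 := (h1.tendsto' ((0, p), 0) (0, 0, p) rfl).eventually (h.translation p hp)
    rw [nhds_prod_eq] at h2
    exact h2.curry
  filter_upwards [ht, h.tendsto_iter hp (h.cone.1.mem_nhds hp)] with u h1 h2
  refine ⟨h2, ?_⟩
  have h3 : HasDerivAt (fun s => iter η (s + u.1) u.2) (Y (iter η u.1 u.2)) 0 :=
    (hY _ h2).congr_of_eventuallyEq h1
  rw [← sub_self u.1] at h3
  simpa only [sub_add_cancel] using h3.comp_sub_const u.1 u.1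

/-- A projective flow is determined by its vector field. -/
theorem IsProjectiveFlow.eventually_iter_eq (h : IsProjectiveFlow C η) {Y : ℝ × ℝ → ℝ × ℝ}
    (hY : HasVectorField C η Y) (hq : IsQuadraticField C Y) {p : ℝ × ℝ} (hp : p ∈ C) :
    ∀ᶠ u in 𝓝 ((0 : ℝ), p), iter (flowMap Y C) u.1 u.2 = iter η u.1 u.2 :=
  eventually_iter_flowMap_eq hq (iter_zero η) (h.eventually_hasDerivAt hY hp)

/-- The vector field of a projective flow is smooth. -/
theorem IsProjectiveFlow.contDiffAt_field (h : IsProjectiveFlow C η) {Y : ℝ × ℝ → ℝ × ℝ}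
    (hY : HasVectorField C η Y) {p : ℝ × ℝ} (hp : p ∈ C) : ContDiffAt ℝ ∞ Y p := by
  have h1 : ContDiffAt ℝ ∞ (fun q : ℝ × ℝ =>
      fderiv ℝ (fun q : ℝ × (ℝ × ℝ) => iter η q.1 q.2) (0, q) (1, 0)) p := by
    have h2 := ((h.contDiffAt hp).self_of_nhds.fderiv_right (m := ∞) (by simp))
    have h3 : ContDiffAt ℝ ∞ (fun q : ℝ × ℝ => ((0 : ℝ), q)) p := by fun_prop
    exact (ContDiffAt.comp p (f := fun q : ℝ × ℝ => ((0 : ℝ), q)) h2 h3).clm_apply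
      contDiffAt_const
  refine h1.congr_of_eventuallyEq ?_
  filter_upwards [h.cone.1.mem_nhds hp] with q hq
  have h2 := ((h.contDiffAt hq).self_of_nhds.differentiableAt (by simp)).hasFDerivAt
  have h3 : HasDerivAt (fun s : ℝ => (s, q)) ((1 : ℝ), (0 : ℝ × ℝ)) 0 :=
    (hasDerivAt_id _).prodMk (hasDerivAt_const _ _)
  have h4 := HasFDerivAt.comp_hasDerivAt (f := fun s : ℝ => (s, q)) (0 : ℝ) h2 h3
  exact (hY q hq).unique h4

theorem IsProjectiveFlow.field_smul (h : IsProjectiveFlow C η) {Y : ℝ × ℝ → ℝ × ℝ}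
    (hY : HasVectorField C η Y) {p : ℝ × ℝ} (hp : p ∈ C) {t : ℝ} (ht : t ≠ 0) :
    Y (t • p) = t ^ 2 • Y p := by
  have h1 := hY (t • p) (h.cone.2.2 p hp t ht)
  have h2 : HasDerivAt (fun z => t • iter η (z * t) p) (t • t • Y p) 0 := by
    have h3 : HasDerivAt (fun z : ℝ => z * t) t 0 := by
      simpa using (hasDerivAt_id (0 : ℝ)).mul_const t
    have h4 : HasDerivAt (fun z : ℝ => iter η z p) (Y p) (0 * t) := by
      rw [zero_mul]
      exact hY p hp
    exact (h4.scomp 0 h3).const_smul t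
  rw [show (fun z => iter η z (t • p)) = fun z => t • iter η (z * t) p from
    funext fun z => iter_smul ht η z p] at h1
  rw [h1.unique h2, smul_smul, sq]

theorem IsProjectiveFlow.isQuadraticField (h : IsProjectiveFlow C η) {Y : ℝ × ℝ → ℝ × ℝ}
    (hY : HasVectorField C η Y) : IsQuadraticField C Y where
  cone := h.cone
  contDiffAt p hp := (h.contDiffAt_field hY hp).of_le (by simp)
  homogeneous p hp t ht := h.field_smul hY hp ht

/-- Two projective flows with the same vector field coincide near the origin. -/
theorem IsProjectiveFlow.nearZero_eq {θ : ℝ × ℝ → ℝ × ℝ} (h : IsProjectiveFlow C η)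
    (h' : IsProjectiveFlow C θ) {Y : ℝ × ℝ → ℝ × ℝ} (hY : HasVectorField C η Y)
    (hY' : HasVectorField C θ Y) : NearZero C fun p => η p = θ p := fun p hp => by
  filter_upwards [h.eventually_iter_eq hY (h.isQuadraticField hY) hp,
    h'.eventually_iter_eq hY' (h.isQuadraticField hY) hp] with u h1 h2 hu
  simp only [apply_smul_eq_smul_iter hu, ← h1, h2]

end ProjectiveFlow

/-! ### The two fields -/

theorem isOpenCone_conePhi : IsOpenCone conePhi := by
  refine ⟨isOpen_ne, fun h => h rfl, fun p hp t ht => ?_⟩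
  exact smul_ne_zero ht hp

theorem isOpenCone_conePsi : IsOpenCone conePsi := by
  refine ⟨isOpen_ne_fun continuous_fst continuous_snd, fun h => h rfl, fun p hp t ht h => hp ?_⟩
  simpa [ht] using h

theorem isOpenCone_coneGeneric : IsOpenCone coneGeneric := by
  refine ⟨(isOpen_ne_fun continuous_fst continuous_const).inter
    ((isOpen_ne_fun continuous_snd continuous_const).inter
      (isOpen_ne_fun continuous_fst continuous_snd)), fun h => h.1 rfl, fun p hp t ht => ?_⟩
  simpa [coneGeneric, ht] using hp

theorem conePsi_subset_conePhi : conePsi ⊆ conePhi := by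
  rintro p hp rfl
  exact hp rfl

theorem coneGeneric_subset_conePsi : coneGeneric ⊆ conePsi := fun _ hp => hp.2.2

theorem contDiff_fieldPhi {n : WithTop ℕ∞} : ContDiff ℝ n fieldPhi := by
  unfold fieldPhi
  fun_prop

theorem contDiffAt_fieldPsi {n : WithTop ℕ∞} {p : ℝ × ℝ} (hp : p ∈ conePsi) :
    ContDiffAt ℝ n fieldPsi p := by
  have h : (p.1 - p.2) ^ 2 ≠ 0 := pow_ne_zero 2 (sub_ne_zero.2 hp)
  unfold fieldPsi
  exact ContDiffAt.prodMk (ContDiffAt.div (by fun_prop) (by fun_prop) h)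
    (ContDiffAt.div (by fun_prop) (by fun_prop) h)

theorem fieldPhi_smul (p : ℝ × ℝ) (t : ℝ) : fieldPhi (t • p) = t ^ 2 • fieldPhi p := by
  simp only [fieldPhi, Prod.smul_fst, Prod.smul_snd, smul_eq_mul, Prod.smul_mk, Prod.mk.injEq]
  constructor <;> ring

theorem fieldPsi_smul (p : ℝ × ℝ) {t : ℝ} (ht : t ≠ 0) :
    fieldPsi (t • p) = t ^ 2 • fieldPsi p := by
  simp only [fieldPsi, Prod.smul_fst, Prod.smul_snd, smul_eq_mul, Prod.smul_mk, Prod.mk.injEq]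
  rw [← mul_sub, mul_pow]
  rcases eq_or_ne (p.1 - p.2) 0 with h | h
  · simp [h]
  · constructor
    · field_simp
    · field_simp

theorem isQuadraticField_fieldPhi : IsQuadraticField conePhi fieldPhi where
  cone := isOpenCone_conePhi
  contDiffAt _ _ := contDiff_fieldPhi.contDiffAt
  homogeneous p _ t _ := fieldPhi_smul p t

theorem isQuadraticField_fieldPsi : IsQuadraticField conePsi fieldPsi where
  cone := isOpenCone_conePsi
  contDiffAt _ hp := contDiffAt_fieldPsi hp
  homogeneous p _ _ ht := fieldPsi_smul p ht

theorem hasAnalyticLift_fieldPhi (p : ℝ × ℝ) : HasAnalyticLift fieldPhi p := by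
  refine ⟨fun γ => ((2 : ℝ) • γ.1 ^ 2 + γ.1 * γ.2, γ.1 * γ.2 + (2 : ℝ) • γ.2 ^ 2), by fun_prop,
    Eventually.of_forall fun γ τ => ?_⟩
  simp [fieldPhi]

/-- The division in `fieldPsi` is lifted to the inversion of the Banach algebra of paths. -/
theorem hasAnalyticLift_fieldPsi {p : ℝ × ℝ} (hp : p ∈ conePsi) :
    HasAnalyticLift fieldPsi p := by
  have hd : (constPath p).1 - (constPath p).2 = (p.1 - p.2) • (1 : RealPath) := by
    simp [constPath, sub_smul]
  have hu : IsUnit (((constPath p).1 - (constPath p).2) ^ 2) := by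
    rw [hd, smul_pow, one_pow]
    exact (isUnit_one (M := RealPath)).smul (Units.mk0 _ (pow_ne_zero 2 (sub_ne_zero.2 hp)))
  have hc : Continuous fun γ : RealPath × RealPath => (γ.1 - γ.2) ^ 2 := by fun_prop
  have hI : ContDiffAt ℝ ω (fun γ : RealPath × RealPath => Ring.inverse ((γ.1 - γ.2) ^ 2))
      (constPath p) := by
    obtain ⟨x, hx⟩ := hu
    have h1 : ContDiffAt ℝ ω Ring.inverse (((constPath p).1 - (constPath p).2) ^ 2) := by
      rw [← hx]
      exact contDiffAt_ringInverse ℝ x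
    exact ContDiffAt.comp (constPath p)
      (f := fun γ : RealPath × RealPath => (γ.1 - γ.2) ^ 2) h1 (by fun_prop)
  refine ⟨fun γ => (-(γ.1 * γ.2 ^ 3) * Ring.inverse ((γ.1 - γ.2) ^ 2),
    ((3 : ℝ) • (γ.1 * γ.2 ^ 3) - (2 : ℝ) • γ.2 ^ 4) * Ring.inverse ((γ.1 - γ.2) ^ 2)),
    ContDiffAt.prodMk (ContDiffAt.mul (by fun_prop) hI) (ContDiffAt.mul (by fun_prop) hI), ?_⟩
  filter_upwards [hc.continuousAt.eventually (Units.isOpen.mem_nhds hu)] with γ hγ τ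
  have h1 : Ring.inverse ((γ.1 - γ.2) ^ 2) τ = ((γ.1 τ - γ.2 τ) ^ 2)⁻¹ := by
    have := congrArg (fun f : RealPath => f τ) (Ring.inverse_mul_cancel _ hγ)
    simp only [ContinuousMap.mul_apply, ContinuousMap.pow_apply, ContinuousMap.sub_apply,
      ContinuousMap.one_apply] at this
    exact eq_inv_of_mul_eq_one_left this
  simp [fieldPsi, h1, div_eq_mul_inv, mul_assoc]

/-- The flow with field `fieldPhi`. -/
noncomputable def phi : ℝ × ℝ → ℝ × ℝ := flowMap fieldPhi conePhi

/-- The flow with field `fieldPsi`. -/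
noncomputable def psi : ℝ × ℝ → ℝ × ℝ := flowMap fieldPsi conePsi

theorem iter_phi_regular {p : ℝ × ℝ} (hp : p ∈ conePhi) : ∀ᶠ u in 𝓝 ((0 : ℝ), p),
    ContDiffAt ℝ ω (fun q : ℝ × (ℝ × ℝ) => iter phi q.1 q.2) u ∧ iter phi u.1 u.2 ∈ conePhi ∧
      HasDerivAt (fun s => iter phi s u.2) (fieldPhi (iter phi u.1 u.2)) u.1 :=
  iter_flowMap_regular isQuadraticField_fieldPhi (fun p _ => hasAnalyticLift_fieldPhi p) hp

theorem iter_psi_regular {p : ℝ × ℝ} (hp : p ∈ conePsi) : ∀ᶠ u in 𝓝 ((0 : ℝ), p),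
    ContDiffAt ℝ ω (fun q : ℝ × (ℝ × ℝ) => iter psi q.1 q.2) u ∧ iter psi u.1 u.2 ∈ conePsi ∧
      HasDerivAt (fun s => iter psi s u.2) (fieldPsi (iter psi u.1 u.2)) u.1 :=
  iter_flowMap_regular isQuadraticField_fieldPsi (fun _ => hasAnalyticLift_fieldPsi) hp

theorem isProjectiveFlow_phi : IsProjectiveFlow conePhi phi :=
  isProjectiveFlow_flowMap isQuadraticField_fieldPhi fun p _ => hasAnalyticLift_fieldPhi p

theorem hasVectorField_phi : HasVectorField conePhi phi fieldPhi :=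
  hasVectorField_flowMap isQuadraticField_fieldPhi fun p _ => hasAnalyticLift_fieldPhi p

theorem isProjectiveFlow_psi : IsProjectiveFlow conePsi psi :=
  isProjectiveFlow_flowMap isQuadraticField_fieldPsi fun _ => hasAnalyticLift_fieldPsi

theorem hasVectorField_psi : HasVectorField conePsi psi fieldPsi :=
  hasVectorField_flowMap isQuadraticField_fieldPsi fun _ => hasAnalyticLift_fieldPsi

theorem hasDerivAt_fst {γ : ℝ → ℝ × ℝ} {v : ℝ × ℝ} {s : ℝ} (h : HasDerivAt γ v s) :
    HasDerivAt (fun s => (γ s).1) v.1 s :=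
  (ContinuousLinearMap.fst ℝ ℝ ℝ).hasFDerivAt.comp_hasDerivAt s h

theorem hasDerivAt_snd {γ : ℝ → ℝ × ℝ} {v : ℝ × ℝ} {s : ℝ} (h : HasDerivAt γ v s) :
    HasDerivAt (fun s => (γ s).2) v.2 s :=
  (ContinuousLinearMap.snd ℝ ℝ ℝ).hasFDerivAt.comp_hasDerivAt s h

theorem nearZero_phi_symm : NearZero conePhi fun p => (phi p).2 = (phi (p.2, p.1)).1 := by
  intro p hp
  obtain ⟨ε, hε, hbox⟩ := exists_box (iter_phi_regular hp)
  refine eventually_of_box hε fun s hs q hq hs0 => ?_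
  have key : iter phi s (q.2, q.1) = ((iter phi s q).2, (iter phi s q).1) := by
    refine iter_flowMap_eq isQuadraticField_fieldPhi
      (g := fun s => ((iter phi s q).2, (iter phi s q).1)) (by simp [iter_zero]) fun t ht => ?_
    obtain ⟨-, hC, hd⟩ := hbox t (ht.trans_lt hs) q hq
    refine ⟨fun h => hC ?_, ?_⟩
    · rw [Prod.mk_eq_zero] at h
      exact Prod.ext h.2 h.1
    · have h2 : HasDerivAt (fun s => ((iter phi s q).2, (iter phi s q).1))
          ((fieldPhi (iter phi t q)).2, (fieldPhi (iter phi t q)).1) t :=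
        (hasDerivAt_snd hd).prodMk (hasDerivAt_fst hd)
      convert h2 using 1
      simp only [fieldPhi, Prod.mk.injEq]
      constructor <;> ring
  replace hs0 : s ≠ 0 := hs0
  show (phi (s • q)).2 = (phi (s • (q.2, q.1))).1
  rw [apply_smul_eq_smul_iter hs0 phi,
    apply_smul_eq_smul_iter hs0 phi, key]
  rfl

/-! ### First integrals -/

/-- The functions `(3x - y) / x²` and `(3y - x) / y²` decrease by `6 A` and `6 B` from the point
`p` to the point `q`; the equations are written without denominators, so that they are meaningful
on the coordinate axes. -/
structure Shift (A B : ℝ) (p q : ℝ × ℝ) : Prop where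
  left_ne : p ≠ 0
  right_ne : q ≠ 0
  fst : (3 * q.1 - q.2) * p.1 ^ 2 = q.1 ^ 2 * (3 * p.1 - p.2) - 6 * A * q.1 ^ 2 * p.1 ^ 2
  snd : (3 * q.2 - q.1) * p.2 ^ 2 = q.2 ^ 2 * (3 * p.2 - p.1) - 6 * B * q.2 ^ 2 * p.2 ^ 2

namespace Shift

variable {A B A' B' : ℝ} {p q r : ℝ × ℝ}

theorem swap (h : Shift A B p q) : Shift B A p.swap q.swap where
  left_ne h0 := h.left_ne (Prod.ext (congrArg Prod.snd h0) (congrArg Prod.fst h0))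
  right_ne h0 := h.right_ne (Prod.ext (congrArg Prod.snd h0) (congrArg Prod.fst h0))
  fst := h.snd
  snd := h.fst

theorem fst_eq_zero_iff (h : Shift A B p q) : q.1 = 0 ↔ p.1 = 0 := by
  have h1 := h.fst
  constructor
  · intro h0
    by_contra hp
    rw [h0] at h1
    have : q.2 * p.1 ^ 2 = 0 := by linarith
    exact h.right_ne (Prod.ext h0 (by simpa [hp] using this))
  · intro h0
    have hp : p.2 ≠ 0 := fun h2 => h.left_ne (Prod.ext h0 h2)
    rw [h0] at h1
    have : q.1 ^ 2 * p.2 = 0 := by linarith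
    simpa [hp] using this

theorem snd_eq_zero_iff (h : Shift A B p q) : q.2 = 0 ↔ p.2 = 0 :=
  h.swap.fst_eq_zero_iff

theorem trans_fst (h : Shift A B p q) (h' : Shift A' B' q r) :
    (3 * r.1 - r.2) * p.1 ^ 2 =
      r.1 ^ 2 * (3 * p.1 - p.2) - 6 * (A + A') * r.1 ^ 2 * p.1 ^ 2 := by
  rcases eq_or_ne p.1 0 with h0 | h0
  · rw [h'.fst_eq_zero_iff.2 (h.fst_eq_zero_iff.2 h0), h0]
    ring
  · have hq : q.1 ^ 2 ≠ 0 := pow_ne_zero 2 (mt h.fst_eq_zero_iff.1 h0)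
    have h1 := h.fst
    have h2 := h'.fst
    apply mul_left_cancel₀ hq
    linear_combination p.1 ^ 2 * h2 + r.1 ^ 2 * h1

theorem trans (h : Shift A B p q) (h' : Shift A' B' q r) : Shift (A + A') (B + B') p r where
  left_ne := h.left_ne
  right_ne := h'.right_ne
  fst := h.trans_fst h'
  snd := h.swap.trans_fst h'.swap

theorem smul {t : ℝ} (ht : t ≠ 0) (h : Shift (A * t) (B * t) p q) :
    Shift A B (t • p) (t • q) where
  left_ne := smul_ne_zero ht h.left_ne
  right_ne := smul_ne_zero ht h.right_ne
  fst := by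
    simp only [Prod.smul_fst, Prod.smul_snd, smul_eq_mul]
    linear_combination t ^ 3 * h.fst
  snd := by
    simp only [Prod.smul_fst, Prod.smul_snd, smul_eq_mul]
    linear_combination t ^ 3 * h.snd

theorem cube_sub (h : Shift A B p q) : (q.1 - q.2) ^ 3 * (p.1 ^ 2 * p.2 ^ 2) =
    q.1 ^ 2 * q.2 ^ 2 * ((p.1 - p.2) ^ 3 - 6 * (A - B) * (p.1 ^ 2 * p.2 ^ 2)) := by
  linear_combination q.2 ^ 2 * p.2 ^ 2 * h.fst - q.1 ^ 2 * p.1 ^ 2 * h.snd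

end Shift

/-- A solution of the linear equation `Q' = c Q` with `Q 0 = 0` vanishes. -/
theorem eq_zero_of_linear_ode {Q c : ℝ → ℝ} {z : ℝ} (h0 : Q 0 = 0)
    (hQ : ∀ s, |s| ≤ |z| → HasDerivAt Q (c s * Q s) s)
    (hc : ∀ s, |s| ≤ |z| → ContinuousAt c s) : Q z = 0 := by
  have hm : ∀ τ ∈ Set.Icc (0 : ℝ) 1, |z * τ| ≤ |z| := fun τ hτ => by
    rw [abs_mul, abs_of_nonneg hτ.1]
    exact mul_le_of_le_one_right (abs_nonneg z) hτ.2
  have hd : ∀ τ ∈ Set.Icc (0 : ℝ) 1,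
      HasDerivAt (fun τ => Q (z * τ)) (z * (c (z * τ) * Q (z * τ))) τ := fun τ hτ => by
    have h1 : HasDerivAt (fun σ : ℝ => z * σ) z τ := by
      simpa using (hasDerivAt_id τ).const_mul z
    exact (hQ _ (hm τ hτ)).scomp τ h1
  have hcc : ContinuousOn (fun τ => z * c (z * τ)) (Set.Icc 0 1) := fun τ hτ =>
    (ContinuousAt.mul continuousAt_const (ContinuousAt.comp (f := fun τ => z * τ)
      (hc _ (hm τ hτ)) (by fun_prop))).continuousWithinAt
  obtain ⟨K, hK⟩ := isCompact_Icc.exists_bound_of_continuousOn hcc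
  have := eq_zero_of_abs_deriv_le_mul_abs_self_of_eq_zero_right (f := fun τ => Q (z * τ))
    (K := K) (a := 0) (b := 1)
    (fun τ hτ => (hd τ hτ).continuousAt.continuousWithinAt)
    (fun τ hτ => (hd τ (Set.Ico_subset_Icc_self hτ)).hasDerivWithinAt) (by simpa using h0)
    (fun τ hτ => by
      rw [← mul_assoc, norm_mul]
      exact mul_le_mul_of_nonneg_right (hK τ (Set.Ico_subset_Icc_self hτ)) (norm_nonneg _))
    1 (by simp)
  simpa using this

/-- The difference of the two sides of the first equation of `Shift` satisfies `Q' = c Q` along a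
curve `(u, v)`, provided that `(u²)' = c u²` and `(3u - v)' = c (3u - v) - 6 A' u²`. -/
theorem hasDerivAt_shift_defect {u v A : ℝ → ℝ} {s x y u' v' a c : ℝ} (hu : HasDerivAt u u' s)
    (hv : HasDerivAt v v' s) (hA : HasDerivAt A a s)
    (h1 : u' * 2 = c * u s) (h2 : 3 * u' - v' = c * (3 * u s - v s) - 6 * a * u s ^ 2) :
    HasDerivAt (fun s => (3 * u s - v s) * x ^ 2 - (u s ^ 2 * (3 * x - y)
      - 6 * A s * u s ^ 2 * x ^ 2)) (c * ((3 * u s - v s) * x ^ 2 - (u s ^ 2 * (3 * x - y)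
      - 6 * A s * u s ^ 2 * x ^ 2))) s := by
  have := (((hu.const_mul 3).sub hv).mul_const (x ^ 2)).sub
    (((hu.pow 2).mul_const (3 * x - y)).sub
      (((hA.const_mul 6).mul (hu.pow 2)).mul_const (x ^ 2)))
  refine this.congr_deriv ?_
  simp only [Pi.pow_apply]
  push_cast
  linear_combination x ^ 2 * h2 - (u s * (3 * x - y) - 6 * A s * u s * x ^ 2) * h1

/-- Along an integral curve of `fieldPhi`, the equations of `Shift` hold since the difference of
their two sides satisfies a linear differential equation. -/
theorem eventually_shift_phi {p : ℝ × ℝ} (hp : p ∈ conePhi) :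
    ∀ᶠ u in 𝓝 ((0 : ℝ), p), Shift u.1 u.1 u.2 (iter phi u.1 u.2) := by
  obtain ⟨ε, hε, hbox⟩ := exists_box (iter_phi_regular hp)
  obtain ⟨δ, hδ, hball⟩ := Metric.isOpen_iff.1 isOpenCone_conePhi.1 p hp
  refine eventually_of_box (lt_min hε hδ) fun z hz q hq => ?_
  rw [lt_min_iff] at hz hq
  have hd : ∀ s, |s| ≤ |z| → HasDerivAt (fun s => iter phi s q) (fieldPhi (iter phi s q)) s :=
    fun s hs => (hbox s (hs.trans_lt hz.1) q hq.1).2.2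
  have hd1 : ∀ s, |s| ≤ |z| → HasDerivAt (fun s => (iter phi s q).1)
      (fieldPhi (iter phi s q)).1 s := fun s hs => hasDerivAt_fst (hd s hs)
  have hd2 : ∀ s, |s| ≤ |z| → HasDerivAt (fun s => (iter phi s q).2)
      (fieldPhi (iter phi s q)).2 s := fun s hs => hasDerivAt_snd (hd s hs)
  refine ⟨hball hq.2, (hbox z hz.1 q hq.1).2.1, ?_, ?_⟩
  · refine sub_eq_zero.1 (eq_zero_of_linear_ode (z := z)
      (Q := fun s => (3 * (iter phi s q).1 - (iter phi s q).2) * q.1 ^ 2 -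
        ((iter phi s q).1 ^ 2 * (3 * q.1 - q.2) - 6 * s * (iter phi s q).1 ^ 2 * q.1 ^ 2))
      (c := fun s => 2 * (2 * (iter phi s q).1 + (iter phi s q).2)) ?_ (fun s hs => ?_)
      fun s hs => ?_)
    · simp only [iter_zero]
      ring
    · refine hasDerivAt_shift_defect (hd1 s hs) (hd2 s hs) (hasDerivAt_id s) ?_ ?_ <;>
      · simp only [fieldPhi]
        ring
    · have := (hd1 s hs).continuousAt
      have := (hd2 s hs).continuousAt
      fun_prop
  · refine sub_eq_zero.1 (eq_zero_of_linear_ode (z := z)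
      (Q := fun s => (3 * (iter phi s q).2 - (iter phi s q).1) * q.2 ^ 2 -
        ((iter phi s q).2 ^ 2 * (3 * q.2 - q.1) - 6 * s * (iter phi s q).2 ^ 2 * q.2 ^ 2))
      (c := fun s => 2 * ((iter phi s q).1 + 2 * (iter phi s q).2)) ?_ (fun s hs => ?_)
      fun s hs => ?_)
    · simp only [iter_zero]
      ring
    · refine hasDerivAt_shift_defect (hd2 s hs) (hd1 s hs) (hasDerivAt_id s) ?_ ?_ <;>
      · simp only [fieldPhi]
        ring
    · have := (hd1 s hs).continuousAt
      have := (hd2 s hs).continuousAt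
      fun_prop

/-- Along an integral curve of `fieldPsi`, the function `(3x - y) / x²` is constant, and
`(3y - x) / y²` grows at the rate `6`. -/
theorem eventually_shift_psi {p : ℝ × ℝ} (hp : p ∈ conePsi) :
    ∀ᶠ u in 𝓝 ((0 : ℝ), p), Shift 0 (-u.1) u.2 (iter psi u.1 u.2) := by
  obtain ⟨ε, hε, hbox⟩ := exists_box (iter_psi_regular hp)
  obtain ⟨δ, hδ, hball⟩ := Metric.isOpen_iff.1 isOpenCone_conePsi.1 p hp
  refine eventually_of_box (lt_min hε hδ) fun z hz q hq => ?_
  rw [lt_min_iff] at hz hq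
  have hd : ∀ s, |s| ≤ |z| → HasDerivAt (fun s => iter psi s q) (fieldPsi (iter psi s q)) s :=
    fun s hs => (hbox s (hs.trans_lt hz.1) q hq.1).2.2
  have hne : ∀ s, |s| ≤ |z| → (iter psi s q).1 - (iter psi s q).2 ≠ 0 :=
    fun s hs => sub_ne_zero.2 (hbox s (hs.trans_lt hz.1) q hq.1).2.1
  have hd1 : ∀ s, |s| ≤ |z| → HasDerivAt (fun s => (iter psi s q).1)
      (fieldPsi (iter psi s q)).1 s := fun s hs => hasDerivAt_fst (hd s hs)
  have hd2 : ∀ s, |s| ≤ |z| → HasDerivAt (fun s => (iter psi s q).2)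
      (fieldPsi (iter psi s q)).2 s := fun s hs => hasDerivAt_snd (hd s hs)
  refine ⟨conePsi_subset_conePhi (hball hq.2),
    conePsi_subset_conePhi (hbox z hz.1 q hq.1).2.1, ?_, ?_⟩
  · refine sub_eq_zero.1 (eq_zero_of_linear_ode (z := z)
      (Q := fun s => (3 * (iter psi s q).1 - (iter psi s q).2) * q.1 ^ 2 -
        ((iter psi s q).1 ^ 2 * (3 * q.1 - q.2) - 6 * 0 * (iter psi s q).1 ^ 2 * q.1 ^ 2))
      (c := fun s => -2 * (iter psi s q).2 ^ 3 / ((iter psi s q).1 - (iter psi s q).2) ^ 2)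
      ?_ (fun s hs => ?_) fun s hs => ?_)
    · simp only [iter_zero]
      ring
    · have := hne s hs
      refine hasDerivAt_shift_defect (hd1 s hs) (hd2 s hs) (hasDerivAt_const s (0 : ℝ)) ?_ ?_
      · simp only [fieldPsi]
        field_simp
      · simp only [fieldPsi]
        field_simp
        ring
    · have := (hd1 s hs).continuousAt
      have := (hd2 s hs).continuousAt
      exact ContinuousAt.div (by fun_prop) (by fun_prop) (pow_ne_zero 2 (hne s hs))
  · refine sub_eq_zero.1 (eq_zero_of_linear_ode (z := z)
      (Q := fun s => (3 * (iter psi s q).2 - (iter psi s q).1) * q.2 ^ 2 -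
        ((iter psi s q).2 ^ 2 * (3 * q.2 - q.1) - 6 * (-s) * (iter psi s q).2 ^ 2 * q.2 ^ 2))
      (c := fun s => 2 * (3 * (iter psi s q).1 * (iter psi s q).2 ^ 2 - 2 * (iter psi s q).2 ^ 3)
        / ((iter psi s q).1 - (iter psi s q).2) ^ 2)
      ?_ (fun s hs => ?_) fun s hs => ?_)
    · simp only [iter_zero]
      ring
    · have := hne s hs
      refine hasDerivAt_shift_defect (hd2 s hs) (hd1 s hs) (hasDerivAt_neg s) ?_ ?_
      · simp only [fieldPsi]
        field_simp
      · simp only [fieldPsi]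
        field_simp
        ring
    · have := (hd1 s hs).continuousAt
      have := (hd2 s hs).continuousAt
      exact ContinuousAt.div (by fun_prop) (by fun_prop) (pow_ne_zero 2 (hne s hs))

/-! ### Commutation -/

/-- On a coordinate axis, the equations of `Shift` determine the second point. -/
theorem Shift.unique_of_fst_eq_zero {A B : ℝ} {p q r : ℝ × ℝ} (hq : Shift A B p q)
    (hr : Shift A B p r) (h0 : p.1 = 0) : q = r := by
  have hy : p.2 ≠ 0 := fun h => hq.left_ne (Prod.ext h0 h)
  have key : ∀ s : ℝ × ℝ, Shift A B p s → s.2 * (1 - 2 * B * p.2) = p.2 := fun s hs => by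
    have h1 := hs.snd
    rw [hs.fst_eq_zero_iff.2 h0, h0] at h1
    have hs2 : s.2 ≠ 0 := mt hs.snd_eq_zero_iff.1 hy
    apply mul_left_cancel₀ (mul_ne_zero hs2 hy)
    linear_combination -h1 / 3
  refine Prod.ext ((hq.fst_eq_zero_iff.2 h0).trans (hr.fst_eq_zero_iff.2 h0).symm) ?_
  have h1 := key q hq
  have h2 := key r hr
  have hB : 1 - 2 * B * p.2 ≠ 0 := fun h => hy (by rw [← h1, h, mul_zero])
  exact mul_right_cancel₀ hB (h1.trans h2.symm)

theorem Shift.unique_of_snd_eq_zero {A B : ℝ} {p q r : ℝ × ℝ} (hq : Shift A B p q)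
    (hr : Shift A B p r) (h0 : p.2 = 0) : q = r :=
  Prod.swap_injective (hq.swap.unique_of_fst_eq_zero hr.swap h0)

/-- The derivative of the first equation of `Shift` along a curve, when `A' = 1`. -/
theorem Shift.deriv_eq {H : ℝ → ℝ × ℝ} {A B : ℝ → ℝ} {v q : ℝ × ℝ} {s : ℝ}
    (hH : HasDerivAt H v s) (hA : HasDerivAt A 1 s) (hq : q.1 ≠ 0)
    (hS : ∀ᶠ σ in 𝓝 s, Shift (A σ) (B σ) q (H σ)) :
    (3 * v.1 - v.2) * (H s).1 - 2 * v.1 * (3 * (H s).1 - (H s).2) + 6 * (H s).1 ^ 3 = 0 := by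
  have h1 := hasDerivAt_fst hH
  have h2 := hasDerivAt_snd hH
  have h3 := (((h1.const_mul 3).sub h2).mul_const (q.1 ^ 2)).sub
    (((h1.pow 2).mul_const (3 * q.1 - q.2)).sub
      (((hA.const_mul 6).mul (h1.pow 2)).mul_const (q.1 ^ 2)))
  have h4 : HasDerivAt (fun _ : ℝ => (0 : ℝ)) 0 s := hasDerivAt_const s 0
  have h5 := h3.unique (h4.congr_of_eventuallyEq (by
    filter_upwards [hS] with σ hσ
    have := hσ.fst
    simp only [Pi.sub_apply, Pi.mul_apply, Pi.pow_apply]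
    linear_combination this))
  simp only [Pi.pow_apply] at h5
  push_cast at h5
  have h6 := hS.self_of_nhds.fst
  apply mul_left_cancel₀ (pow_ne_zero 2 hq)
  linear_combination (H s).1 * h5 - 2 * v.1 * h6

/-- A curve along which `(3x - y) / x²` and `(3y - x) / y²` both decrease at the rate `6` is an
integral curve of `fieldPhi`. -/
theorem Shift.hasDerivAt_fieldPhi {H : ℝ → ℝ × ℝ} {q : ℝ × ℝ} {s c : ℝ}
    (hH : DifferentiableAt ℝ H s) (hq1 : q.1 ≠ 0) (hq2 : q.2 ≠ 0) (hne : H s ∈ conePsi)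
    (hS : ∀ᶠ σ in 𝓝 s, Shift σ (σ - c) q (H σ)) : HasDerivAt H (fieldPhi (H s)) s := by
  have hd := hH.hasDerivAt
  set v := deriv H s
  have e1 := Shift.deriv_eq hd (hasDerivAt_id s) hq1 hS
  have e2 := Shift.deriv_eq (H := fun σ => (H σ).swap) (v := v.swap) (q := q.swap)
    ((hasDerivAt_snd hd).prodMk (hasDerivAt_fst hd)) ((hasDerivAt_id s).sub_const c) hq2
    (hS.mono fun σ hσ => hσ.swap)
  simp only [Prod.fst_swap, Prod.snd_swap] at e2
  -- the determinant of the linear equations `e1`, `e2` for `v`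
  have hd2 : (-6 : ℝ) * ((H s).1 - (H s).2) ^ 2 ≠ 0 :=
    mul_ne_zero (by norm_num) (pow_ne_zero 2 (sub_ne_zero.2 hne))
  have hv : v = fieldPhi (H s) := by
    ext
    · simp only [fieldPhi]
      apply mul_left_cancel₀ hd2
      linear_combination (2 * (H s).1 - 3 * (H s).2) * e1 + (H s).1 * e2
    · simp only [fieldPhi]
      apply mul_left_cancel₀ hd2
      linear_combination (2 * (H s).2 - 3 * (H s).1) * e2 + (H s).2 * e1
  rwa [hv] at hd

/-- On the axes `φ^z ψ^w = ψ^w φ^z` since both sides solve the same equations of `Shift`; elsewhere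
`z ↦ ψ^w φ^z(q)` shifts the two first integrals as an integral curve of `fieldPhi` does, so that
it is the integral curve through `ψ^w(q)`. -/
theorem eventually_iter_comm {p : ℝ × ℝ} (hp : p ∈ conePsi) :
    ∀ᶠ v : ℝ × ℝ × (ℝ × ℝ) in 𝓝 ((0 : ℝ), (0 : ℝ), p),
      iter phi v.1 (iter psi v.2.1 v.2.2) = iter psi v.2.1 (iter phi v.1 v.2.2) := by
  have hp' := conePsi_subset_conePhi hp
  have tphi : Tendsto (fun v : ℝ × ℝ × (ℝ × ℝ) => (v.2.1, iter phi v.1 v.2.2))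
      (𝓝 ((0 : ℝ), (0 : ℝ), p)) (𝓝 (0, p)) := by
    have h1 : Continuous fun v : ℝ × ℝ × (ℝ × ℝ) => (v.1, v.2.2) := by fun_prop
    have h2 : Continuous fun v : ℝ × ℝ × (ℝ × ℝ) => v.2.1 := by fun_prop
    exact (h2.tendsto' _ (0 : ℝ) rfl).prodMk_nhds
      ((isProjectiveFlow_phi.tendsto_iter hp').comp (h1.tendsto' _ (0, p) rfl))
  have tpsi : Tendsto (fun v : ℝ × ℝ × (ℝ × ℝ) => (v.1, iter psi v.2.1 v.2.2))
      (𝓝 ((0 : ℝ), (0 : ℝ), p)) (𝓝 (0, p)) := by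
    have h1 : Continuous fun v : ℝ × ℝ × (ℝ × ℝ) => (v.2.1, v.2.2) := by fun_prop
    have h2 : Continuous fun v : ℝ × ℝ × (ℝ × ℝ) => v.1 := by fun_prop
    exact (h2.tendsto' _ (0 : ℝ) rfl).prodMk_nhds
      ((isProjectiveFlow_psi.tendsto_iter hp).comp (h1.tendsto' _ (0, p) rfl))
  have t1 : Tendsto (fun v : ℝ × ℝ × (ℝ × ℝ) => (v.1, v.2.2))
      (𝓝 ((0 : ℝ), (0 : ℝ), p)) (𝓝 (0, p)) := Continuous.tendsto' (by fun_prop) _ _ rfl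
  have t2 : Tendsto (fun v : ℝ × ℝ × (ℝ × ℝ) => (v.2.1, v.2.2))
      (𝓝 ((0 : ℝ), (0 : ℝ), p)) (𝓝 (0, p)) := Continuous.tendsto' (by fun_prop) _ _ rfl
  have hev := (t1.eventually (iter_phi_regular hp')).and
    ((t1.eventually (eventually_shift_phi hp')).and
    ((t2.eventually (eventually_shift_psi hp)).and
    ((tphi.eventually (iter_psi_regular hp)).and
    ((tphi.eventually (eventually_shift_psi hp)).and
      (tpsi.eventually (eventually_shift_phi hp'))))))
  obtain ⟨ε, hε, hbox⟩ := Metric.eventually_nhds_iff.1 hev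
  refine Metric.eventually_nhds_iff.2 ⟨ε, hε, ?_⟩
  rintro ⟨z, w, q⟩ hv
  simp only [Prod.dist_eq, max_lt_iff, dist_zero_right, Real.norm_eq_abs] at hv
  obtain ⟨hz, hw, hq⟩ := hv
  have box : ∀ s, |s| < ε → _ := fun s hs =>
    @hbox (s, w, q) (by simpa [Prod.dist_eq] using ⟨hs, hw, by simpa [Prod.dist_eq] using hq⟩)
  simp only at box ⊢
  have hS : ∀ s, |s| < ε → Shift s (s - w) q (iter psi w (iter phi s q)) := fun s hs => by
    obtain ⟨-, h1, -, -, h2, -⟩ := box s hs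
    have := h1.trans h2
    rwa [add_zero, ← sub_eq_add_neg] at this
  have hS' : Shift z (z - w) q (iter phi z (iter psi w q)) := by
    obtain ⟨-, -, h1, -, -, h2⟩ := box z hz
    have := h1.trans h2
    rwa [zero_add, add_comm, ← sub_eq_add_neg] at this
  by_cases h1 : q.1 = 0
  · exact hS'.unique_of_fst_eq_zero (hS z hz) h1
  by_cases h2 : q.2 = 0
  · exact hS'.unique_of_snd_eq_zero (hS z hz) h2
  refine iter_flowMap_eq isQuadraticField_fieldPhi
    (g := fun s => iter psi w (iter phi s q)) (by simp only [iter_zero]) fun s hs => ?_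
  have hs' := hs.trans_lt hz
  obtain ⟨hr, -, -, hr', -, -⟩ := box s hs'
  refine ⟨conePsi_subset_conePhi hr'.2.1, ?_⟩
  refine Shift.hasDerivAt_fieldPhi (H := fun s => iter psi w (iter phi s q)) (c := w) ?_ h1 h2
    hr'.2.1 ?_
  · have d1 : DifferentiableAt ℝ (fun s => (w, iter phi s q)) s :=
      (differentiableAt_const w).prodMk hr.2.2.differentiableAt
    exact DifferentiableAt.comp s (f := fun s => (w, iter phi s q))
      (hr'.1.differentiableAt (by simp)) d1
  · filter_upwards [(isOpen_lt continuous_abs continuous_const).mem_nhds hs'] with σ hσ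
    exact hS σ hσ

/-! ### The maps `φ^z ∘ ψ^w` -/

theorem iter_compIter (φ ψ : ℝ × ℝ → ℝ × ℝ) (z w t : ℝ) (p : ℝ × ℝ) :
    iter (compIter φ ψ z w) t p = iter φ (z * t) (iter ψ (w * t) p) := by
  rcases eq_or_ne t 0 with rfl | ht
  · simp [iter_zero]
  · rw [iter_of_ne ht, compIter, iter_smul ht, iter_smul ht, inv_smul_smul₀ ht]

section CompIter

variable (z w : ℝ) {p : ℝ × ℝ}

theorem tendsto_mul_prodMk (c : ℝ) (p : ℝ × ℝ) :
    Tendsto (fun u : ℝ × (ℝ × ℝ) => (c * u.1, u.2)) (𝓝 (0, p)) (𝓝 (0, p)) :=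
  Continuous.tendsto' (by fun_prop) _ _ (by simp)

theorem tendsto_mul_iter_psi (hp : p ∈ conePsi) :
    Tendsto (fun u : ℝ × (ℝ × ℝ) => (z * u.1, iter psi (w * u.1) u.2)) (𝓝 (0, p))
      (𝓝 (0, p)) := by
  have h2 : Continuous fun u : ℝ × (ℝ × ℝ) => z * u.1 := by fun_prop
  exact (h2.tendsto' _ (0 : ℝ) (by simp)).prodMk_nhds
    ((isProjectiveFlow_psi.tendsto_iter hp).comp (tendsto_mul_prodMk w p))

theorem tendsto_iter_compIter (hp : p ∈ conePsi) :
    Tendsto (fun u : ℝ × (ℝ × ℝ) => iter (compIter phi psi z w) u.1 u.2) (𝓝 (0, p)) (𝓝 p) := by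
  simp only [iter_compIter]
  exact (isProjectiveFlow_phi.tendsto_iter (conePsi_subset_conePhi hp)).comp
    (tendsto_mul_iter_psi z w hp)

theorem contDiffAt_iter_compIter (hp : p ∈ conePsi) :
    ∀ᶠ u in 𝓝 ((0 : ℝ), p), ContDiffAt ℝ ω
      (fun q : ℝ × (ℝ × ℝ) => iter (compIter phi psi z w) q.1 q.2) u := by
  filter_upwards [(tendsto_mul_iter_psi z w hp).eventually
    (iter_phi_regular (conePsi_subset_conePhi hp)),
    (tendsto_mul_prodMk w p).eventually (iter_psi_regular hp)] with u h1 h2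
  simp only [iter_compIter]
  have d1 : ContDiffAt ℝ ω (fun u : ℝ × (ℝ × ℝ) => (w * u.1, u.2)) u := by fun_prop
  have d2 : ContDiffAt ℝ ω (fun u : ℝ × (ℝ × ℝ) => iter psi (w * u.1) u.2) u :=
    ContDiffAt.comp u (f := fun u : ℝ × (ℝ × ℝ) => (w * u.1, u.2)) h2.1 d1
  have d3 : ContDiffAt ℝ ω (fun u : ℝ × (ℝ × ℝ) => (z * u.1, iter psi (w * u.1) u.2)) u :=
    ContDiffAt.prodMk (by fun_prop) d2
  exact ContDiffAt.comp u (f := fun u : ℝ × (ℝ × ℝ) => (z * u.1, iter psi (w * u.1) u.2)) h1.1 d3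

theorem eventually_shift_compIter (hp : p ∈ conePsi) : ∀ᶠ u in 𝓝 ((0 : ℝ), p),
    Shift (z * u.1) (z * u.1 - w * u.1) u.2 (iter (compIter phi psi z w) u.1 u.2) := by
  filter_upwards [(tendsto_mul_iter_psi z w hp).eventually
    (eventually_shift_phi (conePsi_subset_conePhi hp)),
    (tendsto_mul_prodMk w p).eventually (eventually_shift_psi hp)] with u h1 h2
  rw [iter_compIter]
  have := h2.trans h1
  rwa [zero_add, add_comm, ← sub_eq_add_neg] at this

theorem isProjectiveFlow_compIter : IsProjectiveFlow conePsi (compIter phi psi z w) where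
  cone := isOpenCone_conePsi
  boundary p hp := by
    have h1 : Tendsto (fun t : ℝ => iter (compIter phi psi z w) t p) (𝓝[≠] 0) (𝓝 p) :=
      (tendsto_iter_compIter z w hp).comp
        (((Continuous.prodMk_left p).tendsto' (0 : ℝ) (0, p) rfl).mono_left nhdsWithin_le_nhds)
    refine h1.congr' ?_
    filter_upwards [self_mem_nhdsWithin] with t ht
    exact iter_of_ne ht _ _
  smooth p hp := ⟨_, contDiffAt_iter_compIter z w hp,
    fun u hu => (ContDiffAt.of_le (show ContDiffAt ℝ ω _ u from hu) le_top).contDiffWithinAt⟩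
  translation p hp := by
    have hp' := conePsi_subset_conePhi hp
    -- `φ^{z(s+t)} ψ^{w(s+t)} = φ^{zs} φ^{zt} ψ^{ws} ψ^{wt} = φ^{zs} ψ^{ws} φ^{zt} ψ^{wt}`
    have b1 : Tendsto (fun v : ℝ × ℝ × (ℝ × ℝ) => iter psi (w * v.2.1) v.2.2)
        (𝓝 ((0 : ℝ), (0 : ℝ), p)) (𝓝 p) :=
      (isProjectiveFlow_psi.tendsto_iter hp).comp
        (Continuous.tendsto' (f := fun v : ℝ × ℝ × (ℝ × ℝ) => (w * v.2.1, v.2.2))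
          (by fun_prop) _ _ (by simp))
    have b2 : Tendsto (fun v : ℝ × ℝ × (ℝ × ℝ) => iter psi (w * v.1) (iter psi (w * v.2.1) v.2.2))
        (𝓝 ((0 : ℝ), (0 : ℝ), p)) (𝓝 p) := by
      refine (isProjectiveFlow_psi.tendsto_iter hp).comp (Tendsto.prodMk_nhds ?_ b1)
      exact Continuous.tendsto' (by fun_prop) _ _ (by simp)
    have c1 : Tendsto (fun v : ℝ × ℝ × (ℝ × ℝ) => (w * v.1, w * v.2.1, v.2.2))
        (𝓝 ((0 : ℝ), (0 : ℝ), p)) (𝓝 ((0 : ℝ), (0 : ℝ), p)) :=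
      Continuous.tendsto' (by fun_prop) _ _ (by simp)
    have c2 : Tendsto (fun v : ℝ × ℝ × (ℝ × ℝ) => (z * v.1, z * v.2.1,
        iter psi (w * v.1) (iter psi (w * v.2.1) v.2.2)))
        (𝓝 ((0 : ℝ), (0 : ℝ), p)) (𝓝 ((0 : ℝ), (0 : ℝ), p)) :=
      Tendsto.prodMk_nhds (Continuous.tendsto' (by fun_prop) _ _ (by simp))
        (Tendsto.prodMk_nhds (Continuous.tendsto' (by fun_prop) _ _ (by simp)) b2)
    have c3 : Tendsto (fun v : ℝ × ℝ × (ℝ × ℝ) => (z * v.2.1, w * v.1,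
        iter psi (w * v.2.1) v.2.2))
        (𝓝 ((0 : ℝ), (0 : ℝ), p)) (𝓝 ((0 : ℝ), (0 : ℝ), p)) :=
      Tendsto.prodMk_nhds (Continuous.tendsto' (by fun_prop) _ _ (by simp))
        (Tendsto.prodMk_nhds (Continuous.tendsto' (by fun_prop) _ _ (by simp)) b1)
    filter_upwards [c1.eventually (isProjectiveFlow_psi.translation p hp),
      c2.eventually (isProjectiveFlow_phi.translation p hp'),
      c3.eventually (eventually_iter_comm hp)] with v h1 h2 h3
    simp only [iter_compIter, mul_add] at h1 h2 h3 ⊢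
    rw [h1, h2, h3]

theorem hasVectorField_compIter : HasVectorField conePsi (compIter phi psi z w)
    fun p => z • fieldPhi p + w • fieldPsi p := by
  intro p hp
  have hp' := conePsi_subset_conePhi hp
  have e1 := (isProjectiveFlow_phi.contDiffAt hp').self_of_nhds.differentiableAt (by simp)
  -- the two partial derivatives of `(s, q) ↦ φ^s(q)` at `(0, p)`
  have d1 : HasDerivAt (fun t : ℝ => (t, p)) ((1 : ℝ), (0 : ℝ × ℝ)) 0 :=
    (hasDerivAt_id _).prodMk (hasDerivAt_const _ _)
  have p1 : fderiv ℝ (fun q : ℝ × (ℝ × ℝ) => iter phi q.1 q.2) (0, p) (1, 0) = fieldPhi p :=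
    (HasFDerivAt.comp_hasDerivAt (f := fun s : ℝ => (s, p)) (0 : ℝ) e1.hasFDerivAt d1).unique
      (hasVectorField_phi p hp')
  have p2 : ∀ v, fderiv ℝ (fun q : ℝ × (ℝ × ℝ) => iter phi q.1 q.2) (0, p) (0, v) = v := by
    intro v
    have d2 : HasDerivAt (fun t : ℝ => ((0 : ℝ), p + t • v)) ((0 : ℝ), v) 0 := by
      refine (hasDerivAt_const _ _).prodMk ?_
      simpa using ((hasDerivAt_id (0 : ℝ)).smul_const v).const_add p
    have e1' : HasFDerivAt (fun q : ℝ × (ℝ × ℝ) => iter phi q.1 q.2)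
        (fderiv ℝ (fun q : ℝ × (ℝ × ℝ) => iter phi q.1 q.2) (0, p))
        ((0 : ℝ), p + (0 : ℝ) • v) := by
      simpa using e1.hasFDerivAt
    have d3 := HasFDerivAt.comp_hasDerivAt (f := fun t : ℝ => ((0 : ℝ), p + t • v)) (0 : ℝ) e1' d2
    have d4 : HasDerivAt (fun t : ℝ => p + t • v) v 0 := by
      simpa using ((hasDerivAt_id (0 : ℝ)).smul_const v).const_add p
    refine d3.unique (d4.congr_of_eventuallyEq (Eventually.of_forall fun t => ?_))
    simp [iter_zero]
  have d5 : HasDerivAt (fun t : ℝ => iter psi (w * t) p) (w • fieldPsi p) 0 := by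
    have h1 : HasDerivAt (fun t : ℝ => w * t) w 0 := by
      simpa using (hasDerivAt_id (0 : ℝ)).const_mul w
    have h2 : HasDerivAt (fun t : ℝ => iter psi t p) (fieldPsi p) (w * 0) := by
      rw [mul_zero]
      exact hasVectorField_psi p hp
    exact h2.scomp 0 h1
  have d6 : HasDerivAt (fun t : ℝ => (z * t, iter psi (w * t) p)) (z, w • fieldPsi p) 0 := by
    have h1 : HasDerivAt (fun t : ℝ => z * t) z 0 := by
      simpa using (hasDerivAt_id (0 : ℝ)).const_mul z
    exact h1.prodMk d5
  have e2 : HasFDerivAt (fun q : ℝ × (ℝ × ℝ) => iter phi q.1 q.2)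
      (fderiv ℝ (fun q : ℝ × (ℝ × ℝ) => iter phi q.1 q.2) (0, p))
      (z * 0, iter psi (w * 0) p) := by
    simpa [iter_zero] using e1.hasFDerivAt
  have d7 := HasFDerivAt.comp_hasDerivAt (f := fun t : ℝ => (z * t, iter psi (w * t) p))
    (0 : ℝ) e2 d6
  have e3 : fderiv ℝ (fun q : ℝ × (ℝ × ℝ) => iter phi q.1 q.2) (0, p) (z, w • fieldPsi p) =
      z • fieldPhi p + w • fieldPsi p := by
    rw [← p1, ← map_smul]
    conv_rhs => rw [← p2 (w • fieldPsi p), ← map_add]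
    simp
  rw [e3] at d7
  simp only [iter_compIter]
  exact d7

theorem flowsCommute_phi_compIter : FlowsCommute conePsi phi (compIter phi psi z w) := by
  intro p hp
  have hp' := conePsi_subset_conePhi hp
  have t0 : Tendsto (fun u : ℝ × (ℝ × ℝ) => iter psi (w * u.1) u.2) (𝓝 (0, p)) (𝓝 p) :=
    (isProjectiveFlow_psi.tendsto_iter hp).comp (tendsto_mul_prodMk w p)
  have c1 : Tendsto (fun u : ℝ × (ℝ × ℝ) => (u.1, z * u.1, iter psi (w * u.1) u.2))
      (𝓝 (0, p)) (𝓝 ((0 : ℝ), (0 : ℝ), p)) :=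
    Tendsto.prodMk_nhds (Continuous.tendsto' (by fun_prop) _ _ (by simp))
      (Tendsto.prodMk_nhds (Continuous.tendsto' (by fun_prop) _ _ (by simp)) t0)
  have c2 : Tendsto (fun u : ℝ × (ℝ × ℝ) => (z * u.1, u.1, iter psi (w * u.1) u.2))
      (𝓝 (0, p)) (𝓝 ((0 : ℝ), (0 : ℝ), p)) :=
    Tendsto.prodMk_nhds (Continuous.tendsto' (by fun_prop) _ _ (by simp))
      (Tendsto.prodMk_nhds (Continuous.tendsto' (by fun_prop) _ _ (by simp)) t0)
  have c3 : Tendsto (fun u : ℝ × (ℝ × ℝ) => (u.1, w * u.1, u.2))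
      (𝓝 (0, p)) (𝓝 ((0 : ℝ), (0 : ℝ), p)) :=
    Continuous.tendsto' (by fun_prop) _ _ (by simp)
  filter_upwards [c1.eventually (isProjectiveFlow_phi.translation p hp'),
    c2.eventually (isProjectiveFlow_phi.translation p hp'),
    c3.eventually (eventually_iter_comm hp)] with u h1 h2 h3 hu
  rw [apply_smul_eq_smul_iter hu (compIter phi psi z w), apply_smul_eq_smul_iter hu phi,
    apply_smul_eq_smul_iter hu phi, apply_smul_eq_smul_iter hu (compIter phi psi z w),
    iter_compIter, iter_compIter, ← h1, add_comm, h2, h3]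

end CompIter

theorem flowsCommute_phi_psi : FlowsCommute conePsi phi psi := by
  have := flowsCommute_phi_compIter 0 1
  have e : compIter phi psi 0 1 = psi := by
    funext p
    simp [compIter, iter]
  rwa [e] at this

/-! ### Orbits -/

theorem Shift.orbit_phi {A : ℝ} {p q : ℝ × ℝ} (h : Shift A A p q) :
    ((p.1 - p.2) ^ 3 ≠ 0 → (q.1 - q.2) ^ 3 ≠ 0 ∧
      q.1 ^ 2 * q.2 ^ 2 / (q.1 - q.2) ^ 3 = p.1 ^ 2 * p.2 ^ 2 / (p.1 - p.2) ^ 3) ∧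
    ((p.1 - p.2) ^ 3 = 0 → (q.1 - q.2) ^ 3 = 0) := by
  have hc := h.cube_sub
  rw [sub_self, mul_zero, zero_mul, sub_zero] at hc
  have hne : (p.1 - p.2) ^ 3 ≠ 0 → (q.1 - q.2) ^ 3 ≠ 0 := by
    intro hp hq
    rw [hq, zero_mul] at hc
    have h3 : q.1 = 0 ∨ q.2 = 0 := by
      have := (mul_eq_zero.1 hc.symm).resolve_right hp
      simpa using this
    have h4 : q.1 = q.2 := sub_eq_zero.1 (pow_eq_zero_iff (three_ne_zero) |>.1 hq)
    rcases h3 with h3 | h3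
    · exact h.right_ne (Prod.ext h3 (h4 ▸ h3))
    · exact h.right_ne (Prod.ext (h4.trans h3) h3)
  refine ⟨fun hp => ⟨hne hp, ?_⟩, fun hp => ?_⟩
  · rw [div_eq_div_iff (hne hp) hp]
    linear_combination -hc
  · rw [hp, mul_zero] at hc
    have h4 : p.1 = p.2 := sub_eq_zero.1 (pow_eq_zero_iff (three_ne_zero) |>.1 hp)
    refine (mul_eq_zero.1 hc).resolve_right (mul_ne_zero (pow_ne_zero 2 fun h0 => ?_)
      (pow_ne_zero 2 fun h0 => ?_))
    · exact h.left_ne (Prod.ext h0 (h4 ▸ h0))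
    · exact h.left_ne (Prod.ext (h4.trans h0) h0)

theorem orbits_phi :
    OrbitsGivenBy conePhi phi (fun p => p.1 ^ 2 * p.2 ^ 2) (fun p => (p.1 - p.2) ^ 3) :=
  fun _ hp => (eventually_shift_phi hp).mono fun _ hu => hu.orbit_phi

theorem Shift.orbit_psi {B : ℝ} {p q : ℝ × ℝ} (h : Shift 0 B p q) :
    (3 * p.1 - p.2 ≠ 0 → 3 * q.1 - q.2 ≠ 0 ∧
      q.1 ^ 2 / (3 * q.1 - q.2) = p.1 ^ 2 / (3 * p.1 - p.2)) ∧
    (3 * p.1 - p.2 = 0 → 3 * q.1 - q.2 = 0) := by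
  have h1 : (3 * q.1 - q.2) * p.1 ^ 2 = q.1 ^ 2 * (3 * p.1 - p.2) := by
    linear_combination h.fst
  rcases eq_or_ne p.1 0 with h0 | h0
  · have hq := h.fst_eq_zero_iff.2 h0
    have hp2 : p.2 ≠ 0 := fun h2 => h.left_ne (Prod.ext h0 h2)
    have hq2 : q.2 ≠ 0 := mt h.snd_eq_zero_iff.1 hp2
    simp [h0, hq, hp2, hq2]
  · have hq := mt h.fst_eq_zero_iff.1 h0
    have hne : 3 * p.1 - p.2 ≠ 0 → 3 * q.1 - q.2 ≠ 0 := fun hp h3 => by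
      rw [h3, zero_mul] at h1
      exact mul_ne_zero (pow_ne_zero 2 hq) hp h1.symm
    refine ⟨fun hp => ⟨hne hp, ?_⟩, fun hp => ?_⟩
    · rw [div_eq_div_iff (hne hp) hp]
      linear_combination -h1
    · rw [hp, mul_zero] at h1
      exact (mul_eq_zero.1 h1).resolve_right (pow_ne_zero 2 h0)

theorem orbits_psi : OrbitsGivenBy conePsi psi (fun p => p.1 ^ 2) (fun p => 3 * p.1 - p.2) :=
  fun _ hp => (eventually_shift_psi hp).mono fun _ hu => hu.orbit_psi

theorem Shift.orbit_compIter {z w t : ℝ} {p q : ℝ × ℝ} (h : Shift (z * t) (z * t - w * t) p q) :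
    (z * (p.2 - p.1) ^ 3 + w * p.2 ^ 2 * (3 * p.1 - p.2) ≠ 0 →
      z * (q.2 - q.1) ^ 3 + w * q.2 ^ 2 * (3 * q.1 - q.2) ≠ 0 ∧
      q.1 ^ 2 * q.2 ^ 2 / (z * (q.2 - q.1) ^ 3 + w * q.2 ^ 2 * (3 * q.1 - q.2)) =
        p.1 ^ 2 * p.2 ^ 2 / (z * (p.2 - p.1) ^ 3 + w * p.2 ^ 2 * (3 * p.1 - p.2))) ∧
    (z * (p.2 - p.1) ^ 3 + w * p.2 ^ 2 * (3 * p.1 - p.2) = 0 →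
      z * (q.2 - q.1) ^ 3 + w * q.2 ^ 2 * (3 * q.1 - q.2) = 0) := by
  have key : (z * (q.2 - q.1) ^ 3 + w * q.2 ^ 2 * (3 * q.1 - q.2)) * (p.1 ^ 2 * p.2 ^ 2) =
      q.1 ^ 2 * q.2 ^ 2 * (z * (p.2 - p.1) ^ 3 + w * p.2 ^ 2 * (3 * p.1 - p.2)) := by
    linear_combination -z * h.cube_sub + w * q.2 ^ 2 * p.2 ^ 2 * h.fst
  rcases eq_or_ne p.1 0 with h0 | h0
  · have hq := h.fst_eq_zero_iff.2 h0
    have hp2 : p.2 ≠ 0 := fun h2 => h.left_ne (Prod.ext h0 h2)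
    have hq2 : q.2 ≠ 0 := mt h.snd_eq_zero_iff.1 hp2
    have e : ∀ x : ℝ, z * (x - 0) ^ 3 + w * x ^ 2 * (3 * 0 - x) = (z - w) * x ^ 3 := fun x => by
      ring
    rw [h0, hq, e, e]
    simp [hp2, hq2]
  rcases eq_or_ne p.2 0 with h2 | h2
  · have hq2 := h.snd_eq_zero_iff.2 h2
    have hq := mt h.fst_eq_zero_iff.1 h0
    simp [h2, hq2, h0, hq]
  have hq := mt h.fst_eq_zero_iff.1 h0
  have hq2 := mt h.snd_eq_zero_iff.1 h2
  have hpp : p.1 ^ 2 * p.2 ^ 2 ≠ 0 := mul_ne_zero (pow_ne_zero 2 h0) (pow_ne_zero 2 h2)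
  have hqq : q.1 ^ 2 * q.2 ^ 2 ≠ 0 := mul_ne_zero (pow_ne_zero 2 hq) (pow_ne_zero 2 hq2)
  have hne : z * (p.2 - p.1) ^ 3 + w * p.2 ^ 2 * (3 * p.1 - p.2) ≠ 0 →
      z * (q.2 - q.1) ^ 3 + w * q.2 ^ 2 * (3 * q.1 - q.2) ≠ 0 := fun hp h3 => by
    rw [h3, zero_mul] at key
    exact mul_ne_zero hqq hp key.symm
  refine ⟨fun hp => ⟨hne hp, ?_⟩, fun hp => ?_⟩
  · rw [div_eq_div_iff (hne hp) hp]
    linear_combination -key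
  · rw [hp, mul_zero] at key
    exact (mul_eq_zero.1 key).resolve_right hpp

theorem orbits_compIter (z w : ℝ) : OrbitsGivenBy conePsi (compIter phi psi z w)
    (fun p => p.1 ^ 2 * p.2 ^ 2)
    (fun p => z * (p.2 - p.1) ^ 3 + w * p.2 ^ 2 * (3 * p.1 - p.2)) :=
  fun _ hp => (eventually_shift_compIter z w hp).mono fun _ hu => hu.orbit_compIter

/-! ### The radical formula -/

theorem nearZero_shift_phi : NearZero conePhi fun p => Shift 1 1 p (phi p) := fun p hp => by
  filter_upwards [eventually_shift_phi hp] with u hu h0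
  rw [apply_smul_eq_smul_iter h0 phi]
  exact Shift.smul h0 (by simpa using hu)

theorem nearZero_shift_psi : NearZero conePsi fun p => Shift 0 (-1) p (psi p) := fun p hp => by
  filter_upwards [eventually_shift_psi hp] with u hu h0
  rw [apply_smul_eq_smul_iter h0 psi]
  exact Shift.smul h0 (by simpa using hu)

/-- The ratio `v / u` satisfies a cubic equation which, centred at `1`, has no quadratic term;
the root `K` below is a multiple of `v / u - 1`. -/
theorem Shift.exists_cubic_root {p q : ℝ × ℝ} (h : Shift 1 1 p q)
    (hD : p.2 - 3 * p.1 + 6 * p.1 ^ 2 ≠ 0) {c : ℝ} (hc0 : c ≠ 0)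
    (hc : c ^ 3 = p.1 - 3 * p.2 + 6 * p.2 ^ 2) :
    ∃ K : ℝ, K ^ 3 - 3 * K * ((p.1 - p.2) / c) = 2 * p.1 ∧
      q.1 = K * (p.1 * (p.1 - p.2)) / (c * (p.2 - 3 * p.1 + 6 * p.1 ^ 2))
        - 2 * p.1 ^ 2 / (p.2 - 3 * p.1 + 6 * p.1 ^ 2) := by
  have h1 := h.fst
  have h2 := h.snd
  have h3 := h.cube_sub
  rcases eq_or_ne p.1 0 with hx | hx
  · exact ⟨0, by simp [hx], by simp [hx, h.fst_eq_zero_iff.2 hx]⟩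
  have hu := mt h.fst_eq_zero_iff.1 hx
  by_cases hxy : p.1 = p.2
  · refine ⟨cbrt (2 * p.1), ?_, ?_⟩
    · rw [cbrt_pow_three, hxy]
      simp
    · have h4 : q.1 = q.2 := by
        have h5 : (q.1 - q.2) ^ 3 * (p.1 ^ 2 * p.2 ^ 2) = 0 := by
          rw [h3, hxy]
          ring
        have h6 : p.1 ^ 2 * p.2 ^ 2 ≠ 0 :=
          mul_ne_zero (pow_ne_zero 2 hx) (pow_ne_zero 2 (hxy ▸ hx))
        exact sub_eq_zero.1 (pow_eq_zero_iff three_ne_zero |>.1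
          ((mul_eq_zero.1 h5).resolve_right h6))
      have h7 : q.1 * (p.2 - 3 * p.1 + 6 * p.1 ^ 2) = -2 * p.1 ^ 2 := by
        apply mul_left_cancel₀ hu
        linear_combination h1 - p.1 ^ 2 * h4
      rw [show p.1 * (p.1 - p.2) = 0 by rw [hxy]; ring, mul_zero, zero_div, zero_sub,
        eq_neg_iff_add_eq_zero, ← neg_eq_iff_add_eq_zero, eq_div_iff hD]
      linear_combination -h7
  · have hxy' := sub_ne_zero.2 hxy
    refine ⟨(q.2 - q.1) * p.1 * c / (q.1 * (p.1 - p.2)), ?_, ?_⟩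
    · have key : p.1 ^ 2 * (p.1 - 3 * p.2 + 6 * p.2 ^ 2) * (q.2 - q.1) ^ 3 =
          (p.1 - p.2) ^ 3 * q.1 ^ 2 * (3 * q.2 - q.1) := by
        rcases eq_or_ne q.2 0 with hv | hv
        · rw [hv, h.snd_eq_zero_iff.1 hv]
          ring
        · apply mul_left_cancel₀ (pow_ne_zero 2 hv)
          linear_combination p.1 ^ 2 * (q.2 - q.1) ^ 3 * h2 + (3 * q.2 - q.1) * h3
      field_simp
      rw [hc]
      linear_combination key
    · generalize hd : p.2 - 3 * p.1 + 6 * p.1 ^ 2 = d at hD ⊢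
      field_simp
      linear_combination h1 + q.1 ^ 2 * -hd

theorem exists_cube_roots {x y s K P : ℂ} (hK : K ^ 3 - 3 * K * P = 2 * x)
    (hP : P ^ 3 = x ^ 2 - y ^ 2 * s ^ 2) :
    ∃ r₁ r₂ : ℂ, r₁ + r₂ = K ∧ r₁ * r₂ = P ∧ r₁ ^ 3 = x + y * s ∧ r₂ ^ 3 = x - y * s := by
  obtain ⟨d, hd⟩ := IsAlgClosed.exists_eq_mul_self (K ^ 2 - 4 * P)
  set a := (K + d) / 2 with ha
  set b := (K - d) / 2 with hb
  have h1 : a + b = K := by rw [ha, hb]; ring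
  have h2 : a * b = P := by
    rw [ha, hb]
    linear_combination hd / 4
  have h3 : a ^ 3 + b ^ 3 = 2 * x := by
    rw [← hK, ← h1, ← h2]
    ring
  have h4 : (a ^ 3 - (x + y * s)) * (a ^ 3 - (x - y * s)) = 0 := by
    have h5 : a ^ 3 * b ^ 3 = x ^ 2 - y ^ 2 * s ^ 2 := by rw [← hP, ← h2]; ring
    linear_combination a ^ 3 * h3 - h5
  rcases mul_eq_zero.1 h4 with h | h
  · exact ⟨a, b, h1, h2, by linear_combination h, by linear_combination h3 - h⟩
  · exact ⟨b, a, by rw [← h1]; ring, by rw [← h2]; ring, by linear_combination h3 - h,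
      by linear_combination h⟩

theorem Shift.isCardanoValue {p q : ℝ × ℝ} (h : Shift 1 1 p q)
    (hD : p.2 - 3 * p.1 + 6 * p.1 ^ 2 ≠ 0) (hR : p.1 - 3 * p.2 + 6 * p.2 ^ 2 ≠ 0) :
    IsCardanoValue p.1 p.2 q.1 := by
  set c := cbrt (p.1 - 3 * p.2 + 6 * p.2 ^ 2) with hcdef
  have hc : c ^ 3 = p.1 - 3 * p.2 + 6 * p.2 ^ 2 := cbrt_pow_three _
  have hc0 : c ≠ 0 := fun h0 => hR (by rw [← hc, h0]; norm_num)
  obtain ⟨K, hK, hu⟩ := h.exists_cubic_root hD hc0 hc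
  have hcC : (c : ℂ) ^ 3 = (p.1 : ℂ) - 3 * p.2 + 6 * p.2 ^ 2 := by exact_mod_cast hc
  have hc0C : (c : ℂ) ≠ 0 := by exact_mod_cast hc0
  have hRC : (p.1 : ℂ) - 3 * p.2 + 6 * p.2 ^ 2 ≠ 0 := by exact_mod_cast hR
  obtain ⟨s, hs⟩ := IsAlgClosed.exists_pow_nat_eq
    (((p.2 : ℂ) - 3 * p.1 + 6 * p.1 ^ 2) / ((p.1 : ℂ) - 3 * p.2 + 6 * p.2 ^ 2)) two_pos
  have hP : (((p.1 : ℂ) - p.2) / c) ^ 3 = (p.1 : ℂ) ^ 2 - (p.2 : ℂ) ^ 2 * s ^ 2 := by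
    rw [hs, div_pow, hcC, div_eq_iff hRC]
    linear_combination (p.2 : ℂ) ^ 2 * div_mul_cancel₀ ((p.2 : ℂ) - 3 * p.1 + 6 * p.1 ^ 2) hRC
  obtain ⟨r₁, r₂, h1, h2, h3, h4⟩ := exists_cube_roots (x := p.1) (y := p.2) (s := s)
    (K := K) (P := ((p.1 : ℂ) - p.2) / c) (by exact_mod_cast hK) hP
  refine ⟨hD, hR, s, r₁, r₂, c, hs, h3, h4, hcC, ?_, ?_⟩
  · rw [h2]
    field_simp
  · rw [h1]
    exact_mod_cast hu

/-- For two distinct real cube roots, the cubic equation solved by Cardano's formula has only one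
real root. -/
theorem Shift.eq_cardanoU {p q : ℝ × ℝ} (h : Shift 1 1 p q)
    (hpos : 0 < (p.2 - 3 * p.1 + 6 * p.1 ^ 2) * (p.1 - 3 * p.2 + 6 * p.2 ^ 2))
    (hy : p.2 ≠ 0) : q.1 = cardanoU p.1 p.2 := by
  have hD := left_ne_zero_of_mul hpos.ne'
  have hR := right_ne_zero_of_mul hpos.ne'
  set c := cbrt (p.1 - 3 * p.2 + 6 * p.2 ^ 2) with hcdef
  have hc : c ^ 3 = p.1 - 3 * p.2 + 6 * p.2 ^ 2 := cbrt_pow_three _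
  have hc0 : c ≠ 0 := fun h0 => hR (by rw [← hc, h0]; norm_num)
  obtain ⟨K, hK, hu⟩ := h.exists_cubic_root hD hc0 hc
  have hq : 0 < (p.2 - 3 * p.1 + 6 * p.1 ^ 2) / (p.1 - 3 * p.2 + 6 * p.2 ^ 2) := by
    rcases pos_and_pos_or_neg_and_neg_of_mul_pos hpos with h1 | h1
    exacts [div_pos h1.1 h1.2, div_pos_of_neg_of_neg h1.1 h1.2]
  unfold cardanoU
  set s := √((p.2 - 3 * p.1 + 6 * p.1 ^ 2) / (p.1 - 3 * p.2 + 6 * p.2 ^ 2)) with hsdef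
  have hs : s ^ 2 = (p.2 - 3 * p.1 + 6 * p.1 ^ 2) / (p.1 - 3 * p.2 + 6 * p.2 ^ 2) :=
    Real.sq_sqrt hq.le
  have hs0 : s ≠ 0 := (Real.sqrt_pos.2 hq).ne'
  have h1 : cbrt (p.1 + p.2 * s) ^ 3 = _ := cbrt_pow_three _
  have h2 : cbrt (p.1 - p.2 * s) ^ 3 = _ := cbrt_pow_three _
  set a := cbrt (p.1 + p.2 * s)
  set b := cbrt (p.1 - p.2 * s)
  have hP : a * b = (p.1 - p.2) / c := by
    refine (Odd.pow_injective (n := 3) (by decide)) ?_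
    simp only
    rw [mul_pow, h1, h2, div_pow, hc]
    have : (p.1 + p.2 * s) * (p.1 - p.2 * s) = p.1 ^ 2 - p.2 ^ 2 * s ^ 2 := by ring
    rw [this, hs, eq_div_iff hR]
    linear_combination -p.2 ^ 2 * div_mul_cancel₀ (p.2 - 3 * p.1 + 6 * p.1 ^ 2) hR
  have hab : a - b ≠ 0 := fun h0 => by
    have : a = b := sub_eq_zero.1 h0
    rw [this, h2] at h1
    exact mul_ne_zero hy hs0 (by linarith)
  have hKab : K = a + b := by
    rw [← hP] at hK
    have h3 : (K - (a + b)) * ((K + (a + b) / 2) ^ 2 + 3 / 4 * (a - b) ^ 2) = 0 := by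
      linear_combination hK - h1 - h2
    refine sub_eq_zero.1 ((mul_eq_zero.1 h3).resolve_right (ne_of_gt ?_))
    have : 0 < (a - b) ^ 2 := by positivity
    positivity
  rw [hu, hKab]

theorem nearZero_cardanoU : NearZero coneReal fun p =>
    phi p = (cardanoU p.1 p.2, cardanoU p.2 p.1) := by
  intro p hp
  have hp' : p ∈ conePhi := fun h0 => by
    rw [h0] at hp
    simp [coneReal] at hp
  have h2 : p.2 ≠ 0 := fun h0 => by
    have : 0 < (p.1 - 3 * p.2) * (p.2 - 3 * p.1) := hp
    rw [h0] at this
    nlinarith [sq_nonneg p.1]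
  have h1 : p.1 ≠ 0 := fun h0 => by
    have : 0 < (p.1 - 3 * p.2) * (p.2 - 3 * p.1) := hp
    rw [h0] at this
    nlinarith [sq_nonneg p.2]
  have c1 : ContinuousAt (fun u : ℝ × (ℝ × ℝ) =>
      (u.2.2 - 3 * u.2.1 + 6 * u.1 * u.2.1 ^ 2) * (u.2.1 - 3 * u.2.2 + 6 * u.1 * u.2.2 ^ 2))
      (0, p) := by fun_prop
  have c2 : ContinuousAt (fun u : ℝ × (ℝ × ℝ) => u.2.1) (0, p) := by fun_prop
  have c3 : ContinuousAt (fun u : ℝ × (ℝ × ℝ) => u.2.2) (0, p) := by fun_prop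
  have h3 : 0 < (p.1 - 3 * p.2) * (p.2 - 3 * p.1) := hp
  filter_upwards [nearZero_shift_phi p hp', c1.eventually_const_lt (u := 0) (by
      simpa [mul_comm] using h3), c2.eventually_ne h1, c3.eventually_ne h2] with u hu hpos k1 k2 h0
  have hu := hu h0
  have hpos' : 0 < ((u.1 • u.2).2 - 3 * (u.1 • u.2).1 + 6 * (u.1 • u.2).1 ^ 2) *
      ((u.1 • u.2).1 - 3 * (u.1 • u.2).2 + 6 * (u.1 • u.2).2 ^ 2) := by
    have : 0 < u.1 ^ 2 := by positivity
    refine (mul_pos this hpos).trans_eq ?_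
    simp only [Prod.smul_fst, Prod.smul_snd, smul_eq_mul]
    ring
  refine Prod.ext (hu.eq_cardanoU hpos' (mul_ne_zero h0 k2)) ?_
  refine hu.swap.eq_cardanoU ?_ (mul_ne_zero h0 k1)
  rw [mul_comm]
  exact hpos'

theorem nearZero_isCardanoValue :
    NearZero {p : ℝ × ℝ | p.1 - 3 * p.2 ≠ 0 ∧ p.2 - 3 * p.1 ≠ 0} fun p =>
      IsCardanoValue p.1 p.2 (phi p).1 ∧ IsCardanoValue p.2 p.1 (phi p).2 := by
  intro p hp
  have hp' : p ∈ conePhi := fun h0 => by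
    rw [h0] at hp
    simp at hp
  have c1 : ContinuousAt (fun u : ℝ × (ℝ × ℝ) =>
      u.2.2 - 3 * u.2.1 + 6 * u.1 * u.2.1 ^ 2) (0, p) := by fun_prop
  have c2 : ContinuousAt (fun u : ℝ × (ℝ × ℝ) =>
      u.2.1 - 3 * u.2.2 + 6 * u.1 * u.2.2 ^ 2) (0, p) := by fun_prop
  filter_upwards [nearZero_shift_phi p hp', c1.eventually_ne (y := 0) (by simpa using hp.2),
    c2.eventually_ne (y := 0) (by simpa using hp.1)] with u hu k1 k2 h0
  have hu := hu h0
  have l1 : (u.1 • u.2).2 - 3 * (u.1 • u.2).1 + 6 * (u.1 • u.2).1 ^ 2 ≠ 0 := by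
    refine ne_of_eq_of_ne ?_ (mul_ne_zero h0 k1)
    simp only [Prod.smul_fst, Prod.smul_snd, smul_eq_mul]
    ring
  have l2 : (u.1 • u.2).1 - 3 * (u.1 • u.2).2 + 6 * (u.1 • u.2).2 ^ 2 ≠ 0 := by
    refine ne_of_eq_of_ne ?_ (mul_ne_zero h0 k2)
    simp only [Prod.smul_fst, Prod.smul_snd, smul_eq_mul]
    ring
  exact ⟨hu.isCardanoValue l1 l2, hu.swap.isCardanoValue l2 l1⟩

/-! ### The cubic equation -/

theorem Shift.cubicEquation {p q : ℝ × ℝ} (h : Shift 0 (-1) p q) (hx : p.1 ≠ 0) (hy : p.2 ≠ 0) :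
    CubicEquation q.1 p.1 p.2 ∧ q.2 = q.1 ^ 2 * (p.2 - 3 * p.1) / p.1 ^ 2 + 3 * q.1 := by
  have ha := mt h.fst_eq_zero_iff.1 hx
  have hb := mt h.snd_eq_zero_iff.1 hy
  have h1 := h.fst
  have h2 := h.snd
  have h3 : q.1 * (q.1 * p.2 - 3 * q.1 * p.1 + 3 * p.1 ^ 2) = q.2 * p.1 ^ 2 := by
    linear_combination h1
  have h4 : q.1 * p.2 - 3 * q.1 * p.1 + 3 * p.1 ^ 2 ≠ 0 := fun h0 => by
    rw [h0, mul_zero] at h3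
    exact mul_ne_zero hb (pow_ne_zero 2 hx) h3.symm
  have h5 : q.1 * (q.1 * p.2 - 3 * q.1 * p.1 + 3 * p.1 ^ 2) ^ 2 ≠ 0 :=
    mul_ne_zero ha (pow_ne_zero 2 h4)
  refine ⟨⟨h5, ?_⟩, ?_⟩
  · rw [div_eq_iff h5]
    apply mul_left_cancel₀ ha
    have h6 : q.1 ^ 2 * (q.1 * p.2 - 3 * q.1 * p.1 + 3 * p.1 ^ 2) ^ 2 = (q.2 * p.1 ^ 2) ^ 2 := by
      rw [← h3]
      ring
    linear_combination -(p.1 - 3 * p.2 - 6 * p.2 ^ 2) * h6 + p.1 ^ 4 * -h2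
      + 3 * p.1 ^ 2 * p.2 ^ 2 * -h3
  · field_simp
    linear_combination -h1

theorem nearZero_cubicEquation : NearZero coneGeneric fun p => CubicEquation (psi p).1 p.1 p.2 ∧
    (psi p).2 = (psi p).1 ^ 2 * (p.2 - 3 * p.1) / p.1 ^ 2 + 3 * (psi p).1 := by
  intro p hp
  filter_upwards [nearZero_shift_psi p (coneGeneric_subset_conePsi hp),
    (isOpenCone_coneGeneric.1.preimage continuous_snd).mem_nhds
      (show ((0 : ℝ), p).2 ∈ coneGeneric from hp)] with u h1 h2 h0
  have h3 := isOpenCone_coneGeneric.2.2 u.2 h2 u.1 h0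
  exact (h1 h0).cubicEquation h3.1 h3.2.1

theorem CubicEquation.scaled {g t x y : ℝ} (ht : t ≠ 0) (h : CubicEquation g (t * x) (t * y)) :
    (9 * (t⁻¹ * g) * x - 8 * x ^ 2 - 3 * (t⁻¹ * g) * y) * x ^ 2 * y ^ 2 =
      (x - 3 * y - 6 * t * y ^ 2) * ((t⁻¹ * g) * ((t⁻¹ * g) * (y - 3 * x) + 3 * x ^ 2) ^ 2) := by
  obtain ⟨h1, h2⟩ := h
  rw [div_eq_iff h1] at h2
  obtain ⟨γ, rfl⟩ : ∃ γ, g = t * γ := ⟨t⁻¹ * g, by rw [mul_inv_cancel_left₀ ht]⟩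
  rw [inv_mul_cancel_left₀ ht]
  apply mul_left_cancel₀ (pow_ne_zero 6 ht)
  linear_combination h2

/-- At `t = 0` the value `x` is a simple root of the scaled cubic equation, so that two branches
with this limit coincide. -/
theorem cubicEquation_unique (g : ℝ × ℝ → ℝ)
    (hg : ∀ p ∈ coneGeneric, Tendsto (fun q : ℝ × (ℝ × ℝ) => q.1⁻¹ * g (q.1 • q.2))
      (𝓝 ((0 : ℝ), p) ⊓ 𝓟 {q | q.1 ≠ 0}) (𝓝 p.1))
    (hc : NearZero coneGeneric fun p => CubicEquation (g p) p.1 p.2) :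
    NearZero coneGeneric fun p => g p = (psi p).1 := by
  intro p hp
  set l := 𝓝 ((0 : ℝ), p) ⊓ 𝓟 {q : ℝ × (ℝ × ℝ) | q.1 ≠ 0} with hl
  have l0 : l ≤ 𝓝 ((0 : ℝ), p) := inf_le_left
  have t1 := hg p hp
  have t2 : Tendsto (fun q : ℝ × (ℝ × ℝ) => q.1⁻¹ * (psi (q.1 • q.2)).1) l (𝓝 p.1) := by
    have h1 := ((isProjectiveFlow_psi.tendsto_iter (coneGeneric_subset_conePsi hp)).mono_left l0)
    refine ((continuous_fst.tendsto p).comp h1).congr' ?_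
    filter_upwards [mem_inf_of_right (mem_principal_self _)] with q hq
    rw [apply_smul_eq_smul_iter hq psi]
    simp only [Function.comp_apply, Prod.smul_fst, smul_eq_mul]
    rw [inv_mul_cancel_left₀ hq]
  have t0 : Tendsto (fun q : ℝ × (ℝ × ℝ) => q) l (𝓝 ((0 : ℝ), p)) := l0
  -- the difference quotient of the two sides of the cubic equation
  let Q : (ℝ × (ℝ × ℝ)) × ℝ × ℝ → ℝ := fun v =>
    (9 * v.1.2.1 - 3 * v.1.2.2) * v.1.2.1 ^ 2 * v.1.2.2 ^ 2
      - (v.1.2.1 - 3 * v.1.2.2 - 6 * v.1.1 * v.1.2.2 ^ 2) *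
        ((v.1.2.2 - 3 * v.1.2.1) ^ 2 * (v.2.1 ^ 2 + v.2.1 * v.2.2 + v.2.2 ^ 2)
          + 6 * (v.1.2.2 - 3 * v.1.2.1) * v.1.2.1 ^ 2 * (v.2.1 + v.2.2) + 9 * v.1.2.1 ^ 4)
  have hQ : Continuous Q := by fun_prop
  have hQ0 : Q ((0, p), p.1, p.1) ≠ 0 := by
    have h1 : Q ((0, p), p.1, p.1) = 6 * p.1 ^ 2 * p.2 * (p.1 - p.2) ^ 2 := by
      simp only [Q]
      ring
    rw [h1]
    exact mul_ne_zero (mul_ne_zero (mul_ne_zero (by norm_num) (pow_ne_zero 2 hp.1)) hp.2.1)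
      (pow_ne_zero 2 (sub_ne_zero.2 hp.2.2))
  have t3 := (hQ.tendsto _).comp (t0.prodMk_nhds (t1.prodMk_nhds t2))
  have key : ∀ᶠ q in l, g (q.1 • q.2) = (psi (q.1 • q.2)).1 := by
    filter_upwards [t3.eventually_ne hQ0, l0 (hc p hp), l0 (nearZero_cubicEquation p hp),
      mem_inf_of_right (mem_principal_self _)] with q h1 h2 h3 h0
    replace h0 : q.1 ≠ 0 := h0
    have e1 := CubicEquation.scaled h0 (h2 h0)
    have e2 := CubicEquation.scaled h0 (h3 h0).1
    have e3 : (q.1⁻¹ * g (q.1 • q.2) - q.1⁻¹ * (psi (q.1 • q.2)).1) *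
        Q (q, q.1⁻¹ * g (q.1 • q.2), q.1⁻¹ * (psi (q.1 • q.2)).1) = 0 := by
      simp only [Q]
      linear_combination e1 - e2
    have e4 := sub_eq_zero.1 ((mul_eq_zero.1 e3).resolve_right h1)
    exact mul_left_cancel₀ (inv_ne_zero h0) e4
  exact eventually_inf_principal.1 key

/-! ### Polynomials on open sets and lines -/

theorem exists_eval_ne_zero_of_isOpen {c : MvPolynomial (Fin 2) ℝ} (hc : c ≠ 0)
    {V : Set (ℝ × ℝ)} (hV : IsOpen V) (hne : V.Nonempty) :
    ∃ p ∈ V, MvPolynomial.eval ![p.1, p.2] c ≠ 0 := by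
  by_contra! h
  obtain ⟨p, hp⟩ := hne
  obtain ⟨ε, hε, hb⟩ := Metric.isOpen_iff.1 hV p hp
  apply hc
  have hinf : ∀ a : ℝ, (Metric.ball a ε).Infinite := fun a => by
    rw [Real.ball_eq_Ioo]
    exact Set.Ioo_infinite (by linarith)
  refine MvPolynomial.funext_set (![Metric.ball p.1 ε, Metric.ball p.2 ε]) ?_ fun x hx => ?_
  · intro i
    fin_cases i
    exacts [hinf p.1, hinf p.2]
  · rw [map_zero]
    have h0 := hx 0 trivial
    have h1 := hx 1 trivial
    have hx' : x = ![x 0, x 1] := by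
      ext i
      fin_cases i <;> rfl
    rw [hx']
    refine h (x 0, x 1) (hb ?_)
    rw [Metric.mem_ball, Prod.dist_eq]
    exact max_lt h0 h1

/-- A polynomial with infinitely many zeros on a line through the origin vanishes on that line. -/
theorem eval_smul_eq_zero_of_infinite {c : MvPolynomial (Fin 2) ℝ} {p : ℝ × ℝ} {S : Set ℝ}
    (hS : S.Infinite) (h : ∀ t ∈ S, MvPolynomial.eval ![t * p.1, t * p.2] c = 0) :
    MvPolynomial.eval ![p.1, p.2] c = 0 := by
  let F : Polynomial ℝ := MvPolynomial.aeval
    ![Polynomial.X * Polynomial.C p.1, Polynomial.X * Polynomial.C p.2] c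
  have hF : ∀ t : ℝ, F.eval t = MvPolynomial.eval ![t * p.1, t * p.2] c := fun t => by
    have h1 : F.eval t = (Polynomial.aeval t : Polynomial ℝ →ₐ[ℝ] ℝ) F := by
      rw [Polynomial.coe_aeval_eq_eval]
    rw [h1, MvPolynomial.comp_aeval_apply, MvPolynomial.aeval_eq_eval]
    congr 2
    ext i
    fin_cases i
    · simp [mul_comm t]
    · simp [mul_comm t]
  have hF0 : F = 0 := Polynomial.eq_zero_of_infinite_isRoot F
    (hS.mono fun t ht => by
      rw [Set.mem_ofPred_eq, Polynomial.IsRoot, hF]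
      exact h t ht)
  have := hF 1
  rw [hF0] at this
  simpa using this.symm

/-- Up to a power of the polynomial `M` in the denominator, `f` is a polynomial function. -/
def IsFraction (M : Polynomial ℝ) (f : ℝ → ℝ) : Prop :=
  ∃ (N : Polynomial ℝ) (k : ℕ), ∀ r, f r * M.eval r ^ k = N.eval r

namespace IsFraction

variable {M : Polynomial ℝ} {f g : ℝ → ℝ}

theorem eval (N : Polynomial ℝ) : IsFraction M fun r => N.eval r := ⟨N, 0, fun r => by simp⟩

theorem add (hf : IsFraction M f) (hg : IsFraction M g) : IsFraction M fun r => f r + g r := by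
  obtain ⟨N, k, h⟩ := hf
  obtain ⟨N', l, h'⟩ := hg
  refine ⟨N * M ^ l + N' * M ^ k, k + l, fun r => ?_⟩
  simp only [Polynomial.eval_add, Polynomial.eval_mul, Polynomial.eval_pow, ← h, ← h']
  ring

theorem mul (hf : IsFraction M f) (hg : IsFraction M g) : IsFraction M fun r => f r * g r := by
  obtain ⟨N, k, h⟩ := hf
  obtain ⟨N', l, h'⟩ := hg
  refine ⟨N * N', k + l, fun r => ?_⟩
  simp only [Polynomial.eval_mul, ← h, ← h']
  ring

theorem const (c : ℝ) : IsFraction M fun _ => c :=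
  ⟨Polynomial.C c, 0, fun r => by simp⟩

theorem pow (hf : IsFraction M f) (n : ℕ) : IsFraction M fun r => f r ^ n := by
  obtain ⟨N, k, h⟩ := hf
  refine ⟨N ^ n, k * n, fun r => ?_⟩
  rw [Polynomial.eval_pow, ← h, mul_pow, pow_mul]

theorem mvPolynomial_eval (hf : IsFraction M f) (hg : IsFraction M g)
    (c : MvPolynomial (Fin 2) ℝ) : IsFraction M fun r => MvPolynomial.eval ![f r, g r] c := by
  induction c using MvPolynomial.induction_on with
  | C a => simpa using const a
  | add c d hc hd => simpa using hc.add hd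
  | mul_X c i hc =>
    have hi : IsFraction M fun r => (![f r, g r] : Fin 2 → ℝ) i := by
      fin_cases i
      exacts [hf, hg]
    simpa using hc.mul hi

theorem polynomial_eval {h : ℝ → ℝ} (hf : IsFraction M f) (hg : IsFraction M g)
    (hh : IsFraction M h) (P : Polynomial (MvPolynomial (Fin 2) ℝ)) :
    IsFraction M fun r => (P.map (MvPolynomial.eval ![f r, g r])).eval (h r) := by
  induction P using Polynomial.induction_on' with
  | add P Q hP hQ => simpa using hP.add hQ
  | monomial n c => simpa using (mvPolynomial_eval hf hg c).mul (hh.pow n)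

theorem eq_zero_of_infinite (hf : IsFraction M f) {S : Set ℝ} (hS : S.Infinite)
    (h0 : ∀ r ∈ S, f r = 0) {r : ℝ} (hr : M.eval r ≠ 0) : f r = 0 := by
  obtain ⟨N, k, h⟩ := hf
  have hN : N = 0 := Polynomial.eq_zero_of_infinite_isRoot N (hS.mono fun s hs => by
    rw [Set.mem_ofPred_eq, Polynomial.IsRoot, ← h, h0 s hs, zero_mul])
  have := h r
  rw [hN, Polynomial.eval_zero] at this
  exact (mul_eq_zero.1 this).resolve_right (pow_ne_zero k hr)

end IsFraction

/-! ### The degree of the two coordinates -/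

/-- For `κ < 0` the three values of the ratio `b / a` belonging to one value of the parameter `κ`
are real. -/
theorem exists_three_roots {κ : ℝ} (hκ : κ < 0) : ∃ r : Fin 3 → ℝ, Function.Injective r ∧
    ∀ i, r i ^ 2 * (3 - r i) = κ * (3 * r i - 1) := by
  let h : ℝ → ℝ := fun r => κ * (3 * r - 1) - r ^ 2 * (3 - r)
  have hc : Continuous h := by fun_prop
  have v1 : h (κ - 1) < 0 := by
    simp only [h]
    nlinarith [mul_pos_of_neg_of_neg hκ hκ, mul_neg_of_pos_of_neg (mul_pos_of_neg_of_neg hκ hκ) hκ]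
  have v2 : 0 < h 0 := by
    simp only [h]
    linarith
  have v3 : h (1 / 3) < 0 := by
    simp only [h]
    norm_num
  have v4 : 0 < h (3 - 3 * κ) := by
    simp only [h]
    nlinarith [mul_pos_of_neg_of_neg hκ hκ, mul_neg_of_pos_of_neg (mul_pos_of_neg_of_neg hκ hκ) hκ]
  obtain ⟨a, ha, ha0⟩ := intermediate_value_Ioo (by linarith : κ - 1 ≤ 0) hc.continuousOn
    ⟨v1, v2⟩
  obtain ⟨b, hb, hb0⟩ := intermediate_value_Ioo' (by norm_num : (0 : ℝ) ≤ 1 / 3) hc.continuousOn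
    ⟨v3, v2⟩
  obtain ⟨c, hcc, hc0⟩ := intermediate_value_Ioo (by linarith : 1 / 3 ≤ 3 - 3 * κ) hc.continuousOn
    ⟨v3, v4⟩
  have hab : a < b := ha.2.trans hb.1
  have hbc : b < c := hb.2.trans hcc.1
  have hmono : StrictMono ![a, b, c] := by
    rw [Fin.strictMono_iff_lt_succ]
    intro i
    fin_cases i
    exacts [hab, hbc]
  refine ⟨![a, b, c], hmono.injective, fun i => ?_⟩
  fin_cases i
  · exact (sub_eq_zero.1 ha0).symm
  · exact (sub_eq_zero.1 hb0).symm
  · exact (sub_eq_zero.1 hc0).symm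

/-- On a line through the origin, the graph of `f` is parametrized rationally by a ratio `R`, and
for infinitely many values of the parameter `t` of the line there are three points of the
parametrized curve above `t`. Hence no polynomial of degree two vanishes along `f`. -/
theorem three_le_natDegree {f : ℝ × ℝ → ℝ} {g : Polynomial ℝ}
    (hg : ∀ κ < 0, ∀ r s : ℝ, r ^ 2 * (3 - r) = κ * (3 * r - 1) →
      s ^ 2 * (3 - s) = κ * (3 * s - 1) → g.eval r = g.eval s → r = s)
    (hf : ∀ p ∈ coneGeneric, 3 * p.1 - p.2 ≠ 0 → ∀ᶠ t in 𝓝[≠] (0 : ℝ), ∃ R : ℝ, R ≠ 0 ∧ R ≠ 3 ∧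
      (3 * R - 1) * ((3 * p.1 - p.2) / p.1 ^ 2) =
        (3 - R) * R ^ 2 * ((3 * p.2 - p.1) / p.2 ^ 2 + 6 * t) ∧
      f (t • p) = t * (g.eval R / ((3 * p.1 - p.2) / p.1 ^ 2)))
    {C' : Set (ℝ × ℝ)} {P : Polynomial (MvPolynomial (Fin 2) ℝ)} (hC' : IsOpenCone C')
    (hne : C'.Nonempty) (hsub : C' ⊆ coneGeneric) (hP : P ≠ 0)
    (hPf : NearZero C' fun p => evalAlong P f p = 0) : 3 ≤ P.natDegree := by
  by_contra! hdeg
  have hl : P.leadingCoeff * (3 * MvPolynomial.X 0 - MvPolynomial.X 1) ≠ 0 := by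
    refine mul_ne_zero (Polynomial.leadingCoeff_ne_zero.2 hP) fun h => ?_
    have := congrArg (MvPolynomial.eval ![0, 1]) h
    simp at this
  obtain ⟨p, hp, hlp⟩ := exists_eval_ne_zero_of_isOpen hl hC'.1 hne
  rw [map_mul] at hlp
  have hl0 := left_ne_zero_of_mul hlp
  have hp3 : 3 * p.1 - p.2 ≠ 0 := by simpa using right_ne_zero_of_mul hlp
  have hpg := hsub hp
  set T₁ := (3 * p.1 - p.2) / p.1 ^ 2 with hT₁
  set T₂ := (3 * p.2 - p.1) / p.2 ^ 2
  have hT₁0 : T₁ ≠ 0 := div_ne_zero hp3 (pow_ne_zero 2 hpg.1)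
  let M : Polynomial ℝ := 6 * Polynomial.X ^ 2 * (3 - Polynomial.X)
  let N : Polynomial ℝ := (3 * Polynomial.X - 1) * Polynomial.C T₁ -
    (3 - Polynomial.X) * Polynomial.X ^ 2 * Polynomial.C T₂
  have hM : ∀ r, M.eval r = 6 * r ^ 2 * (3 - r) := fun r => by simp [M]
  have hN : ∀ r, N.eval r = (3 * r - 1) * T₁ - (3 - r) * r ^ 2 * T₂ := fun r => by
    simp only [N, Polynomial.eval_sub, Polynomial.eval_mul, Polynomial.eval_X, Polynomial.eval_pow,
      Polynomial.eval_C, Polynomial.eval_ofNat, Polynomial.eval_one]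
  have hM0 : ∀ r, r ≠ 0 → r ≠ 3 → M.eval r ≠ 0 := fun r h0 h3 => by
    rw [hM]
    exact mul_ne_zero (mul_ne_zero (by norm_num) (pow_ne_zero 2 h0)) (sub_ne_zero.2 h3.symm)
  let τ : ℝ → ℝ := fun r => N.eval r / M.eval r
  have hτ : IsFraction M τ := by
    refine ⟨N * M, 2, fun r => ?_⟩
    simp only [τ, Polynomial.eval_mul]
    rcases eq_or_ne (M.eval r) 0 with h | h
    · simp [h]
    · field_simp
  let Φ : ℝ → ℝ := fun r => (P.map (MvPolynomial.eval ![τ r * p.1, τ r * p.2])).eval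
    (τ r * (g.eval r / T₁))
  have hΦ : IsFraction M Φ := IsFraction.polynomial_eval (hτ.mul (IsFraction.const _))
    (hτ.mul (IsFraction.const _))
    (hτ.mul ((IsFraction.eval g).mul (IsFraction.const T₁⁻¹))) P
  -- the values of the ratio at the points of the line near the origin
  have hev : ∀ᶠ t in 𝓝[≠] (0 : ℝ), ∃ R : ℝ, τ R = t ∧ Φ R = 0 := by
    have t1 : Tendsto (fun t : ℝ => (t, p)) (𝓝[≠] 0) (𝓝 (0, p)) :=
      ((Continuous.prodMk_left p).tendsto' (0 : ℝ) (0, p) rfl).mono_left nhdsWithin_le_nhds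
    filter_upwards [hf p hpg hp3, t1.eventually (hPf p hp), self_mem_nhdsWithin] with t h1 h2 h0
    obtain ⟨R, hR0, hR3, hR, hfR⟩ := h1
    have hτR : τ R = t := by
      simp only [τ]
      rw [div_eq_iff (hM0 R hR0 hR3), hM, hN]
      linear_combination hR
    refine ⟨R, hτR, ?_⟩
    have h3 := h2 h0
    simp only [evalAlong, hfR] at h3
    simp only [Φ, hτR]
    exact h3
  have hinf : {R : ℝ | Φ R = 0}.Infinite := by
    intro hfin
    have hfin' := hfin.image τ
    obtain ⟨δ, hδ, hb⟩ := Metric.mem_nhdsWithin_iff.1 hev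
    refine (Set.Ioo_infinite (a := (0 : ℝ)) (b := δ) hδ) (hfin'.subset fun t ht => ?_)
    have hmem : t ∈ Metric.ball (0 : ℝ) δ ∩ {0}ᶜ := by
      refine ⟨?_, ht.1.ne'⟩
      rw [Metric.mem_ball, Real.dist_eq, sub_zero, abs_of_pos ht.1]
      exact ht.2
    obtain ⟨R, h1, h2⟩ := hb hmem
    exact ⟨R, h2, h1⟩
  have hzero : ∀ r, r ≠ 0 → r ≠ 3 → Φ r = 0 := fun r h0 h3 =>
    hΦ.eq_zero_of_infinite hinf (fun _ h => h) (hM0 r h0 h3)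
  -- three points above `t = (T₁ / κ - T₂) / 6`
  have hlead : ∀ κ < 0, (T₁ / κ - T₂) / 6 ≠ 0 →
      MvPolynomial.eval ![(T₁ / κ - T₂) / 6 * p.1, (T₁ / κ - T₂) / 6 * p.2] P.leadingCoeff = 0 := by
    intro κ hκ ht
    obtain ⟨r, hr, hrκ⟩ := exists_three_roots hκ
    have hr0 : ∀ i, r i ≠ 0 := fun i h => by
      have := hrκ i
      rw [h] at this
      linarith
    have hr3 : ∀ i, r i ≠ 3 := fun i h => by
      have := hrκ i
      rw [h] at this
      linarith
    have hτr : ∀ i, τ (r i) = (T₁ / κ - T₂) / 6 := fun i => by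
      simp only [τ]
      rw [div_eq_iff (hM0 _ (hr0 i) (hr3 i)), hM, hN]
      have h1 : r i ^ 2 * (3 - r i) / κ = 3 * r i - 1 := by
        rw [hrκ i]
        field_simp [hκ.ne]
      linear_combination -T₁ * h1
    have hz : P.map (MvPolynomial.eval
        ![(T₁ / κ - T₂) / 6 * p.1, (T₁ / κ - T₂) / 6 * p.2]) = 0 := by
      refine Polynomial.eq_zero_of_natDegree_lt_card_of_eval_eq_zero _
        (f := fun i => (T₁ / κ - T₂) / 6 * (g.eval (r i) / T₁)) ?_ (fun i => ?_) ?_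
      · intro i j hij
        apply hr
        refine hg κ hκ _ _ (hrκ i) (hrκ j) ?_
        have := mul_left_cancel₀ ht hij
        field_simp at this
        exact this
      · have := hzero (r i) (hr0 i) (hr3 i)
        simp only [Φ, hτr] at this
        exact this
      · rw [Fintype.card_fin]
        exact Polynomial.natDegree_map_le.trans_lt hdeg
    have := congrArg (fun F => Polynomial.coeff F P.natDegree) hz
    simpa using this
  refine hl0 (eval_smul_eq_zero_of_infinite
    (S := (fun κ => (T₁ / κ - T₂) / 6) '' (Set.Iio 0) \ {0}) ?_ ?_)
  · refine Set.Infinite.sdiff ?_ (Set.finite_singleton 0)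
    refine (Set.Iio_infinite (0 : ℝ)).image fun κ hκ μ hμ h => ?_
    have hκ' : κ ≠ 0 := ne_of_lt hκ
    have hμ' : μ ≠ 0 := ne_of_lt hμ
    have h1 : T₁ / κ = T₁ / μ := by linarith
    rw [div_eq_div_iff hκ' hμ'] at h1
    exact (mul_left_cancel₀ hT₁0 h1).symm
  · rintro _ ⟨⟨κ, hκ, rfl⟩, ht⟩
    exact hlead κ hκ ht

/-- The parametrization of `ψ` on the line through `p` by the ratio `R = b / a`. -/
theorem eventually_ratio_psi {p : ℝ × ℝ} (hp : p ∈ coneGeneric) (hp3 : 3 * p.1 - p.2 ≠ 0) :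
    ∀ᶠ t in 𝓝[≠] (0 : ℝ), ∃ R : ℝ, R ≠ 0 ∧ R ≠ 3 ∧
      (3 * R - 1) * ((3 * p.1 - p.2) / p.1 ^ 2) =
        (3 - R) * R ^ 2 * ((3 * p.2 - p.1) / p.2 ^ 2 + 6 * t) ∧
      (psi (t • p)).1 = t * ((3 - R) / ((3 * p.1 - p.2) / p.1 ^ 2)) ∧
      (psi (t • p)).2 = t * (R * (3 - R) / ((3 * p.1 - p.2) / p.1 ^ 2)) := by
  have t1 : Tendsto (fun t : ℝ => (t, p)) (𝓝[≠] 0) (𝓝 (0, p)) :=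
    ((Continuous.prodMk_left p).tendsto' (0 : ℝ) (0, p) rfl).mono_left nhdsWithin_le_nhds
  filter_upwards [t1.eventually (eventually_shift_psi (coneGeneric_subset_conePsi hp)),
    self_mem_nhdsWithin] with t h h0
  rw [apply_smul_eq_smul_iter h0 psi]
  set q := iter psi t p
  have hx := hp.1
  have hy := hp.2.1
  have ha := mt h.fst_eq_zero_iff.1 hx
  have hb := mt h.snd_eq_zero_iff.1 hy
  have e1 : 3 * q.1 - q.2 = q.1 ^ 2 * ((3 * p.1 - p.2) / p.1 ^ 2) := by
    field_simp
    linear_combination h.fst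
  have e2 : 3 * q.2 - q.1 = q.2 ^ 2 * ((3 * p.2 - p.1) / p.2 ^ 2 + 6 * t) := by
    field_simp
    linear_combination h.snd
  have hT₁ : (3 * p.1 - p.2) / p.1 ^ 2 ≠ 0 := div_ne_zero hp3 (pow_ne_zero 2 hx)
  set T₁ := (3 * p.1 - p.2) / p.1 ^ 2
  set T₂ := (3 * p.2 - p.1) / p.2 ^ 2
  have e3 : 3 - q.2 / q.1 = q.1 * T₁ := by
    field_simp
    linear_combination e1
  refine ⟨q.2 / q.1, div_ne_zero hb ha, fun h3 => ?_, ?_, ?_, ?_⟩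
  · rw [h3, sub_self] at e3
    exact mul_ne_zero ha hT₁ e3.symm
  · rw [e3]
    field_simp
    linear_combination e2
  · rw [e3, mul_div_cancel_right₀ _ hT₁]
    rfl
  · rw [e3, ← mul_assoc, mul_div_cancel_right₀ _ hT₁, div_mul_cancel₀ _ ha]
    rfl

theorem evalAlong_cubic (a b c d : MvPolynomial (Fin 2) ℝ) (f : ℝ × ℝ → ℝ) (p : ℝ × ℝ) :
    evalAlong (Polynomial.C a * Polynomial.X ^ 3 + Polynomial.C b * Polynomial.X ^ 2 +
      Polynomial.C c * Polynomial.X + Polynomial.C d) f p =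
    MvPolynomial.eval ![p.1, p.2] a * f p ^ 3 + MvPolynomial.eval ![p.1, p.2] b * f p ^ 2 +
      MvPolynomial.eval ![p.1, p.2] c * f p + MvPolynomial.eval ![p.1, p.2] d := by
  simp [evalAlong]

theorem exists_cubic {C : Set (ℝ × ℝ)} {f : ℝ × ℝ → ℝ} (a b c d : MvPolynomial (Fin 2) ℝ)
    (ha : a ≠ 0) (h : NearZero C fun p => MvPolynomial.eval ![p.1, p.2] a * f p ^ 3 +
      MvPolynomial.eval ![p.1, p.2] b * f p ^ 2 + MvPolynomial.eval ![p.1, p.2] c * f p +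
      MvPolynomial.eval ![p.1, p.2] d = 0) :
    ∃ P : Polynomial (MvPolynomial (Fin 2) ℝ), P ≠ 0 ∧ P.natDegree = 3 ∧
      NearZero C fun p => evalAlong P f p = 0 := by
  have hd := Polynomial.natDegree_cubic (b := b) (c := c) (d := d) ha
  refine ⟨_, fun h0 => ?_, hd, ?_⟩
  · rw [h0] at hd
    simp at hd
  · simpa only [evalAlong_cubic] using h

theorem NearZero.mono {C : Set (ℝ × ℝ)} {P Q : ℝ × ℝ → Prop} (h : NearZero C P)
    (hPQ : ∀ p, P p → Q p) : NearZero C Q :=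
  fun p hp => (h p hp).mono fun _ hu h0 => hPQ _ (hu h0)

open MvPolynomial in
theorem isAlgebraicOfDegree_psi_fst : IsAlgebraicOfDegree coneGeneric (fun p => (psi p).1) 3 := by
  refine ⟨exists_cubic ((X 0 - 3 * X 1 - 6 * X 1 ^ 2) * (X 1 - 3 * X 0) ^ 2)
    (6 * (X 0 - 3 * X 1 - 6 * X 1 ^ 2) * (X 1 - 3 * X 0) * X 0 ^ 2)
    (9 * (X 0 - 3 * X 1 - 6 * X 1 ^ 2) * X 0 ^ 4 - (9 * X 0 - 3 * X 1) * X 0 ^ 2 * X 1 ^ 2)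
    (8 * X 0 ^ 4 * X 1 ^ 2) (fun h => ?_) ?_, fun C' P hC' hne hsub hP hPf =>
      three_le_natDegree (g := 3 - Polynomial.X) (fun κ _ r s _ _ h => ?_)
        (fun p hp hp3 => ?_) hC' hne hsub hP hPf⟩
  · have := congrArg (eval ![1, 0]) h
    norm_num at this
  · refine nearZero_cubicEquation.mono fun p hp => ?_
    have h1 := hp.1.2
    rw [div_eq_iff hp.1.1] at h1
    simp only [map_mul, map_sub, map_pow, eval_X, map_ofNat, Matrix.cons_val_zero,
      Matrix.cons_val_one]
    linear_combination -h1
  · simpa using h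
  · refine (eventually_ratio_psi hp hp3).mono fun t ht => ?_
    obtain ⟨R, h0, h3, hR, h1, -⟩ := ht
    exact ⟨R, h0, h3, hR, by simpa using h1⟩

open MvPolynomial in
theorem isAlgebraicOfDegree_psi_snd : IsAlgebraicOfDegree coneGeneric (fun p => (psi p).2) 3 := by
  refine ⟨exists_cubic ((3 * X 0 - X 1) * (3 * X 1 - X 0 + 6 * X 1 ^ 2) ^ 2)
    (-6 * (3 * X 0 - X 1) * (3 * X 1 - X 0 + 6 * X 1 ^ 2) * X 1 ^ 2)
    (9 * (3 * X 0 - X 1) * X 1 ^ 4 + 3 * (3 * X 1 - X 0 + 6 * X 1 ^ 2) * X 0 ^ 2 * X 1 ^ 2)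
    (-8 * X 0 ^ 2 * X 1 ^ 4) (fun h => ?_) (fun p hp => ?_), fun C' P hC' hne hsub hP hPf =>
      three_le_natDegree (g := Polynomial.X * (3 - Polynomial.X)) (fun κ hκ r s hr hs h => ?_)
        (fun p hp hp3 => ?_) hC' hne hsub hP hPf⟩
  · have := congrArg (eval ![1, 0]) h
    norm_num at this
  · filter_upwards [nearZero_shift_psi p (coneGeneric_subset_conePsi hp)] with u hu h0
    have h := hu h0
    generalize u.1 • u.2 = r at h ⊢
    simp only [map_mul, map_sub, map_add, map_pow, eval_X, map_ofNat, map_neg,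
      Matrix.cons_val_zero, Matrix.cons_val_one]
    rcases eq_or_ne (psi r).2 0 with hb | hb
    · rw [hb, h.snd_eq_zero_iff.1 hb]
      ring
    -- eliminate the first coordinate of `ψ` from the two equations of `Shift`
    have h2 : (psi r).1 * r.2 ^ 2 =
        (psi r).2 * (3 * r.2 ^ 2 - (3 * r.2 - r.1 + 6 * r.2 ^ 2) * (psi r).2) := by
      linear_combination -h.snd
    have h1 : 3 * ((psi r).1 * r.2 ^ 2) * r.1 ^ 2 * r.2 ^ 2 - (psi r).2 * r.1 ^ 2 * r.2 ^ 4 =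
        ((psi r).1 * r.2 ^ 2) ^ 2 * (3 * r.1 - r.2) := by
      linear_combination r.2 ^ 4 * h.fst
    rw [h2] at h1
    apply mul_left_cancel₀ hb
    linear_combination -h1
  · by_contra hne
    simp only [Polynomial.eval_mul, Polynomial.eval_X, Polynomial.eval_sub,
      Polynomial.eval_ofNat] at h
    have h1 : (3 * κ - r * (3 - r)) * (r - s) = 0 := by
      linear_combination -hr + hs + s * h
    have h2 := (mul_eq_zero.1 h1).resolve_right (sub_ne_zero.2 hne)
    have h3 : κ = 0 := by linear_combination r * h2 + hr
    exact hκ.ne h3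
  · refine (eventually_ratio_psi hp hp3).mono fun t ht => ?_
    obtain ⟨R, h0, h3, hR, -, h1⟩ := ht
    exact ⟨R, h0, h3, hR, by simpa using h1⟩

/-! ### Flows commuting with `φ`: invariance of the coefficients -/

section Commuting

variable {V : Set (ℝ × ℝ)} {η Y : ℝ × ℝ → ℝ × ℝ} {T : ℝ × ℝ → ℝ}

theorem tendsto_left (p : ℝ × ℝ) : Tendsto (fun t : ℝ => (t, p)) (𝓝[≠] 0) (𝓝 (0, p)) :=
  ((Continuous.prodMk_left p).tendsto' (0 : ℝ) (0, p) rfl).mono_left nhdsWithin_le_nhds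

/-- For `T` homogeneous of degree `-1`, the change of `T` under `η` near the origin is, to first
order, the derivative of `T` along the vector field of `η`. -/
theorem tendsto_defect (hη : IsProjectiveFlow V η) (hY : HasVectorField V η Y)
    (hT : ∀ p ∈ V, DifferentiableAt ℝ T p)
    (hT1 : ∀ p ∈ V, ∀ t : ℝ, t ≠ 0 → T (t • p) = t⁻¹ * T p) {p : ℝ × ℝ} (hp : p ∈ V) :
    Tendsto (fun t : ℝ => T (η (t • p)) - T (t • p)) (𝓝[≠] 0) (𝓝 (fderiv ℝ T p (Y p))) := by
  have h0 : HasFDerivAt T (fderiv ℝ T p) (iter η 0 p) := by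
    rw [iter_zero]
    exact (hT p hp).hasFDerivAt
  have h1 := HasFDerivAt.comp_hasDerivAt (f := fun t : ℝ => iter η t p) (0 : ℝ) h0 (hY p hp)
  have h2 := h1.tendsto_slope_zero
  refine h2.congr' ?_
  have h3 : ∀ᶠ t in 𝓝[≠] (0 : ℝ), iter η t p ∈ V :=
    ((hη.tendsto_iter hp).comp (tendsto_left p)).eventually (hη.cone.1.mem_nhds hp)
  filter_upwards [h3, self_mem_nhdsWithin] with t ht h0
  replace h0 : t ≠ 0 := h0
  rw [hT1 p hp t h0, apply_smul_eq_smul_iter h0 η, hT1 _ ht t h0]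
  simp only [zero_add, Function.comp_apply, iter_zero, smul_eq_mul]
  ring

/-- If `T` is shifted by a constant along `φ` and `η` commutes with `φ`, then `T ∘ η - T` is
invariant under `φ`, hence under all iterates `φ^s`; its limit at the origin in the direction
`p` is the derivative of `T` along the vector field of `η`. -/
theorem eventually_fderiv_field_eq (hV : V ⊆ conePhi) (hη : IsProjectiveFlow V η)
    (hY : HasVectorField V η Y) (hc : FlowsCommute V phi η)
    (hT : ∀ p ∈ V, DifferentiableAt ℝ T p)
    (hT1 : ∀ p ∈ V, ∀ t : ℝ, t ≠ 0 → T (t • p) = t⁻¹ * T p)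
    (hTphi : NearZero V fun p => T (phi p) = T p - 6) {p : ℝ × ℝ} (hp : p ∈ V) :
    ∀ᶠ s in 𝓝 (0 : ℝ), fderiv ℝ T (iter phi s p) (Y (iter phi s p)) = fderiv ℝ T p (Y p) := by
  have hinv : ∀ᶠ u in 𝓝 ((0 : ℝ), p), u.1 ≠ 0 →
      T (η (phi (u.1 • u.2))) - T (phi (u.1 • u.2)) = T (η (u.1 • u.2)) - T (u.1 • u.2) := by
    have h1 : Tendsto (fun u : ℝ × (ℝ × ℝ) => (u.1, iter η u.1 u.2)) (𝓝 (0, p)) (𝓝 (0, p)) :=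
      (continuous_fst.tendsto' _ _ rfl).prodMk_nhds (hη.tendsto_iter hp)
    filter_upwards [hc p hp, hTphi p hp, h1.eventually (hTphi p hp)] with u k1 k2 k3 h0
    have k3 := k3 h0
    simp only [← apply_smul_eq_smul_iter h0 η] at k3
    rw [← k1 h0, k2 h0, k3]
    ring
  have hmem : ∀ᶠ u in 𝓝 ((0 : ℝ), p), u.2 ∈ V :=
    (hη.cone.1.preimage continuous_snd).mem_nhds (show ((0 : ℝ), p).2 ∈ V from hp)
  obtain ⟨ε, hε, hbox⟩ := exists_box (hinv.and hmem)
  have hclose : ∀ᶠ s in 𝓝 (0 : ℝ), dist (iter phi s p) p < ε :=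
    ((isProjectiveFlow_phi.tendsto_iter (hV hp)).comp
      ((Continuous.prodMk_left p).tendsto' (0 : ℝ) (0, p) rfl)).eventually
      (Metric.ball_mem_nhds p hε)
  have htrans : ∀ᶠ a : ℝ × ℝ in 𝓝 (0, 0), iter phi (a.1 + a.2) p = iter phi a.1 (iter phi a.2 p) :=
    (Continuous.tendsto' (f := fun a : ℝ × ℝ => (a.1, a.2, p)) (by fun_prop) (0, 0)
      ((0 : ℝ), (0 : ℝ), p) rfl).eventually (isProjectiveFlow_phi.translation p (hV hp))
  obtain ⟨δ₁, hδ₁, h₁⟩ := Metric.eventually_nhds_iff.1 hclose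
  obtain ⟨δ₂, hδ₂, h₂⟩ := Metric.eventually_nhds_iff.1 htrans
  refine Metric.eventually_nhds_iff.2 ⟨min δ₁ δ₂, lt_min hδ₁ hδ₂, fun s hs => ?_⟩
  rw [lt_min_iff, dist_zero_right, Real.norm_eq_abs] at hs
  rcases eq_or_ne s 0 with rfl | hs0
  · rw [iter_zero]
  have hqV : iter phi s p ∈ V :=
    (hbox 0 (by simpa using hε) _ (h₁ (by simpa using hs.1))).2
  let t : ℕ → ℝ := fun n => s / ((n : ℝ) + 1)
  have ht : Tendsto t atTop (𝓝[≠] 0) := by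
    refine tendsto_nhdsWithin_iff.2 ⟨?_, Eventually.of_forall fun n => ?_⟩
    · have := (tendsto_one_div_add_atTop_nhds_zero_nat (𝕜 := ℝ)).const_mul s
      simpa [t, div_eq_mul_inv] using this
    · exact div_ne_zero hs0 (by positivity)
  have l1 := (tendsto_defect hη hY hT hT1 hqV).comp ht
  have l2 := (tendsto_defect hη hY hT hT1 hp).comp ht
  refine tendsto_nhds_unique (l1.congr' ?_) l2
  -- pass from `p` to `φ^s(p)` in `n + 1` steps of length `s / (n + 1)`
  have hsmall : ∀ᶠ n in atTop, |t n| < ε := by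
    have h0 : Tendsto (fun n => |t n|) atTop (𝓝 0) := by
      simpa using (ht.mono_right nhdsWithin_le_nhds).abs
    exact h0.eventually_lt_const hε
  filter_upwards [hsmall] with n hn
  have htn : t n ≠ 0 := div_ne_zero hs0 (by positivity)
  have hle : ∀ k : ℕ, k ≤ n + 1 → |(k : ℝ) * t n| ≤ |s| := fun k hk => by
    have e : (k : ℝ) * t n = (k / ((n : ℝ) + 1)) * s := by
      simp only [t]
      ring
    rw [e, abs_mul]
    refine mul_le_of_le_one_left (abs_nonneg s) ?_
    rw [abs_of_nonneg (by positivity), div_le_one (by positivity)]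
    exact_mod_cast hk
  have key : ∀ k : ℕ, k ≤ n + 1 →
      T (η (t n • iter phi (k * t n) p)) - T (t n • iter phi (k * t n) p) =
        T (η (t n • p)) - T (t n • p) := by
    intro k
    induction k with
    | zero => intro _; simp [iter_zero]
    | succ k ih =>
      intro hk
      have hk' : k ≤ n + 1 := by omega
      have e1 : iter phi ((k + 1 : ℕ) * t n) p = iter phi (t n) (iter phi (k * t n) p) := by
        have := @h₂ (t n, k * t n) (by
          rw [Prod.dist_eq]
          refine max_lt ?_ ?_
          · simpa using (by simpa using hle 1 (by omega) : |t n| ≤ |s|).trans_lt hs.2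
          · rw [Real.dist_eq, sub_zero]
            exact (hle k hk').trans_lt hs.2)
        rw [← this]
        congr 1
        push_cast
        ring
      have hd : dist (iter phi (k * t n) p) p < ε :=
        h₁ (by simpa [abs_mul] using (hle k hk').trans_lt hs.1)
      rw [e1, ← apply_smul_eq_smul_iter htn phi, (hbox (t n) hn _ hd).1 htn]
      exact ih hk'
  have := key (n + 1) le_rfl
  have e : ((n + 1 : ℕ) : ℝ) * t n = s := by
    simp only [t]
    push_cast
    field_simp
  rw [e] at this
  exact this

theorem fderiv_field_smul (hη : IsProjectiveFlow V η) (hY : HasVectorField V η Y)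
    (hT : ∀ p ∈ V, DifferentiableAt ℝ T p)
    (hT1 : ∀ p ∈ V, ∀ t : ℝ, t ≠ 0 → T (t • p) = t⁻¹ * T p) {p : ℝ × ℝ} (hp : p ∈ V)
    {c : ℝ} (h0 : c ≠ 0) : fderiv ℝ T (c • p) (Y (c • p)) = fderiv ℝ T p (Y p) := by
  have h1 := tendsto_defect hη hY hT hT1 (hη.cone.2.2 p hp c h0)
  have h2 : Tendsto (fun t : ℝ => t * c) (𝓝[≠] 0) (𝓝[≠] 0) := by
    refine tendsto_nhdsWithin_iff.2 ⟨(Continuous.tendsto' (by fun_prop) _ _ (by simp)).mono_left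
      nhdsWithin_le_nhds, ?_⟩
    filter_upwards [self_mem_nhdsWithin] with t ht
    exact mul_ne_zero ht h0
  have h3 := (tendsto_defect hη hY hT hT1 hp).comp h2
  refine tendsto_nhds_unique h1 (h3.congr fun t => ?_)
  simp only [Function.comp_apply, smul_smul]

/-- The derivative of `T` along the vector field of `η` is invariant under `φ` and under scaling,
and these move the points in independent directions. -/
theorem fderiv_fderiv_field_eq_zero (hV : V ⊆ coneGeneric) (hη : IsProjectiveFlow V η)
    (hY : HasVectorField V η Y) (hc : FlowsCommute V phi η)
    (hT : ∀ p ∈ V, ContDiffAt ℝ ∞ T p)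
    (hT1 : ∀ p ∈ V, ∀ t : ℝ, t ≠ 0 → T (t • p) = t⁻¹ * T p)
    (hTphi : NearZero V fun p => T (phi p) = T p - 6) {p : ℝ × ℝ} (hp : p ∈ V) :
    DifferentiableAt ℝ (fun q => fderiv ℝ T q (Y q)) p ∧
      fderiv ℝ (fun q => fderiv ℝ T q (Y q)) p = 0 := by
  have hT' : ∀ p ∈ V, DifferentiableAt ℝ T p := fun p hp => (hT p hp).differentiableAt (by simp)
  have hV' : V ⊆ conePhi :=
    (hV.trans coneGeneric_subset_conePsi).trans conePsi_subset_conePhi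
  have hd : DifferentiableAt ℝ (fun q => fderiv ℝ T q (Y q)) p :=
    (((hT p hp).fderiv_right (m := ∞) (by simp)).clm_apply
      (hη.contDiffAt_field hY hp)).differentiableAt (by simp)
  refine ⟨hd, ?_⟩
  set L := fderiv ℝ (fun q => fderiv ℝ T q (Y q)) p with hL
  have hLp : L p = 0 := by
    have d1 : HasDerivAt (fun c : ℝ => c • p) p 1 := by
      simpa using (hasDerivAt_id (1 : ℝ)).smul_const p
    have h0 : HasFDerivAt (fun q => fderiv ℝ T q (Y q)) L ((1 : ℝ) • p) := by
      rw [one_smul]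
      exact hd.hasFDerivAt
    have d2 := HasFDerivAt.comp_hasDerivAt (f := fun c : ℝ => c • p) (1 : ℝ) h0 d1
    refine d2.unique ((hasDerivAt_const (1 : ℝ) (fderiv ℝ T p (Y p))).congr_of_eventuallyEq ?_)
    filter_upwards [eventually_ne_nhds one_ne_zero] with c hc0
    exact fderiv_field_smul hη hY hT' hT1 hp hc0
  have hLX : L (fieldPhi p) = 0 := by
    have h0 : HasFDerivAt (fun q => fderiv ℝ T q (Y q)) L (iter phi 0 p) := by
      rw [iter_zero]
      exact hd.hasFDerivAt
    have d2 := HasFDerivAt.comp_hasDerivAt (f := fun s : ℝ => iter phi s p) (0 : ℝ) h0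
      (hasVectorField_phi p (hV' hp))
    exact d2.unique ((hasDerivAt_const (0 : ℝ) (fderiv ℝ T p (Y p))).congr_of_eventuallyEq
      (eventually_fderiv_field_eq hV' hη hY hc hT' hT1 hTphi hp))
  have hlin : ∀ v : ℝ × ℝ, L v = v.1 * L (1, 0) + v.2 * L (0, 1) := fun v => by
    have : v = v.1 • ((1 : ℝ), (0 : ℝ)) + v.2 • ((0 : ℝ), (1 : ℝ)) := by
      ext <;> simp
    conv_lhs => rw [this]
    rw [map_add, map_smul, map_smul, smul_eq_mul, smul_eq_mul]
  rw [hlin] at hLp hLX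
  obtain ⟨hx, hy, hxy⟩ := hV hp
  have hdet : p.1 * p.2 * (p.1 - p.2) ≠ 0 :=
    mul_ne_zero (mul_ne_zero hx hy) (sub_ne_zero.2 hxy)
  simp only [fieldPhi] at hLX
  have e1 : L (1, 0) = 0 := by
    refine (mul_eq_zero.1 ?_).resolve_left hdet
    linear_combination p.2 * hLX - (p.1 * p.2 + 2 * p.2 ^ 2) * hLp
  have e2 : L (0, 1) = 0 := by
    refine (mul_eq_zero.1 ?_).resolve_left hdet
    linear_combination (2 * p.1 ^ 2 + p.1 * p.2) * hLp - p.1 * hLX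
  refine ContinuousLinearMap.ext fun v => ?_
  rw [hlin, e1, e2]
  simp

theorem fderiv_field_const (hV : V ⊆ coneGeneric) (hη : IsProjectiveFlow V η)
    (hY : HasVectorField V η Y) (hc : FlowsCommute V phi η)
    (hT : ∀ p ∈ V, ContDiffAt ℝ ∞ T p)
    (hT1 : ∀ p ∈ V, ∀ t : ℝ, t ≠ 0 → T (t • p) = t⁻¹ * T p)
    (hTphi : NearZero V fun p => T (phi p) = T p - 6) {W : Set (ℝ × ℝ)} (hW : W ⊆ V)
    (hWo : IsOpen W) (hWc : IsPreconnected W) : ∃ α : ℝ, ∀ q ∈ W, fderiv ℝ T q (Y q) = α :=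
  hWo.exists_is_const_of_fderiv_eq_zero hWc
    (fun _ hq => (fderiv_fderiv_field_eq_zero hV hη hY hc hT hT1 hTphi
      (hW hq)).1.differentiableWithinAt)
    (fun _ hq => (fderiv_fderiv_field_eq_zero hV hη hY hc hT hT1 hTphi (hW hq)).2)

/-- The first integral `(3x - y) / x²` of `ψ`. -/
noncomputable def integralFst (p : ℝ × ℝ) : ℝ := (3 * p.1 - p.2) / p.1 ^ 2

/-- The function `(3y - x) / y²`, the mirror image of `integralFst`. -/
noncomputable def integralSnd (p : ℝ × ℝ) : ℝ := (3 * p.2 - p.1) / p.2 ^ 2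

theorem integralFst_smul (p : ℝ × ℝ) {t : ℝ} (ht : t ≠ 0) :
    integralFst (t • p) = t⁻¹ * integralFst p := by
  simp only [integralFst, Prod.smul_fst, Prod.smul_snd, smul_eq_mul]
  rcases eq_or_ne p.1 0 with h | h
  · simp [h]
  · field_simp

theorem contDiffAt_integralFst {n : WithTop ℕ∞} {p : ℝ × ℝ} (hp : p.1 ≠ 0) :
    ContDiffAt ℝ n integralFst p := by
  unfold integralFst
  exact ContDiffAt.div (by fun_prop) (by fun_prop) (pow_ne_zero 2 hp)

theorem Shift.integralFst_eq {A B : ℝ} {p q : ℝ × ℝ} (h : Shift A B p q) (hp : p.1 ≠ 0) :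
    integralFst q = integralFst p - 6 * A := by
  have hq := mt h.fst_eq_zero_iff.1 hp
  unfold integralFst
  field_simp
  linear_combination h.fst

theorem fderiv_integralFst {p : ℝ × ℝ} (hp : p.1 ≠ 0) (v : ℝ × ℝ) :
    fderiv ℝ integralFst p v * p.1 ^ 3 = (2 * p.2 - 3 * p.1) * v.1 - p.1 * v.2 := by
  have hd : DifferentiableAt ℝ integralFst p :=
    (contDiffAt_integralFst (n := 1) hp).differentiableAt (by simp)
  have d0 : HasDerivAt (fun t : ℝ => p + t • v) v 0 := by
    simpa using ((hasDerivAt_id (0 : ℝ)).smul_const v).const_add p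
  have h0 : HasFDerivAt integralFst (fderiv ℝ integralFst p) (p + (0 : ℝ) • v) := by
    simpa using hd.hasFDerivAt
  have d1 := HasFDerivAt.comp_hasDerivAt (f := fun t : ℝ => p + t • v) (0 : ℝ) h0 d0
  have d2 := (((hasDerivAt_fst d0).const_mul 3).sub (hasDerivAt_snd d0)).div
    ((hasDerivAt_fst d0).pow 2) (by simpa using hp)
  rw [d1.unique d2]
  simp
  field_simp
  ring

theorem fderiv_integralSnd {p : ℝ × ℝ} (hp : p.2 ≠ 0) (v : ℝ × ℝ) :
    fderiv ℝ integralSnd p v * p.2 ^ 3 = (2 * p.1 - 3 * p.2) * v.2 - p.2 * v.1 := by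
  have h1 : HasFDerivAt integralFst (fderiv ℝ integralFst p.swap) p.swap :=
    ((contDiffAt_integralFst (n := 1) (p := p.swap) hp).differentiableAt (by simp)).hasFDerivAt
  have h2 : HasFDerivAt (Prod.swap : ℝ × ℝ → ℝ × ℝ)
      (ContinuousLinearEquiv.prodComm ℝ ℝ ℝ : ℝ × ℝ →L[ℝ] ℝ × ℝ) p :=
    (ContinuousLinearEquiv.prodComm ℝ ℝ ℝ).hasFDerivAt
  have h3 : HasFDerivAt integralSnd _ p := h1.comp p h2
  rw [h3.fderiv]
  exact fderiv_integralFst (p := p.swap) hp v.swap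

/-- On a connected set of directions off the axes and the diagonal, the vector field of a flow
commuting with `φ` is a linear combination of the fields of `φ` and `ψ`. -/
theorem exists_field_eq (hV : V ⊆ coneGeneric) (hη : IsProjectiveFlow V η)
    (hY : HasVectorField V η Y) (hc : FlowsCommute V phi η) {W : Set (ℝ × ℝ)} (hW : W ⊆ V)
    (hWo : IsOpen W) (hWc : IsPreconnected W) :
    ∃ z w : ℝ, ∀ q ∈ W, Y q = z • fieldPhi q + w • fieldPsi q := by
  have hV' : V ⊆ conePhi :=
    (hV.trans coneGeneric_subset_conePsi).trans conePsi_subset_conePhi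
  have hS : NearZero V fun p => p ∈ V ∧ Shift 1 1 p (phi p) := fun p hp => by
    have hmem : ∀ᶠ u in 𝓝 ((0 : ℝ), p), u.2 ∈ V :=
      (hη.cone.1.preimage continuous_snd).mem_nhds (show ((0 : ℝ), p).2 ∈ V from hp)
    filter_upwards [nearZero_shift_phi p (hV' hp), hmem] with u h1 h2 h0
    exact ⟨hη.cone.2.2 _ h2 _ h0, h1 h0⟩
  obtain ⟨α, hα⟩ := fderiv_field_const (T := integralFst) hV hη hY hc
    (fun p hp => contDiffAt_integralFst (hV hp).1) (fun p _ t ht => integralFst_smul p ht)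
    (hS.mono fun p hp => by
      rw [hp.2.integralFst_eq (hV hp.1).1, mul_one]) hW hWo hWc
  obtain ⟨β, hβ⟩ := fderiv_field_const (T := integralSnd) hV hη hY hc
    (fun p hp => (contDiffAt_integralFst (p := p.swap) (hV hp).2.1).comp p
      (contDiff_snd.prodMk contDiff_fst).contDiffAt)
    (fun p _ t ht => integralFst_smul p.swap ht)
    (hS.mono fun p hp => by
      have := hp.2.swap.integralFst_eq (hV hp.1).2.1
      rwa [mul_one] at this) hW hWo hWc
  -- the derivatives of the two first integrals are `-6, -6` along `fieldPhi` and `0, 6` along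
  -- `fieldPsi`
  refine ⟨-α / 6, (β - α) / 6, fun q hq => ?_⟩
  obtain ⟨hx, hy, hxy⟩ := hV (hW hq)
  have hxy' := sub_ne_zero.2 hxy
  have e1 := fderiv_integralFst hx (Y q)
  have e2 := fderiv_integralSnd hy (Y q)
  rw [hα q hq] at e1
  rw [hβ q hq] at e2
  -- the determinant of the linear equations `e1`, `e2` for `Y q`
  have hdet : (-6 : ℝ) * (q.1 - q.2) ^ 2 ≠ 0 :=
    mul_ne_zero (by norm_num) (pow_ne_zero 2 hxy')
  ext
  · simp only [fieldPhi, fieldPsi, Prod.fst_add, Prod.smul_fst, smul_eq_mul]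
    apply mul_left_cancel₀ hdet
    field_simp
    linear_combination -((2 * q.1 - 3 * q.2) * e1 + q.1 * e2)
  · simp only [fieldPhi, fieldPsi, Prod.snd_add, Prod.smul_snd, smul_eq_mul]
    apply mul_left_cancel₀ hdet
    field_simp
    linear_combination -((2 * q.2 - 3 * q.1) * e2 + q.2 * e1)

end Commuting

/-! ### Flows commuting with `φ`: globalization -/

/-- A function that is smooth at `s` and agrees with a polynomial on either side of `s` agrees
with the same polynomial on both sides. -/
theorem polynomial_eq_of_contDiffAt {s : ℝ} (n : ℕ) : ∀ {f : ℝ → ℝ} {P Q : Polynomial ℝ},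
    P.natDegree ≤ n → Q.natDegree ≤ n → ContDiffAt ℝ ∞ f s →
    (∀ᶠ t in 𝓝[>] s, f t = P.eval t) → (∀ᶠ t in 𝓝[<] s, f t = Q.eval t) → P = Q := by
  have heval : ∀ {f : ℝ → ℝ} {P Q : Polynomial ℝ}, ContDiffAt ℝ ∞ f s →
      (∀ᶠ t in 𝓝[>] s, f t = P.eval t) → (∀ᶠ t in 𝓝[<] s, f t = Q.eval t) →
      P.eval s = Q.eval s := by
    intro f P Q hf hP hQ
    have e1 := tendsto_nhds_unique ((hf.continuousAt.mono_left nhdsWithin_le_nhds).congr' hP)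
      (P.continuous.continuousAt.mono_left nhdsWithin_le_nhds)
    have e2 := tendsto_nhds_unique ((hf.continuousAt.mono_left nhdsWithin_le_nhds).congr' hQ)
      (Q.continuous.continuousAt.mono_left nhdsWithin_le_nhds)
    exact e1.symm.trans e2
  have hconst : ∀ {P Q : Polynomial ℝ}, Polynomial.derivative P = Polynomial.derivative Q →
      P.eval s = Q.eval s → P = Q := by
    intro P Q hd he
    have h1 := Polynomial.eq_C_of_derivative_eq_zero (p := P - Q) (by simp [hd])
    have h2 : (P - Q).eval s = 0 := by simp [he]
    rw [h1, Polynomial.eval_C] at h2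
    rw [h2, Polynomial.C_0] at h1
    exact sub_eq_zero.1 h1
  induction n with
  | zero =>
    intro f P Q hP hQ hf h1 h2
    refine hconst ?_ (heval hf h1 h2)
    rw [Polynomial.derivative_of_natDegree_zero (by omega),
      Polynomial.derivative_of_natDegree_zero (by omega)]
  | succ n ih =>
    intro f P Q hP hQ hf h1 h2
    refine hconst ?_ (heval hf h1 h2)
    have hder : ∀ {R : Polynomial ℝ} {S : Set ℝ}, IsOpen S → (∀ᶠ t in 𝓝[S] s, f t = R.eval t) →
        ∀ᶠ t in 𝓝[S] s, deriv f t = (Polynomial.derivative R).eval t := by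
      intro R S hS h
      filter_upwards [eventually_eventually_nhdsWithin.2 h, self_mem_nhdsWithin] with t ht hts
      rw [hS.nhdsWithin_eq hts] at ht
      rw [EventuallyEq.deriv_eq (f := fun t => R.eval t) ht, Polynomial.deriv]
    have hf' : ContDiffAt ℝ ∞ (deriv f) s := by
      have := (hf.fderiv_right (m := ∞) (by simp)).clm_apply
        (contDiffAt_const (c := (1 : ℝ)))
      exact this
    exact ih ((Polynomial.natDegree_derivative_le P).trans (by omega))
      ((Polynomial.natDegree_derivative_le Q).trans (by omega)) hf'
      (hder isOpen_Ioi h1) (hder isOpen_Iio h2)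

open MvPolynomial in
/-- An open set contains a point off the axes and the diagonal at which a given nonzero
polynomial does not vanish. -/
theorem exists_mem_coneGeneric {c : MvPolynomial (Fin 2) ℝ} (hc : c ≠ 0) {V : Set (ℝ × ℝ)}
    (hV : IsOpen V) (hne : V.Nonempty) :
    ∃ p ∈ V, p ∈ coneGeneric ∧ eval ![p.1, p.2] c ≠ 0 := by
  have h01 : (X 0 - X 1 : MvPolynomial (Fin 2) ℝ) ≠ 0 := fun h => by
    have := congrArg (eval ![(1 : ℝ), 0]) h
    simp at this
  obtain ⟨p, hp, h⟩ := exists_eval_ne_zero_of_isOpen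
    (mul_ne_zero hc (mul_ne_zero (mul_ne_zero (X_ne_zero 0) (X_ne_zero 1)) h01)) hV hne
  simp only [map_mul, map_sub, eval_X, Matrix.cons_val_zero, Matrix.cons_val_one, mul_ne_zero_iff,
    sub_ne_zero] at h
  exact ⟨p, hp, ⟨h.2.1.1, h.2.1.2, h.2.2⟩, h.1⟩

theorem exists_mem_coneGeneric_of_eventually {p : ℝ × ℝ} {P : ℝ × ℝ → Prop}
    (h : ∀ᶠ q in 𝓝 p, P q) : ∃ q ∈ coneGeneric, P q := by
  obtain ⟨V, hV, hVo, hpV⟩ := eventually_nhds_iff.1 h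
  obtain ⟨q, hq, hg, -⟩ := exists_mem_coneGeneric (one_ne_zero) hVo ⟨p, hpV⟩
  exact ⟨q, hg, hV q hq⟩

theorem neBot_nhdsWithin_coneGeneric (p : ℝ × ℝ) : (𝓝[coneGeneric] p).NeBot := by
  rw [← mem_closure_iff_nhdsWithin_neBot, mem_closure_iff_nhds]
  intro t ht
  obtain ⟨q, hq, hqt⟩ := exists_mem_coneGeneric_of_eventually ht
  exact ⟨q, hqt, hq⟩

theorem field_coeff_unique {p : ℝ × ℝ} (hp : p ∈ coneGeneric) {z w z' w' : ℝ}
    (h : z • fieldPhi p + w • fieldPsi p = z' • fieldPhi p + w' • fieldPsi p) :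
    z = z' ∧ w = w' := by
  obtain ⟨hx, hy, hxy⟩ := hp
  have hd := sub_ne_zero.2 hxy
  have h1 := congrArg Prod.fst h
  have h2 := congrArg Prod.snd h
  simp only [fieldPhi, fieldPsi, Prod.fst_add, Prod.snd_add, Prod.smul_fst, Prod.smul_snd,
    smul_eq_mul] at h1 h2
  field_simp at h1 h2
  have hz : z = z' := by
    have h0 : 6 * p.1 ^ 2 * (p.1 - p.2) ^ 2 ≠ 0 := by positivity
    apply mul_left_cancel₀ h0
    linear_combination (3 * p.1 - 2 * p.2) * h1 + p.2 * h2
  subst hz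
  refine ⟨rfl, ?_⟩
  have h0 : p.2 ^ 3 ≠ 0 := pow_ne_zero 3 hy
  apply mul_left_cancel₀ h0
  linear_combination -h1

section Classification

variable {U : Set (ℝ × ℝ)} {η Y : ℝ × ℝ → ℝ × ℝ}

/-- Near `p`, off the axes and the diagonal, `Y` is the combination of the vector fields of `φ`
and `ψ` with the coefficients `z` and `w`. -/
def IsFieldCombNear (Y : ℝ × ℝ → ℝ × ℝ) (p : ℝ × ℝ) (z w : ℝ) : Prop :=
  ∀ᶠ q in 𝓝 p, q ∈ coneGeneric → Y q = z • fieldPhi q + w • fieldPsi q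

theorem IsFieldCombNear.unique {p : ℝ × ℝ} {z w z' w' : ℝ} (h : IsFieldCombNear Y p z w)
    (h' : IsFieldCombNear Y p z' w') : z = z' ∧ w = w' := by
  obtain ⟨q, hq, h1, h2⟩ := exists_mem_coneGeneric_of_eventually (h.and h')
  exact field_coeff_unique hq ((h1 hq).symm.trans (h2 hq))

/-- The coefficients depend only on the direction of `p`, as all fields are homogeneous. -/
theorem IsFieldCombNear.of_smul (hη : IsProjectiveFlow U η) (hY : HasVectorField U η Y)
    {p : ℝ × ℝ} (hp : p ∈ U) {t : ℝ} (ht : t ≠ 0) {z w : ℝ}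
    (h : IsFieldCombNear Y (t • p) z w) : IsFieldCombNear Y p z w := by
  have h1 : Tendsto (fun q : ℝ × ℝ => t • q) (𝓝 p) (𝓝 (t • p)) :=
    (continuous_const_smul t).tendsto p
  filter_upwards [h1.eventually h, hη.cone.1.mem_nhds hp] with q hq hqU hqg
  have hg : t • q ∈ coneGeneric := isOpenCone_coneGeneric.2.2 q hqg t ht
  have h2 := hq hg
  rw [hη.field_smul hY hqU ht, fieldPhi_smul, fieldPsi_smul _ ht, smul_comm z, smul_comm w,
    ← smul_add] at h2
  exact smul_right_injective _ (pow_ne_zero 2 ht) h2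

theorem exists_field_eq_of_subset (hη : IsProjectiveFlow U η) (hY : HasVectorField U η Y)
    (hc : FlowsCommute U phi η) {W : Set (ℝ × ℝ)} (hW : W ⊆ U) (hWg : W ⊆ coneGeneric)
    (hWo : IsOpen W) (hWc : IsPreconnected W) :
    ∃ z w : ℝ, ∀ q ∈ W, Y q = z • fieldPhi q + w • fieldPsi q :=
  exists_field_eq (V := U ∩ coneGeneric) Set.inter_subset_right
    (hη.mono (hη.cone.inter isOpenCone_coneGeneric) Set.inter_subset_left)
    (fun p hp => hY p hp.1) (fun p hp => hc p hp.1) (Set.subset_inter hW hWg) hWo hWc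

theorem exists_field_eq_half (hη : IsProjectiveFlow U η) (hY : HasVectorField U η Y)
    (hc : FlowsCommute U phi η) {p : ℝ × ℝ} (hp : p ∈ U) (l : ℝ × ℝ →L[ℝ] ℝ)
    (hl : ∀ᶠ q in 𝓝 p, l q ≠ 0 → q ∈ coneGeneric) :
    ∃ z w : ℝ, ∀ᶠ q in 𝓝 p, 0 < l q → Y q = z • fieldPhi q + w • fieldPsi q := by
  obtain ⟨ε, hε, h⟩ := Metric.eventually_nhds_iff_ball.1 (hl.and (hη.cone.1.mem_nhds hp))
  obtain ⟨z, w, hzw⟩ := exists_field_eq_of_subset hη hY hc (W := Metric.ball p ε ∩ {q | 0 < l q})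
    (fun q hq => (h q hq.1).2) (fun q hq => (h q hq.1).1 hq.2.ne')
    (Metric.isOpen_ball.inter (isOpen_lt continuous_const l.continuous))
    ((convex_ball p ε).inter (convex_halfSpace_gt l.toLinearMap.isLinear 0)).isPreconnected
  refine ⟨z, w, ?_⟩
  filter_upwards [Metric.ball_mem_nhds p hε] with q hq hpos
  exact hzw q ⟨hq, hpos⟩

theorem exists_field_eq_sides (hη : IsProjectiveFlow U η) (hY : HasVectorField U η Y)
    (hc : FlowsCommute U phi η) {p : ℝ × ℝ} (hp : p ∈ U) (l : ℝ × ℝ →L[ℝ] ℝ)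
    (hl : ∀ᶠ q in 𝓝 p, l q ≠ 0 → q ∈ coneGeneric) :
    ∃ z w z' w' : ℝ, (∀ᶠ q in 𝓝 p, 0 < l q → Y q = z • fieldPhi q + w • fieldPsi q) ∧
      ∀ᶠ q in 𝓝 p, l q < 0 → Y q = z' • fieldPhi q + w' • fieldPsi q := by
  obtain ⟨z, w, h⟩ := exists_field_eq_half hη hY hc hp l hl
  obtain ⟨z', w', h'⟩ := exists_field_eq_half hη hY hc hp (-l) (hl.mono fun q hq hq' =>
    hq (neg_ne_zero.1 hq'))
  exact ⟨z, w, z', w', h, h'.mono fun q hq hq' => hq (neg_pos.2 hq')⟩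

theorem isFieldCombNear_of_sides {p : ℝ × ℝ} {l : ℝ × ℝ →L[ℝ] ℝ} {z w : ℝ}
    (hl : ∀ᶠ q in 𝓝 p, q ∈ coneGeneric → l q ≠ 0)
    (h1 : ∀ᶠ q in 𝓝 p, 0 < l q → Y q = z • fieldPhi q + w • fieldPsi q)
    (h2 : ∀ᶠ q in 𝓝 p, l q < 0 → Y q = z • fieldPhi q + w • fieldPsi q) :
    IsFieldCombNear Y p z w := by
  filter_upwards [hl, h1, h2] with q k1 k2 k3 hq
  rcases lt_or_gt_of_ne (k1 hq) with h | h
  exacts [k3 h, k2 h]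

open Polynomial in
/-- The combinations on the two sides of the axis `y = 0` or of the diagonal agree, as the first
coordinate of the field, cleared of denominators, is a polynomial on vertical lines. -/
theorem exists_isFieldCombNear_vertical (hη : IsProjectiveFlow U η) (hY : HasVectorField U η Y)
    (hc : FlowsCommute U phi η) {x c : ℝ} (hp : (x, c * x) ∈ U) (hx : x ≠ 0)
    (h01 : c = 0 ∨ c = 1) :
    ∃ z w : ℝ, IsFieldCombNear Y (x, c * x) z w ∧ (c = 1 → w = 0) := by
  let l : ℝ × ℝ →L[ℝ] ℝ := ContinuousLinearMap.snd ℝ ℝ ℝ - c • ContinuousLinearMap.fst ℝ ℝ ℝ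
  have hlq : ∀ q : ℝ × ℝ, l q = q.2 - c * q.1 := fun q => rfl
  have hg : ∀ᶠ q : ℝ × ℝ in 𝓝 (x, c * x), (q ∈ coneGeneric ↔ l q ≠ 0) := by
    have e1 : ∀ᶠ q : ℝ × ℝ in 𝓝 (x, c * x), q.1 ≠ 0 :=
      continuous_fst.continuousAt.eventually_ne hx
    -- the other one of the two lines
    have e2 : ∀ᶠ q : ℝ × ℝ in 𝓝 (x, c * x), q.2 - (1 - c) * q.1 ≠ 0 := by
      refine ContinuousAt.eventually_ne (g := fun q : ℝ × ℝ => q.2 - (1 - c) * q.1)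
        (by fun_prop) ?_
      rcases h01 with rfl | rfl <;> simpa using hx
    filter_upwards [e1, e2] with q k1 k2
    rw [hlq]
    simp only [coneGeneric, Set.mem_ofPred_eq]
    rcases h01 with rfl | rfl
    · simp only [sub_zero, one_mul, zero_mul] at k2 ⊢
      exact ⟨fun h => h.2.1, fun h => ⟨k1, h, fun h' => k2 (sub_eq_zero.2 h'.symm)⟩⟩
    · simp only [sub_self, zero_mul, sub_zero, one_mul] at k2 ⊢
      exact ⟨fun h => sub_ne_zero.2 h.2.2.symm, fun h => ⟨k1, k2, (sub_ne_zero.1 h).symm⟩⟩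
  obtain ⟨z, w, z', w', h1, h2⟩ := exists_field_eq_sides hη hY hc hp l
    (hg.mono fun q hq => hq.2)
  let P : ℝ → ℝ → ℝ[X] := fun z w =>
    C z * (C (2 * x ^ 2) + C x * X) * (C x - X) ^ 2 - C (w * x) * X ^ 3
  have hline : Tendsto (fun s : ℝ => (x, s)) (𝓝 (c * x)) (𝓝 (x, c * x)) :=
    (Continuous.prodMk_right x).tendsto _
  have hP : ∀ {z w s : ℝ}, (x, s) ∈ coneGeneric →
      Y (x, s) = z • fieldPhi (x, s) + w • fieldPsi (x, s) →
      (Y (x, s)).1 * (x - s) ^ 2 = (P z w).eval s := by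
    intro z w s hs h
    have hd : x - s ≠ 0 := sub_ne_zero.2 hs.2.2
    rw [h]
    simp only [fieldPhi, fieldPsi, Prod.fst_add, Prod.smul_fst, smul_eq_mul, P, eval_sub, eval_mul,
      eval_add, eval_pow, eval_C, eval_X]
    field_simp
    ring
  have hsmooth : ContDiffAt ℝ ∞ (fun s : ℝ => (Y (x, s)).1 * (x - s) ^ 2) (c * x) := by
    have hYs : ContDiffAt ℝ ∞ (fun s : ℝ => Y (x, s)) (c * x) :=
      ContDiffAt.comp (c * x) (f := fun s : ℝ => (x, s)) (hη.contDiffAt_field hY hp)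
        (by fun_prop)
    exact hYs.fst.mul (by fun_prop)
  have r1 : ∀ᶠ s in 𝓝[>] (c * x), (Y (x, s)).1 * (x - s) ^ 2 = (P z w).eval s := by
    filter_upwards [nhdsWithin_le_nhds (hline.eventually (h1.and hg)), self_mem_nhdsWithin]
      with s hs hsc
    have hpos : 0 < l (x, s) := sub_pos.2 hsc
    exact hP (hs.2.2 hpos.ne') (hs.1 hpos)
  have r2 : ∀ᶠ s in 𝓝[<] (c * x), (Y (x, s)).1 * (x - s) ^ 2 = (P z' w').eval s := by
    filter_upwards [nhdsWithin_le_nhds (hline.eventually (h2.and hg)), self_mem_nhdsWithin]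
      with s hs hsc
    have hneg : l (x, s) < 0 := sub_neg.2 hsc
    exact hP (hs.2.2 hneg.ne) (hs.1 hneg)
  have hPP := polynomial_eq_of_contDiffAt (max (P z w).natDegree (P z' w').natDegree)
    (le_max_left _ _) (le_max_right _ _) hsmooth r1 r2
  have hw : w = w' := by
    have := congrArg (eval x) hPP
    simp only [P, eval_sub, eval_mul, eval_add, eval_pow, eval_C, eval_X] at this
    apply mul_left_cancel₀ (pow_ne_zero 4 hx)
    linear_combination -this
  have hz : z = z' := by
    have := congrArg (eval 0) hPP
    simp only [P, eval_sub, eval_mul, eval_add, eval_pow, eval_C, eval_X] at this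
    apply mul_left_cancel₀ (pow_ne_zero 4 hx)
    linear_combination this / 2
  subst hw hz
  refine ⟨z, w, isFieldCombNear_of_sides (hg.mono fun q hq => hq.1) h1 h2, ?_⟩
  rintro rfl
  -- the field of `ψ` has a pole along the diagonal
  have e := tendsto_nhds_unique ((hsmooth.continuousAt.mono_left nhdsWithin_le_nhds).congr' r1)
    ((P z w).continuous.continuousAt.mono_left nhdsWithin_le_nhds)
  simp only [P, eval_sub, eval_mul, eval_add, eval_pow, eval_C, eval_X] at e
  refine (mul_eq_zero.1 ?_).resolve_right (pow_ne_zero 4 hx)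
  linear_combination e

open Polynomial in
/-- The combinations on the two sides of the axis `x = 0` agree, as the second coordinate of the
field, cleared of denominators, is a polynomial on horizontal lines. -/
theorem exists_isFieldCombNear_horizontal (hη : IsProjectiveFlow U η) (hY : HasVectorField U η Y)
    (hc : FlowsCommute U phi η) {y : ℝ} (hp : ((0 : ℝ), y) ∈ U) (hy : y ≠ 0) :
    ∃ z w : ℝ, IsFieldCombNear Y (0, y) z w := by
  let l : ℝ × ℝ →L[ℝ] ℝ := ContinuousLinearMap.fst ℝ ℝ ℝ
  have hlq : ∀ q : ℝ × ℝ, l q = q.1 := fun q => rfl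
  have hg : ∀ᶠ q : ℝ × ℝ in 𝓝 (0, y), (q ∈ coneGeneric ↔ l q ≠ 0) := by
    have e1 : ∀ᶠ q : ℝ × ℝ in 𝓝 (0, y), q.2 ≠ 0 :=
      continuous_snd.continuousAt.eventually_ne hy
    have e2 : ∀ᶠ q : ℝ × ℝ in 𝓝 (0, y), q.1 - q.2 ≠ 0 :=
      ContinuousAt.eventually_ne (g := fun q : ℝ × ℝ => q.1 - q.2) (by fun_prop) (by simpa using hy)
    filter_upwards [e1, e2] with q k1 k2
    exact ⟨fun h => h.1, fun h => ⟨h, k1, sub_ne_zero.1 k2⟩⟩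
  obtain ⟨z, w, z', w', h1, h2⟩ := exists_field_eq_sides hη hY hc hp l
    (hg.mono fun q hq => hq.2)
  let P : ℝ → ℝ → ℝ[X] := fun z w =>
    C z * (C y * X + C (2 * y ^ 2)) * (X - C y) ^ 2 + C w * (C (3 * y ^ 3) * X - C (2 * y ^ 4))
  have hline : Tendsto (fun s : ℝ => (s, y)) (𝓝 0) (𝓝 (0, y)) :=
    (Continuous.prodMk_left y).tendsto _
  have hP : ∀ {z w s : ℝ}, (s, y) ∈ coneGeneric →
      Y (s, y) = z • fieldPhi (s, y) + w • fieldPsi (s, y) →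
      (Y (s, y)).2 * (s - y) ^ 2 = (P z w).eval s := by
    intro z w s hs h
    have hd : s - y ≠ 0 := sub_ne_zero.2 hs.2.2
    rw [h]
    simp only [fieldPhi, fieldPsi, Prod.snd_add, Prod.smul_snd, smul_eq_mul, P, eval_sub, eval_mul,
      eval_add, eval_pow, eval_C, eval_X]
    field_simp
  have hsmooth : ContDiffAt ℝ ∞ (fun s : ℝ => (Y (s, y)).2 * (s - y) ^ 2) 0 := by
    have hYs : ContDiffAt ℝ ∞ (fun s : ℝ => Y (s, y)) 0 :=
      ContDiffAt.comp 0 (f := fun s : ℝ => (s, y)) (hη.contDiffAt_field hY hp) (by fun_prop)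
    exact hYs.snd.mul (by fun_prop)
  have r1 : ∀ᶠ s in 𝓝[>] (0 : ℝ), (Y (s, y)).2 * (s - y) ^ 2 = (P z w).eval s := by
    filter_upwards [nhdsWithin_le_nhds (hline.eventually (h1.and hg)), self_mem_nhdsWithin]
      with s hs hsc
    have hpos : 0 < l (s, y) := hsc
    exact hP (hs.2.2 hpos.ne') (hs.1 hpos)
  have r2 : ∀ᶠ s in 𝓝[<] (0 : ℝ), (Y (s, y)).2 * (s - y) ^ 2 = (P z' w').eval s := by
    filter_upwards [nhdsWithin_le_nhds (hline.eventually (h2.and hg)), self_mem_nhdsWithin]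
      with s hs hsc
    have hneg : l (s, y) < 0 := hsc
    exact hP (hs.2.2 hneg.ne) (hs.1 hneg)
  have hPP := polynomial_eq_of_contDiffAt (max (P z w).natDegree (P z' w').natDegree)
    (le_max_left _ _) (le_max_right _ _) hsmooth r1 r2
  have hw : w = w' := by
    have := congrArg (eval y) hPP
    simp only [P, eval_sub, eval_mul, eval_add, eval_pow, eval_C, eval_X] at this
    apply mul_left_cancel₀ (pow_ne_zero 4 hy)
    linear_combination this
  subst hw
  have hz : z = z' := by
    have := congrArg (eval 0) hPP
    simp only [P, eval_sub, eval_mul, eval_add, eval_pow, eval_C, eval_X] at this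
    apply mul_left_cancel₀ (pow_ne_zero 4 hy)
    linear_combination this / 2
  subst hz
  exact ⟨z, w, isFieldCombNear_of_sides (hg.mono fun q hq => hq.1) h1 h2⟩

theorem exists_isFieldCombNear (hη : IsProjectiveFlow U η) (hY : HasVectorField U η Y)
    (hc : FlowsCommute U phi η) {p : ℝ × ℝ} (hp : p ∈ U) :
    ∃ z w : ℝ, IsFieldCombNear Y p z w ∧ (p.1 = p.2 → w = 0) := by
  obtain ⟨x, y⟩ := p
  have hp0 : (x, y) ≠ (0 : ℝ × ℝ) := fun h => hη.cone.2.1 (h ▸ hp)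
  rcases eq_or_ne x 0 with rfl | hx
  · have hy : y ≠ 0 := fun h => hp0 (by rw [h]; rfl)
    obtain ⟨z, w, h⟩ := exists_isFieldCombNear_horizontal hη hY hc hp hy
    exact ⟨z, w, h, fun h => absurd h.symm hy⟩
  rcases eq_or_ne y 0 with rfl | hy
  · obtain ⟨z, w, h, -⟩ := exists_isFieldCombNear_vertical hη hY hc (x := x) (c := 0)
      (by rwa [zero_mul]) hx (Or.inl rfl)
    rw [zero_mul] at h
    exact ⟨z, w, h, fun h => absurd h hx⟩
  rcases eq_or_ne x y with rfl | hxy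
  · obtain ⟨z, w, h, h'⟩ := exists_isFieldCombNear_vertical hη hY hc (x := x) (c := 1)
      (by rwa [one_mul]) hx (Or.inr rfl)
    rw [one_mul] at h
    exact ⟨z, w, h, fun _ => h' rfl⟩
  · have hg : (x, y) ∈ coneGeneric := ⟨hx, hy, hxy⟩
    obtain ⟨ε, hε, hball⟩ := Metric.isOpen_iff.1 (hη.cone.1.inter isOpenCone_coneGeneric.1) _
      ⟨hp, hg⟩
    obtain ⟨z, w, h⟩ := exists_field_eq_of_subset hη hY hc (fun q hq => (hball hq).1)
      (fun q hq => (hball hq).2) Metric.isOpen_ball (convex_ball (x, y) ε).isPreconnected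
    refine ⟨z, w, ?_, fun h => absurd h hxy⟩
    filter_upwards [Metric.ball_mem_nhds (x, y) hε] with q hq _
    exact h q hq

/-- The coefficients are locally constant, hence constant on a connected set which meets all
directions. -/
theorem exists_isFieldCombNear_of_connected (hη : IsProjectiveFlow U η)
    (hY : HasVectorField U η Y) (hc : FlowsCommute U phi η) (hU : HasConnectedDirections U) :
    ∃ z w : ℝ, ∀ p ∈ U, IsFieldCombNear Y p z w := by
  obtain ⟨S, hSU, hS, hdir⟩ := hU
  choose z w hzw _ using fun p : S => exists_isFieldCombNear hη hY hc (hSU p.2)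
  have hloc : IsLocallyConstant fun p : S => (z p, w p) := by
    rw [IsLocallyConstant.iff_eventually_eq]
    intro p
    have h1 : ∀ᶠ q in 𝓝 (p : ℝ × ℝ), IsFieldCombNear Y q (z p) (w p) :=
      eventually_eventually_nhds.2 (hzw p)
    filter_upwards [continuous_subtype_val.continuousAt.eventually h1] with q hq
    exact Prod.ext (hzw q |>.unique hq).1 (hzw q |>.unique hq).2
  have : PreconnectedSpace S := isPreconnected_iff_preconnectedSpace.1 hS
  rcases S.eq_empty_or_nonempty with rfl | ⟨p₀, hp₀⟩
  · refine ⟨0, 0, fun p hp => ?_⟩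
    obtain ⟨t, -, ht⟩ := hdir p hp
    exact ht.elim
  refine ⟨z ⟨p₀, hp₀⟩, w ⟨p₀, hp₀⟩, fun p hp => ?_⟩
  obtain ⟨t, ht0, ht⟩ := hdir p hp
  have e := hloc.apply_eq_of_preconnectedSpace ⟨t • p, ht⟩ ⟨p₀, hp₀⟩
  simp only [Prod.mk.injEq] at e
  have h := hzw ⟨t • p, ht⟩
  rw [e.1, e.2] at h
  exact IsFieldCombNear.of_smul hη hY hp ht0 h

open MvPolynomial in
/-- A rational field which is a combination of the fields of `φ` and `ψ` near one point is the
same combination everywhere. -/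
theorem exists_isFieldCombNear_of_rational (hη : IsProjectiveFlow U η)
    (hY : HasVectorField U η Y) (hc : FlowsCommute U phi η) (hU : IsRationalField U Y) :
    ∃ z w : ℝ, ∀ p ∈ U, IsFieldCombNear Y p z w := by
  obtain ⟨P₁, P₂, Q, hQ, hPQ⟩ := hU
  rcases U.eq_empty_or_nonempty with rfl | ⟨p₀, hp₀⟩
  · exact ⟨0, 0, fun p hp => hp.elim⟩
  obtain ⟨z, w, h0, -⟩ := exists_isFieldCombNear hη hY hc hp₀
  refine ⟨z, w, fun p hp => ?_⟩
  -- the two coordinates of `Q (x - y)² (z fieldPhi + w fieldPsi - Y)`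
  let D₁ : MvPolynomial (Fin 2) ℝ := Q * (C z * (C 2 * X 0 ^ 2 + X 0 * X 1) * (X 0 - X 1) ^ 2 -
    C w * (X 0 * X 1 ^ 3)) - P₁ * (X 0 - X 1) ^ 2
  let D₂ : MvPolynomial (Fin 2) ℝ := Q * (C z * (X 0 * X 1 + C 2 * X 1 ^ 2) * (X 0 - X 1) ^ 2 +
    C w * (C 3 * X 0 * X 1 ^ 3 - C 2 * X 1 ^ 4)) - P₂ * (X 0 - X 1) ^ 2
  have key : ∀ q ∈ coneGeneric, q ∈ U → eval ![q.1, q.2] Q ≠ 0 →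
      (Y q = z • fieldPhi q + w • fieldPsi q ↔
        eval ![q.1, q.2] D₁ = 0 ∧ eval ![q.1, q.2] D₂ = 0) := by
    intro q hq hqU hQq
    have hd := sub_ne_zero.2 hq.2.2
    have e1 := (hPQ q hqU).1
    have e2 := (hPQ q hqU).2
    have hd2 : eval ![q.1, q.2] Q * (q.1 - q.2) ^ 2 ≠ 0 := mul_ne_zero hQq (pow_ne_zero 2 hd)
    have f1 : eval ![q.1, q.2] D₁ = eval ![q.1, q.2] Q * (q.1 - q.2) ^ 2 *
        ((z • fieldPhi q + w • fieldPsi q).1 - (Y q).1) := by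
      simp only [D₁, map_sub, map_mul, map_add, map_pow, eval_C, eval_X, Matrix.cons_val_zero,
        Matrix.cons_val_one, fieldPhi, fieldPsi, Prod.fst_add, Prod.smul_fst, smul_eq_mul, ← e1]
      field_simp
      ring
    have f2 : eval ![q.1, q.2] D₂ = eval ![q.1, q.2] Q * (q.1 - q.2) ^ 2 *
        ((z • fieldPhi q + w • fieldPsi q).2 - (Y q).2) := by
      simp only [D₂, map_sub, map_mul, map_add, map_pow, eval_C, eval_X, Matrix.cons_val_zero,
        Matrix.cons_val_one, fieldPhi, fieldPsi, Prod.snd_add, Prod.smul_snd, smul_eq_mul, ← e2]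
      field_simp
    rw [f1, f2, mul_eq_zero_iff_left hd2, mul_eq_zero_iff_left hd2, sub_eq_zero, sub_eq_zero,
      Prod.ext_iff, eq_comm, @eq_comm _ (Y q).2]
  obtain ⟨V, hV, hVo, hpV⟩ := eventually_nhds_iff.1 (h0.and (hη.cone.1.mem_nhds hp₀))
  have hzero : ∀ D : MvPolynomial (Fin 2) ℝ, (∀ q ∈ V, q ∈ coneGeneric → eval ![q.1, q.2] Q ≠ 0 →
      eval ![q.1, q.2] D = 0) → D = 0 := by
    intro D hD
    by_contra hne
    obtain ⟨q, hq, hqg, h⟩ := exists_mem_coneGeneric (mul_ne_zero hne hQ) hVo ⟨p₀, hpV⟩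
    rw [map_mul, mul_ne_zero_iff] at h
    exact h.1 (hD q hq hqg h.2)
  have z1 : D₁ = 0 := hzero D₁ fun q hq hqg hQq =>
    ((key q hqg (hV q hq).2 hQq).1 ((hV q hq).1 hqg)).1
  have z2 : D₂ = 0 := hzero D₂ fun q hq hqg hQq =>
    ((key q hqg (hV q hq).2 hQq).1 ((hV q hq).1 hqg)).2
  obtain ⟨z', w', h', -⟩ := exists_isFieldCombNear hη hY hc hp
  obtain ⟨V', hV', hVo', hpV'⟩ := eventually_nhds_iff.1 (h'.and (hη.cone.1.mem_nhds hp))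
  obtain ⟨q, hq, hqg, hQq⟩ := exists_mem_coneGeneric hQ hVo' ⟨p, hpV'⟩
  have e := (key q hqg (hV' q hq).2 hQq).2 (by rw [z1, z2]; simp)
  obtain ⟨rfl, rfl⟩ := field_coeff_unique hqg (e.symm.trans ((hV' q hq).1 hqg))
  exact h'

theorem field_eq_of_isFieldCombNear {θ : ℝ × ℝ → ℝ × ℝ} {p : ℝ × ℝ} {z w : ℝ}
    (hY : ContinuousAt Y p) (hθ : ContinuousAt θ p)
    (hw : ∀ q ∈ coneGeneric, θ q = z • fieldPhi q + w • fieldPsi q)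
    (h : IsFieldCombNear Y p z w) : Y p = θ p := by
  have := neBot_nhdsWithin_coneGeneric p
  refine tendsto_nhds_unique (hY.mono_left nhdsWithin_le_nhds : Tendsto Y (𝓝[coneGeneric] p) _)
    ((hθ.mono_left nhdsWithin_le_nhds).congr' ?_)
  filter_upwards [nhdsWithin_le_nhds h, self_mem_nhdsWithin] with q h1 h2
  rw [h1 h2, hw q h2]

theorem nearZero_eq_compIter_of_field_eq (hη : IsProjectiveFlow U η) (hY : HasVectorField U η Y)
    {z : ℝ} (h : ∀ p ∈ U, Y p = z • fieldPhi p) :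
    NearZero U fun p => η p = compIter phi psi z 0 p := by
  intro p hp
  have hp' : p ∈ conePhi := fun h0 => hη.cone.2.1 (h0 ▸ hp)
  have hX := hη.isQuadraticField hY
  have hreg : ∀ᶠ u in 𝓝 ((0 : ℝ), p), iter phi (z * u.1) u.2 ∈ U ∧
      HasDerivAt (fun s => iter phi (z * s) u.2) (Y (iter phi (z * u.1) u.2)) u.1 := by
    have h1 := (tendsto_mul_prodMk z p).eventually (iter_phi_regular hp')
    have h2 := ((isProjectiveFlow_phi.tendsto_iter hp').comp (tendsto_mul_prodMk z p)).eventually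
      (hη.cone.1.mem_nhds hp)
    filter_upwards [h1, h2] with u k1 k2
    refine ⟨k2, ?_⟩
    rw [show Y (iter phi (z * u.1) u.2) = _ from h _ k2]
    have d := (hasDerivAt_id u.1).const_mul z
    rw [mul_one] at d
    exact HasDerivAt.scomp (g₁ := fun s => iter phi s u.2) u.1 k1.2.2 d
  have h1 := eventually_iter_flowMap_eq hX (g := fun s q => iter phi (z * s) q)
    (fun q => by rw [mul_zero, iter_zero]) hreg
  filter_upwards [h1, hη.eventually_iter_eq hY hX hp] with u k1 k2 h0
  rw [apply_smul_eq_smul_iter h0 η, ← k2, k1, compIter, iter_zero, iter_smul h0]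

/-- A flow whose vector field is a combination of the fields of `φ` and `ψ` is a composition of
iterates of `φ` and `ψ`. If the flow lives on the diagonal too, then `ψ` does not occur. -/
theorem nearZero_eq_compIter (hη : IsProjectiveFlow U η) (hY : HasVectorField U η Y)
    (hc : FlowsCommute U phi η) {z w : ℝ} (h : ∀ p ∈ U, IsFieldCombNear Y p z w) :
    NearZero U fun p => η p = compIter phi psi z w p := by
  by_cases hU : U ⊆ conePsi
  · refine hη.nearZero_eq ((isProjectiveFlow_compIter z w).mono hη.cone hU) hY fun p hp => ?_
    rw [field_eq_of_isFieldCombNear (hη.contDiffAt_field hY hp).continuousAt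
      (θ := fun q => z • fieldPhi q + w • fieldPsi q)
      ((contDiff_fieldPhi (n := 1)).continuous.continuousAt.const_smul z |>.add
        ((contDiffAt_fieldPsi (n := 1) (hU hp)).continuousAt.const_smul w)) (fun _ _ => rfl)
      (h p hp)]
    exact hasVectorField_compIter z w p (hU hp)
  · obtain ⟨p, hp, hpd⟩ := Set.not_subset.1 hU
    obtain ⟨z', w', h', hw'⟩ := exists_isFieldCombNear hη hY hc hp
    have hw : w = 0 := ((h p hp).unique h').2.trans (hw' (not_not.1 hpd))
    subst hw
    exact nearZero_eq_compIter_of_field_eq hη hY fun p hp =>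
      field_eq_of_isFieldCombNear (hη.contDiffAt_field hY hp).continuousAt
        ((contDiff_fieldPhi (n := 1)).continuous.continuousAt.const_smul z)
        (fun q _ => by simp) (h p hp)

theorem exists_nearZero_eq_compIter (hη : IsProjectiveFlow U η)
    (hU : HasConnectedDirections U ∨ ∃ Y, HasVectorField U η Y ∧ IsRationalField U Y)
    (hc : FlowsCommute U phi η) : ∃ z w : ℝ, NearZero U fun p => η p = compIter phi psi z w p := by
  rcases hU with hU | ⟨Y, hY, hU⟩
  · have hY := hη.hasVectorField_deriv
    obtain ⟨z, w, h⟩ := exists_isFieldCombNear_of_connected hη hY hc hU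
    exact ⟨z, w, nearZero_eq_compIter hη hY hc h⟩
  · obtain ⟨z, w, h⟩ := exists_isFieldCombNear_of_rational hη hY hc hU
    exact ⟨z, w, nearZero_eq_compIter hη hY hc h⟩

end Classification

theorem mainTheorem5 :
    ∃ φ ψ : ℝ × ℝ → ℝ × ℝ,
      -- the flow `φ = u • v`, with `v(x,y) = u(y,x)`, its vector field and its orbits
      IsProjectiveFlow conePhi φ ∧
      HasVectorField conePhi φ fieldPhi ∧
      (NearZero conePhi fun p => (φ p).2 = (φ (p.2, p.1)).1) ∧
      OrbitsGivenBy conePhi φ (fun p => p.1 ^ 2 * p.2 ^ 2) (fun p => (p.1 - p.2) ^ 3) ∧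
      -- the radical formula: with real radicals, and in general with suitable complex ones
      (NearZero coneReal fun p => φ p = (cardanoU p.1 p.2, cardanoU p.2 p.1)) ∧
      (NearZero {p | p.1 - 3 * p.2 ≠ 0 ∧ p.2 - 3 * p.1 ≠ 0} fun p =>
        IsCardanoValue p.1 p.2 (φ p).1 ∧ IsCardanoValue p.2 p.1 (φ p).2) ∧
      -- the flow `ψ = a • b`, its vector field and its orbits
      IsProjectiveFlow conePsi ψ ∧
      HasVectorField conePsi ψ fieldPsi ∧
      OrbitsGivenBy conePsi ψ (fun p => p.1 ^ 2) (fun p => 3 * p.1 - p.2) ∧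
      -- the equations for `a` and `b`
      (NearZero coneGeneric fun p => CubicEquation (ψ p).1 p.1 p.2 ∧
        (ψ p).2 = (ψ p).1 ^ 2 * (p.2 - 3 * p.1) / p.1 ^ 2 + 3 * (ψ p).1) ∧
      -- the branch `a` of the cubic equation is determined by the boundary condition
      (∀ g : ℝ × ℝ → ℝ,
        (∀ p ∈ coneGeneric, Tendsto (fun q : ℝ × (ℝ × ℝ) => q.1⁻¹ * g (q.1 • q.2))
          (𝓝 ((0 : ℝ), p) ⊓ 𝓟 {q | q.1 ≠ 0}) (𝓝 p.1)) →
        (NearZero coneGeneric fun p => CubicEquation (g p) p.1 p.2) →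
        NearZero coneGeneric fun p => g p = (ψ p).1) ∧
      -- `a` and `b` are algebraic functions of degree three
      IsAlgebraicOfDegree coneGeneric (fun p => (ψ p).1) 3 ∧
      IsAlgebraicOfDegree coneGeneric (fun p => (ψ p).2) 3 ∧
      -- the two flows commute
      FlowsCommute conePsi φ ψ ∧
      -- the maps `φ^z ∘ ψ^w` are projective flows commuting with `φ`; their orbits
      (∀ z w : ℝ,
        IsProjectiveFlow conePsi (compIter φ ψ z w) ∧
        HasVectorField conePsi (compIter φ ψ z w) (fun p => z • fieldPhi p + w • fieldPsi p) ∧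
        FlowsCommute conePsi φ (compIter φ ψ z w) ∧
        OrbitsGivenBy conePsi (compIter φ ψ z w) (fun p => p.1 ^ 2 * p.2 ^ 2)
          (fun p => z * (p.2 - p.1) ^ 3 + w * p.2 ^ 2 * (3 * p.1 - p.2))) ∧
      -- every projective flow commuting with `φ` is of this form
      (∀ (U : Set (ℝ × ℝ)) (η : ℝ × ℝ → ℝ × ℝ),
        IsProjectiveFlow U η →
        (HasConnectedDirections U ∨ ∃ Y, HasVectorField U η Y ∧ IsRationalField U Y) →
        FlowsCommute U φ η →
        ∃ z w : ℝ, NearZero U fun p => η p = compIter φ ψ z w p) := by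
  refine ⟨phi, psi, isProjectiveFlow_phi, hasVectorField_phi, nearZero_phi_symm, orbits_phi,
    nearZero_cardanoU, nearZero_isCardanoValue, isProjectiveFlow_psi, hasVectorField_psi,
    orbits_psi, nearZero_cubicEquation, cubicEquation_unique, isAlgebraicOfDegree_psi_fst,
    isAlgebraicOfDegree_psi_snd, flowsCommute_phi_psi, fun z w =>
      ⟨isProjectiveFlow_compIter z w, hasVectorField_compIter z w, flowsCommute_phi_compIter z w,
        orbits_compIter z w⟩, fun U η hη hU hc => exists_nearZero_eq_compIter hη hU hc⟩
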